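/- Let $m\ge 1$, let $G=I_2(m)$ be the dihedral group of order $2m$ acting on the Euclidean plane $E=\mathbb R^2$ with orthonormal basis $\xi,\eta$ and dual basis $x,y$ of $E^*$, generated by the reflections $s_j$ in the unit vectors $\alpha_j=\sin(\pi j/m)\,\xi-\cos(\pi j/m)\,\eta$, $1\le j\le m$; put $a_j=\sin(\pi j/m)\,x-\cos(\pi j/m)\,y$ and $\omega=e^{2\pi i/m}$. Let $c$ be a real-valued conjugation-invariant function on the reflections, $c_j=c(s_j)$. The rational Cherednik algebra $H_c(G,E)$ is the quotient of $T(E_{\mathbb C}\oplus E_{\mathbb C}^*)\rtimes\mathbb C[G]$ by the relations $[v,v']=0$ for $v,v'\in E_{\mathbb C}$, $[w,w']=0$ for $w,w'\in E_{\mathbb C}^*$, and $[v,w]=\langle w,v\rangle-2\sum_{j=1}^m c_j\langle w,\alpha_j\rangle\langle a_j,v\rangle s_j$. Put $\sigma=\sum_j c_js_j$, fix $\epsilon\in\mathbb R$, and let $\mathfrak u(1,1)$ be realised in $H_c(G,E)$ by $E_+=\tfrac12(x^2+y^2)$, $E_-=-\tfrac12(\xi^2+\eta^2)$, $H=x\xi+y\eta+1-\sigma$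 and the central element $\tilde Z=Z_0+\epsilon\sigma$, where $Z_0=i(x\eta-y\xi)$. Let $\mathcal V$ be the centraliser of $\mathfrak u(1,1)$ in $H_c(G,E)$, and let $L(\mu,\nu)$ be the irreducible lowest weight $\mathfrak u(1,1)$-module of $(H,\tilde Z)$-lowest weight $(\mu,\nu)$. For a representation $\tau$ of $G$ on $V(\tau)$ let $M_c(\tau)=\mathbb C[E]\otimes V(\tau)$ be the standard module, i.e. the $H_c(G,E)$-module induced from $V(\tau)$ on which $E$ acts by zero, and let $M_c(\tau)_k$ be its part of polynomial degree $k$. For $k\ge0$ and $\lambda\in\mathbb R$ let $\mathcal H_c(\tau)_{k,\lambda}$ be the $\lambda$-eigenspace of $\tilde Z$ in $\ker E_-\cap M_c(\tau)_k$. Assume that $M_c(\tau)$ is irreducible and unitarisable, i.e. that it carries a positive definite Hermitian form that is contravariant for the conjugate-linear anti-involution of $H_c(G,E)$ with $\xi^*=x$, $\eta^*=y$, $g^*=g^{-1}$ (this holds for $c$ close to $0$). Then the following holds. (1) Let $\tau=\chi$ be a one-dimensional representation. For $k\in\mathbb Z_{\ge0}$ let $\sigma_{\chi,k}=\sum_{j=1}^m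 c_j\omega^{jk}\chi(s_j)$, which is real, and $N_c(\chi)=\sigma_{\chi,0}$. Put $\lambda_0=\epsilon\,\sigma_{\chi,0}$ and $\lambda_k=\operatorname{sign}(k)\sqrt{(|k|-N_c(\chi))^2-(1-\epsilon^2)\sigma_{\chi,|k|}^2}$ for $k\in\mathbb Z\setminus\{0\}$; the numbers under the roots are non-negative. Then $$M_c(\chi)=\bigoplus_{k\in\mathbb Z}\mathcal H_c(\chi)_{|k|,\lambda_k}\otimes L\bigl(|k|+1-N_c(\chi),\lambda_k\bigr)$$ as a joint $(\mathcal V,\mathfrak u(1,1))$-module, $\mathcal H_c(\chi)_{0,\lambda_0}=1\otimes V(\chi)$, and each $\mathcal H_c(\chi)_{|k|,\lambda_k}$ is a one-dimensional irreducible $\mathcal V$-module. (2) Let $u$ be an integer with $0<2u<m$ and let $\tau=\rho^{(u)}$ be the two-dimensional representation with basis $z,\bar z$ and $s_jz=\omega^{ju}\bar z$, $s_j\bar z=\omega^{-ju}z$. For $n\in\mathbb Z$ let $\sigma_n=\sum_{j=1}^m c_j\omega^{jn}$, which is real, and for $k>0$ let $$\Lambda_k=\Bigl\{\pm\sqrt{k^2-(1-\epsilon^2)\sigma_{k+u}^2},\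 \pm\sqrt{k^2-(1-\epsilon^2)\sigma_{k-u}^2}\Bigr\};$$ the numbers under the roots are non-negative. Then $$M_c(\tau)=V(\tau)\otimes L(1,0)\ \oplus\ \bigoplus_{k>0}\ \bigoplus_{\lambda\in\Lambda_k}\mathcal H_c(\tau)_{k,\lambda}\otimes L(k+1,\lambda)$$ as a joint $(\mathcal V,\mathfrak u(1,1))$-module, where $V(\tau)$ is identified with $1\otimes V(\tau)=\mathcal H_c(\tau)_{0,0}$. For each $k>0$ the set $\Lambda_k$ has either four or two elements. If it has four, then each $\mathcal H_c(\tau)_{k,\lambda}$, $\lambda\in\Lambda_k$, is a one-dimensional irreducible $\mathcal V$-module; if it has two, then each $\mathcal H_c(\tau)_{k,\lambda}$ is two-dimensional and is the direct sum of two irreducible $\mathcal V$-modules. -/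

import Mathlib

open scoped TensorProduct DirectSum

namespace DihedralCherednik

noncomputable section

/-! ### The dihedral group `I₂(m)` acting on the Euclidean plane -/

/-- `cos (2πj/m)`, where `ω ^ j = ZMod.stdAddChar j = exp (2πij/m)`. -/
def cosj {m : ℕ} [NeZero m] (j : ZMod m) : ℂ := ((ZMod.stdAddChar j : ℂ).re : ℂ)

/-- `sin (2πj/m)`. -/
def sinj {m : ℕ} [NeZero m] (j : ZMod m) : ℂ := ((ZMod.stdAddChar j : ℂ).im : ℂ)

/-- The root `α_j = sin (πj/m) ξ - cos (πj/m) η`, in the coordinates of the orthonormal basis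
`ξ, η`. The covector `a_j = sin (πj/m) x - cos (πj/m) y` has the same coordinates in the dual
basis `x, y`, and `⟨a_j, α_j⟩ = 1`. (Replacing `j` by `j + m` only changes the sign of both.) -/
def root {m : ℕ} (j : ZMod m) : Fin 2 → ℂ :=
  ![(Real.sin (Real.pi * j.val / m) : ℂ), -(Real.cos (Real.pi * j.val / m) : ℂ)]

/-- The matrix of a group element on `E_ℂ`, in the basis `ξ, η`: `sr j` is the orthogonal
reflection `s_j` in the root `α_j`, and `r k = s_i s_{i+k}` is the rotation by `-2πk/m`. These
matrices are orthogonal, so the contragredient action on `E_ℂ^*` is given by the same matrices in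
the dual basis `x, y`. -/
def actMat {m : ℕ} [NeZero m] : DihedralGroup m → Matrix (Fin 2) (Fin 2) ℂ
  | .r k => !![cosj k, sinj k; -sinj k, cosj k]
  | .sr j => !![cosj j, sinj j; sinj j, -cosj j]

section actionFacts

variable {m : ℕ} [NeZero m]

theorem cosj_zero : cosj (0 : ZMod m) = 1 := by simp [cosj]

theorem sinj_zero : sinj (0 : ZMod m) = 0 := by simp [sinj]

theorem cosj_add (i j : ZMod m) : cosj (i + j) = cosj i * cosj j - sinj i * sinj j := by
  simp [cosj, sinj, AddChar.map_add_eq_mul]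

theorem sinj_add (i j : ZMod m) : sinj (i + j) = sinj i * cosj j + cosj i * sinj j := by
  simp [cosj, sinj, AddChar.map_add_eq_mul]; ring

theorem cosj_eq (j : ZMod m) : cosj j = (Real.cos (2 * (Real.pi * j.val / m)) : ℂ) := by
  rw [cosj, ZMod.stdAddChar_apply, ZMod.toCircle_apply]
  rw [show (2 * Real.pi * Complex.I * (j.val : ℂ) / (m : ℂ)) =
    ((2 * (Real.pi * j.val / m) : ℝ) : ℂ) * Complex.I by push_cast; ring, Complex.exp_ofReal_mul_I_re]

theorem sinj_eq (j : ZMod m) : sinj j = (Real.sin (2 * (Real.pi * j.val / m)) : ℂ) := by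
  rw [sinj, ZMod.stdAddChar_apply, ZMod.toCircle_apply]
  rw [show (2 * Real.pi * Complex.I * (j.val : ℂ) / (m : ℂ)) =
    ((2 * (Real.pi * j.val / m) : ℝ) : ℂ) * Complex.I by push_cast; ring, Complex.exp_ofReal_mul_I_im]

theorem cosj_sq_add_sinj_sq (j : ZMod m) : cosj j ^ 2 + sinj j ^ 2 = 1 := by
  rw [cosj_eq, sinj_eq]; norm_cast; exact Real.cos_sq_add_sin_sq _

theorem cosj_neg (j : ZMod m) : cosj (-j) = cosj j := by
  have h1 := cosj_add j (-j)
  have h2 := sinj_add j (-j)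
  rw [add_neg_cancel, cosj_zero] at h1
  rw [add_neg_cancel, sinj_zero] at h2
  linear_combination (-cosj j) * h1 - sinj j * h2 - cosj (-j) * cosj_sq_add_sinj_sq j

theorem sinj_neg (j : ZMod m) : sinj (-j) = -sinj j := by
  have h1 := cosj_add j (-j)
  have h2 := sinj_add j (-j)
  rw [add_neg_cancel, cosj_zero] at h1
  rw [add_neg_cancel, sinj_zero] at h2
  linear_combination (sinj j) * h1 - cosj j * h2 - sinj (-j) * cosj_sq_add_sinj_sq j

end actionFacts

/-- The action of the dihedral group on the plane, as a homomorphism. -/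
def act (m : ℕ) [NeZero m] : DihedralGroup m →* Matrix (Fin 2) (Fin 2) ℂ where
  toFun := actMat
  map_one' := by
    rw [DihedralGroup.one_def]
    simp [actMat, cosj_zero, sinj_zero, Matrix.one_fin_two]
  map_mul' := by
    rintro (i | i) (j | j) <;>
    simp only [DihedralGroup.r_mul_r, DihedralGroup.r_mul_sr, DihedralGroup.sr_mul_r,
      DihedralGroup.sr_mul_sr, actMat, sub_eq_add_neg, cosj_add, sinj_add, cosj_neg, sinj_neg,
      Matrix.mul_fin_two] <;>
    (ext a b; fin_cases a <;> fin_cases b <;> simp <;> ring)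

/-! ### The rational Cherednik algebra `H_c(G, E)` -/

/-- Generators: vectors of `E_ℂ` (coordinates with respect to `ξ, η`), covectors of `E_ℂ^*`
(coordinates with respect to `x, y`) and group elements. -/
inductive Gen (m : ℕ)
  | vec (v : Fin 2 → ℂ)
  | covec (w : Fin 2 → ℂ)
  | grp (g : DihedralGroup m)

/-- The defining relations. The first eight present `T(E_ℂ ⊕ E_ℂ^*) ⋊ ℂ[G]`, the last three are
the relations of the rational Cherednik algebra. `c j` is the parameter `c(s_j)`. -/
inductive Rel (m : ℕ) [NeZero m] (c : ZMod m → ℝ) :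
    FreeAlgebra ℂ (Gen m) → FreeAlgebra ℂ (Gen m) → Prop
  | vec_add (v v' : Fin 2 → ℂ) : Rel m c (.ι ℂ (.vec (v + v'))) (.ι ℂ (.vec v) + .ι ℂ (.vec v'))
  | vec_smul (a : ℂ) (v : Fin 2 → ℂ) : Rel m c (.ι ℂ (.vec (a • v))) (a • .ι ℂ (.vec v))
  | covec_add (w w' : Fin 2 → ℂ) :
      Rel m c (.ι ℂ (.covec (w + w'))) (.ι ℂ (.covec w) + .ι ℂ (.covec w'))
  | covec_smul (a : ℂ) (w : Fin 2 → ℂ) : Rel m c (.ι ℂ (.covec (a • w))) (a • .ι ℂ (.covec w))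
  | grp_one : Rel m c (.ι ℂ (.grp 1)) 1
  | grp_mul (g g' : DihedralGroup m) :
      Rel m c (.ι ℂ (.grp (g * g'))) (.ι ℂ (.grp g) * .ι ℂ (.grp g'))
  | grp_vec (g : DihedralGroup m) (v : Fin 2 → ℂ) :
      Rel m c (.ι ℂ (.grp g) * .ι ℂ (.vec v))
        (.ι ℂ (.vec ((act m g).mulVec v)) * .ι ℂ (.grp g))
  | grp_covec (g : DihedralGroup m) (w : Fin 2 → ℂ) :
      Rel m c (.ι ℂ (.grp g) * .ι ℂ (.covec w))
        (.ι ℂ (.covec ((act m g).mulVec w)) * .ι ℂ (.grp g))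
  | vec_comm (v v' : Fin 2 → ℂ) :
      Rel m c (.ι ℂ (.vec v) * .ι ℂ (.vec v')) (.ι ℂ (.vec v') * .ι ℂ (.vec v))
  | covec_comm (w w' : Fin 2 → ℂ) :
      Rel m c (.ι ℂ (.covec w) * .ι ℂ (.covec w')) (.ι ℂ (.covec w') * .ι ℂ (.covec w))
  | cherednik (v w : Fin 2 → ℂ) :
      Rel m c (.ι ℂ (.vec v) * .ι ℂ (.covec w) - .ι ℂ (.covec w) * .ι ℂ (.vec v))
        (algebraMap ℂ _ (w ⬝ᵥ v) -
          2 * ∑ j : ZMod m, ((w ⬝ᵥ root j) * (root j ⬝ᵥ v) * (c j : ℂ)) •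
            .ι ℂ (.grp (DihedralGroup.sr j)))

/-- The rational Cherednik algebra `H_c(G, E)` of the dihedral group `G = I₂(m)`. -/
def RCA (m : ℕ) [NeZero m] (c : ZMod m → ℝ) : Type := RingQuot (Rel m c)

instance (m : ℕ) [NeZero m] (c : ZMod m → ℝ) : Ring (RCA m c) :=
  inferInstanceAs (Ring (RingQuot (Rel m c)))

instance (m : ℕ) [NeZero m] (c : ZMod m → ℝ) : Algebra ℂ (RCA m c) :=
  inferInstanceAs (Algebra ℂ (RingQuot (Rel m c)))

/-- The quotient map onto `H_c(G, E)`. -/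
def mk (m : ℕ) [NeZero m] (c : ZMod m → ℝ) : FreeAlgebra ℂ (Gen m) →ₐ[ℂ] RCA m c :=
  RingQuot.mkAlgHom ℂ (Rel m c)

theorem mk_rel {m : ℕ} [NeZero m] {c : ZMod m → ℝ} {a b : FreeAlgebra ℂ (Gen m)}
    (h : Rel m c a b) : mk m c a = mk m c b := RingQuot.mkAlgHom_rel ℂ h

section elements

variable (m : ℕ) [NeZero m] (c : ZMod m → ℝ)

/-- The element of `H_c(G, E)` given by a vector of `E_ℂ`. -/
def vec (v : Fin 2 → ℂ) : RCA m c := mk m c (.ι ℂ (.vec v))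

/-- The element of `H_c(G, E)` given by a covector. -/
def covec (w : Fin 2 → ℂ) : RCA m c := mk m c (.ι ℂ (.covec w))

/-- The element of `H_c(G, E)` given by a group element. -/
def grp (g : DihedralGroup m) : RCA m c := mk m c (.ι ℂ (.grp g))

/-- The basis vector `ξ`. -/
def xi : RCA m c := vec m c ![1, 0]

/-- The basis vector `η`. -/
def eta : RCA m c := vec m c ![0, 1]

/-- The coordinate `x`. -/
def X : RCA m c := covec m c ![1, 0]

/-- The coordinate `y`. -/
def Y : RCA m c := covec m c ![0, 1]

/-- `σ = ∑ c(s) s`. -/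
def sigma : RCA m c := ∑ j : ZMod m, (c j : ℂ) • grp m c (DihedralGroup.sr j)

/-- `E_+ = (x² + y²) / 2`. -/
def Eplus : RCA m c := (1 / 2 : ℂ) • (X m c * X m c + Y m c * Y m c)

/-- `E_- = -(ξ² + η²) / 2`. -/
def Eminus : RCA m c := -((1 / 2 : ℂ) • (xi m c * xi m c + eta m c * eta m c))

/-- `H = x ξ + y η + 1 - σ`. -/
def Hel : RCA m c := X m c * xi m c + Y m c * eta m c + 1 - sigma m c

/-- `Z₀ = i (x η - y ξ)`. -/
def Z0 : RCA m c := Complex.I • (X m c * eta m c - Y m c * xi m c)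

/-- `Z₀ + ε σ`. -/
def Ztilde (ε : ℝ) : RCA m c := Z0 m c + (ε : ℂ) • sigma m c

end elements

/-! ### The Lie algebra `𝔲(1,1)`

Representations of the real form `𝔲(1,1)` of `𝔤𝔩(2,ℂ)` on complex vector spaces are the same as
representations of `𝔤𝔩(2,ℂ)`. -/

attribute [local instance 100] LieRing.ofAssociativeRing

/-- The complexification `𝔤𝔩(2,ℂ)` of `𝔲(1,1)`. -/
abbrev Gl2 : Type := Matrix (Fin 2) (Fin 2) ℂ

/-- The homomorphism from `𝔤𝔩(2,ℂ)` with `diag(1,-1) ↦ h`, `E₁₂ ↦ p`, `E₂₁ ↦ q` and `1 ↦ z`. -/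
def gl2Hom {L : Type*} [LieRing L] [LieAlgebra ℂ L] (h p q z : L)
    (hp : ⁅h, p⁆ = (2 : ℂ) • p) (hq : ⁅h, q⁆ = -((2 : ℂ) • q)) (pq : ⁅p, q⁆ = h)
    (zh : ⁅z, h⁆ = 0) (zp : ⁅z, p⁆ = 0) (zq : ⁅z, q⁆ = 0) : Gl2 →ₗ⁅ℂ⁆ L where
  toFun A := ((A 0 0 - A 1 1) / 2) • h + A 0 1 • p + A 1 0 • q + ((A 0 0 + A 1 1) / 2) • z
  map_add' A B := by simp only [Matrix.add_apply]; module
  map_smul' a A := by simp only [Matrix.smul_apply, smul_eq_mul, RingHom.id_apply]; module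
  map_lie' := by
    intro A B
    have ph : ⁅p, h⁆ = -((2 : ℂ) • p) := by rw [← lie_skew, hp]
    have qh : ⁅q, h⁆ = (2 : ℂ) • q := by rw [← lie_skew, hq, neg_neg]
    have qp : ⁅q, p⁆ = -h := by rw [← lie_skew, pq]
    have hz : ⁅h, z⁆ = 0 := by rw [← lie_skew, zh, neg_zero]
    have pz : ⁅p, z⁆ = 0 := by rw [← lie_skew, zp, neg_zero]
    have qz : ⁅q, z⁆ = 0 := by rw [← lie_skew, zq, neg_zero]
    simp only [lie_add, add_lie, lie_smul, smul_lie, lie_self, hp, hq, pq, zh, zp, zq, ph, qh, qp,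
      hz, pz, qz, Ring.lie_def, Matrix.sub_apply, Matrix.mul_apply, Fin.sum_univ_two]
    module


section relations

variable {m : ℕ} [NeZero m] {c : ZMod m → ℝ}

theorem vec_add (v v' : Fin 2 → ℂ) : vec m c (v + v') = vec m c v + vec m c v' := by
  simpa [vec] using mk_rel (Rel.vec_add (c := c) v v')

theorem vec_smul (a : ℂ) (v : Fin 2 → ℂ) : vec m c (a • v) = a • vec m c v := by
  simpa [vec] using mk_rel (Rel.vec_smul (c := c) a v)

theorem covec_add (v v' : Fin 2 → ℂ) : covec m c (v + v') = covec m c v + covec m c v' := by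
  simpa [covec] using mk_rel (Rel.covec_add (c := c) v v')

theorem covec_smul (a : ℂ) (v : Fin 2 → ℂ) : covec m c (a • v) = a • covec m c v := by
  simpa [covec] using mk_rel (Rel.covec_smul (c := c) a v)

theorem vec_eq (v : Fin 2 → ℂ) : vec m c v = v 0 • xi m c + v 1 • eta m c := by
  rw [xi, eta, ← vec_smul, ← vec_smul, ← vec_add]
  congr 1; ext i; fin_cases i <;> simp

theorem covec_eq (v : Fin 2 → ℂ) : covec m c v = v 0 • X m c + v 1 • Y m c := by
  rw [X, Y, ← covec_smul, ← covec_smul, ← covec_add]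
  congr 1; ext i; fin_cases i <;> simp

theorem grp_vec (g : DihedralGroup m) (v : Fin 2 → ℂ) :
    grp m c g * vec m c v = vec m c ((act m g).mulVec v) * grp m c g := by
  simpa [vec, grp] using mk_rel (Rel.grp_vec (c := c) g v)

theorem grp_covec (g : DihedralGroup m) (v : Fin 2 → ℂ) :
    grp m c g * covec m c v = covec m c ((act m g).mulVec v) * grp m c g := by
  simpa [covec, grp] using mk_rel (Rel.grp_covec (c := c) g v)

theorem xi_eta : xi m c * eta m c = eta m c * xi m c := by
  simpa [xi, eta, vec] using mk_rel (Rel.vec_comm (c := c) ![1, 0] ![0, 1])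

theorem X_Y : X m c * Y m c = Y m c * X m c := by
  simpa [X, Y, covec] using mk_rel (Rel.covec_comm (c := c) ![1, 0] ![0, 1])

/-- `σ_{ab} = ∑_s c(s) α_s(a) α_s(b) s`. -/
def sab (m : ℕ) [NeZero m] (c : ZMod m → ℝ) (a b : Fin 2) : RCA m c :=
  ∑ j : ZMod m, (root j a * root j b * (c j : ℂ)) • grp m c (DihedralGroup.sr j)

theorem cherednik (v w : Fin 2 → ℂ) :
    vec m c v * covec m c w - covec m c w * vec m c v = algebraMap ℂ _ (w ⬝ᵥ v) -
      2 * ∑ j : ZMod m, ((w ⬝ᵥ root j) * (root j ⬝ᵥ v) * (c j : ℂ)) •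
        grp m c (DihedralGroup.sr j) := by
  have h := mk_rel (Rel.cherednik (c := c) v w)
  simp only [map_sub, map_mul, map_sum, map_smul, AlgHom.commutes, map_ofNat] at h
  exact h

theorem xi_X : xi m c * X m c = X m c * xi m c + 1 - 2 * sab m c 0 0 := by
  have h := cherednik (m := m) (c := c) ![1, 0] ![1, 0]
  simp only [dotProduct, Fin.sum_univ_two, Matrix.cons_val_zero,
    Matrix.cons_val_one, mul_one, one_mul, mul_zero, zero_mul, add_zero, zero_add, map_one] at h
  rw [add_sub_assoc, sab, xi, X, ← h]; abel

theorem eta_Y : eta m c * Y m c = Y m c * eta m c + 1 - 2 * sab m c 1 1 := by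
  have h := cherednik (m := m) (c := c) ![0, 1] ![0, 1]
  simp only [dotProduct, Fin.sum_univ_two, Matrix.cons_val_zero,
    Matrix.cons_val_one, mul_one, one_mul, mul_zero, zero_mul, add_zero, zero_add, map_one] at h
  rw [add_sub_assoc, sab, eta, Y, ← h]; abel

theorem xi_Y : xi m c * Y m c = Y m c * xi m c - 2 * sab m c 1 0 := by
  have h := cherednik (m := m) (c := c) ![1, 0] ![0, 1]
  simp only [dotProduct, Fin.sum_univ_two, Matrix.cons_val_zero,
    Matrix.cons_val_one, mul_one, one_mul, mul_zero, zero_mul, add_zero, zero_add, map_zero,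
    zero_sub] at h
  rw [sub_eq_add_neg, sab, xi, Y, ← h]; abel

theorem eta_X : eta m c * X m c = X m c * eta m c - 2 * sab m c 1 0 := by
  have h := cherednik (m := m) (c := c) ![0, 1] ![1, 0]
  simp only [dotProduct, Fin.sum_univ_two, Matrix.cons_val_zero,
    Matrix.cons_val_one, mul_one, one_mul, mul_zero, zero_mul, add_zero, zero_add, map_zero,
    zero_sub] at h
  have e : sab m c 1 0 = ∑ j : ZMod m, (root j 0 * root j 1 * (c j : ℂ)) •
      grp m c (DihedralGroup.sr j) := by
    simp only [sab, mul_comm (root _ 1)]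
  rw [sub_eq_add_neg, e, eta, X, ← h]; abel

theorem sab_trace : sab m c 0 0 + sab m c 1 1 = sigma m c := by
  simp only [sab, sigma, ← Finset.sum_add_distrib, ← add_smul]
  refine Finset.sum_congr rfl fun j _ => ?_
  congr 1
  have : root j 0 * root j 0 + root j 1 * root j 1 = 1 := by
    simp only [root, Matrix.cons_val_zero, Matrix.cons_val_one]
    norm_cast
    nlinarith [Real.sin_sq_add_cos_sq (Real.pi * j.val / m)]
  rw [← add_mul, this, one_mul]

theorem act_root (j : ZMod m) :
    (act m (DihedralGroup.sr j)).mulVec (root j) = -root j := by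
  have h := Real.sin_sq_add_cos_sq (Real.pi * j.val / m)
  ext i
  fin_cases i <;>
  simp only [act, actMat, MonoidHom.coe_mk, OneHom.coe_mk, root, cosj_eq, sinj_eq, Matrix.mulVec,
    dotProduct, Fin.sum_univ_two, Real.cos_two_mul, Real.sin_two_mul, Matrix.of_apply,
    Matrix.cons_val_zero, Matrix.cons_val_one, Fin.zero_eta, Fin.mk_one, Pi.neg_apply] <;>
  norm_cast
  · ring
  · linear_combination (2 * Real.cos (Real.pi * j.val / m)) * h

/-- `∑_a {ξ_a, σ_{ab}} = 0`. -/
theorem anti_vec (b : Fin 2) : xi m c * sab m c b 0 + sab m c b 0 * xi m c +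
    (eta m c * sab m c b 1 + sab m c b 1 * eta m c) = 0 := by
  simp only [sab, Finset.mul_sum, Finset.sum_mul, ← Finset.sum_add_distrib]
  refine Finset.sum_eq_zero fun j _ => ?_
  have h := grp_vec (c := c) (DihedralGroup.sr j) (root j)
  rw [act_root, ← neg_one_smul ℂ, vec_smul, vec_eq] at h
  simp only [mul_add, add_mul, smul_add, smul_mul_assoc, mul_smul_comm] at h ⊢
  linear_combination (norm := module) (root j b * (c j : ℂ)) • h

theorem anti_covec (b : Fin 2) : X m c * sab m c b 0 + sab m c b 0 * X m c +
    (Y m c * sab m c b 1 + sab m c b 1 * Y m c) = 0 := by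
  simp only [sab, Finset.mul_sum, Finset.sum_mul, ← Finset.sum_add_distrib]
  refine Finset.sum_eq_zero fun j _ => ?_
  have h := grp_covec (c := c) (DihedralGroup.sr j) (root j)
  rw [act_root, ← neg_one_smul ℂ, covec_smul, covec_eq] at h
  simp only [mul_add, add_mul, smul_add, smul_mul_assoc, mul_smul_comm] at h ⊢
  linear_combination (norm := module) (root j b * (c j : ℂ)) • h

theorem sab_symm : sab m c 0 1 = sab m c 1 0 := by
  simp only [sab, mul_comm (root _ 1)]

theorem lap_X : (xi m c * xi m c + eta m c * eta m c) * X m c -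
    X m c * (xi m c * xi m c + eta m c * eta m c) = 2 * xi m c := by
  have h := anti_vec (m := m) (c := c) 0
  rw [sab_symm] at h
  linear_combination (norm := noncomm_ring) xi m c * xi_X (m := m) (c := c) +
    xi_X (m := m) (c := c) * xi m c + eta m c * eta_X (m := m) (c := c) +
    eta_X (m := m) (c := c) * eta m c - 2 * h

theorem lap_Y : (xi m c * xi m c + eta m c * eta m c) * Y m c -
    Y m c * (xi m c * xi m c + eta m c * eta m c) = 2 * eta m c := by
  have h := anti_vec (m := m) (c := c) 1
  linear_combination (norm := noncomm_ring) xi m c * xi_Y (m := m) (c := c) +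
    xi_Y (m := m) (c := c) * xi m c + eta m c * eta_Y (m := m) (c := c) +
    eta_Y (m := m) (c := c) * eta m c - 2 * h

theorem xi_sq : xi m c * (X m c * X m c + Y m c * Y m c) -
    (X m c * X m c + Y m c * Y m c) * xi m c = 2 * X m c := by
  have h := anti_covec (m := m) (c := c) 0
  rw [sab_symm] at h
  linear_combination (norm := noncomm_ring) X m c * xi_X (m := m) (c := c) +
    xi_X (m := m) (c := c) * X m c + Y m c * xi_Y (m := m) (c := c) +
    xi_Y (m := m) (c := c) * Y m c - 2 * h

theorem eta_sq : eta m c * (X m c * X m c + Y m c * Y m c) -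
    (X m c * X m c + Y m c * Y m c) * eta m c = 2 * Y m c := by
  have h := anti_covec (m := m) (c := c) 1
  linear_combination (norm := noncomm_ring) X m c * eta_X (m := m) (c := c) +
    eta_X (m := m) (c := c) * X m c + Y m c * eta_Y (m := m) (c := c) +
    eta_Y (m := m) (c := c) * Y m c - 2 * h

theorem two_Hel : 2 * Hel m c = X m c * xi m c + xi m c * X m c +
    (Y m c * eta m c + eta m c * Y m c) := by
  rw [Hel, ← sab_trace]
  linear_combination (norm := noncomm_ring) -xi_X (m := m) (c := c) - eta_Y (m := m) (c := c)

theorem smul_two_eq (a : RCA m c) : (2 : ℂ) • a = 2 * a := by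
  rw [two_smul, two_mul]

theorem sr_sq_comm (j : ZMod m) :
    grp m c (.sr j) * (X m c * X m c + Y m c * Y m c) =
      (X m c * X m c + Y m c * Y m c) * grp m c (.sr j) := by
  have hX : grp m c (.sr j) * X m c = (cosj j • X m c + sinj j • Y m c) * grp m c (.sr j) := by
    rw [X, grp_covec, covec_eq]; simp [act, actMat, X]
  have hY : grp m c (.sr j) * Y m c = (sinj j • X m c - cosj j • Y m c) * grp m c (.sr j) := by
    rw [Y, grp_covec, covec_eq]; simp [act, actMat, Y, X, sub_eq_add_neg]
  have h := cosj_sq_add_sinj_sq j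
  have h1 : grp m c (.sr j) * (X m c * X m c) = (cosj j • X m c + sinj j • Y m c) *
      (cosj j • X m c + sinj j • Y m c) * grp m c (.sr j) := by
    rw [← mul_assoc, hX, mul_assoc, hX, mul_assoc]
  have h2 : grp m c (.sr j) * (Y m c * Y m c) = (sinj j • X m c - cosj j • Y m c) *
      (sinj j • X m c - cosj j • Y m c) * grp m c (.sr j) := by
    rw [← mul_assoc, hY, mul_assoc, hY, mul_assoc]
  rw [mul_add, h1, h2, ← add_mul]
  congr 1
  simp only [mul_add, add_mul, mul_sub, sub_mul, smul_mul_assoc, mul_smul_comm, X_Y]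
  linear_combination (norm := module) h • (X m c * X m c) + h • (Y m c * Y m c)

theorem sr_lap_comm (j : ZMod m) :
    grp m c (.sr j) * (xi m c * xi m c + eta m c * eta m c) =
      (xi m c * xi m c + eta m c * eta m c) * grp m c (.sr j) := by
  have hX : grp m c (.sr j) * xi m c =
      (cosj j • xi m c + sinj j • eta m c) * grp m c (.sr j) := by
    rw [xi, grp_vec, vec_eq]; simp [act, actMat, xi]
  have hY : grp m c (.sr j) * eta m c =
      (sinj j • xi m c - cosj j • eta m c) * grp m c (.sr j) := by
    rw [eta, grp_vec, vec_eq]; simp [act, actMat, eta, xi, sub_eq_add_neg]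
  have h := cosj_sq_add_sinj_sq j
  have h1 : grp m c (.sr j) * (xi m c * xi m c) = (cosj j • xi m c + sinj j • eta m c) *
      (cosj j • xi m c + sinj j • eta m c) * grp m c (.sr j) := by
    rw [← mul_assoc, hX, mul_assoc, hX, mul_assoc]
  have h2 : grp m c (.sr j) * (eta m c * eta m c) = (sinj j • xi m c - cosj j • eta m c) *
      (sinj j • xi m c - cosj j • eta m c) * grp m c (.sr j) := by
    rw [← mul_assoc, hY, mul_assoc, hY, mul_assoc]
  rw [mul_add, h1, h2, ← add_mul]
  congr 1
  simp only [mul_add, add_mul, mul_sub, sub_mul, smul_mul_assoc, mul_smul_comm, xi_eta]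
  linear_combination (norm := module) h • (xi m c * xi m c) + h • (eta m c * eta m c)

theorem X_sq : X m c * (X m c * X m c + Y m c * Y m c) =
    (X m c * X m c + Y m c * Y m c) * X m c := by
  linear_combination (norm := noncomm_ring) X_Y (m := m) (c := c) * Y m c +
    Y m c * X_Y (m := m) (c := c)

theorem Y_sq : Y m c * (X m c * X m c + Y m c * Y m c) =
    (X m c * X m c + Y m c * Y m c) * Y m c := by
  linear_combination (norm := noncomm_ring) - X_Y (m := m) (c := c) * X m c -
    X m c * X_Y (m := m) (c := c)

theorem lap_xi : (xi m c * xi m c + eta m c * eta m c) * xi m c =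
    xi m c * (xi m c * xi m c + eta m c * eta m c) := by
  linear_combination (norm := noncomm_ring) - xi_eta (m := m) (c := c) * eta m c -
    eta m c * xi_eta (m := m) (c := c)

theorem lap_eta : (xi m c * xi m c + eta m c * eta m c) * eta m c =
    eta m c * (xi m c * xi m c + eta m c * eta m c) := by
  linear_combination (norm := noncomm_ring) xi_eta (m := m) (c := c) * xi m c +
    xi m c * xi_eta (m := m) (c := c)

theorem Hel_Eplus : ⁅Hel m c, Eplus m c⁆ = (2 : ℂ) • Eplus m c := by
  have key : 2 * Hel m c * (X m c * X m c + Y m c * Y m c) -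
      (X m c * X m c + Y m c * Y m c) * (2 * Hel m c) =
      4 * (X m c * X m c + Y m c * Y m c) := by
    rw [two_Hel]
    linear_combination (norm := noncomm_ring) X m c * xi_sq (m := m) (c := c) +
      xi_sq (m := m) (c := c) * X m c + Y m c * eta_sq (m := m) (c := c) +
      eta_sq (m := m) (c := c) * Y m c + xi m c * X_sq (m := m) (c := c) +
      X_sq (m := m) (c := c) * xi m c + eta m c * Y_sq (m := m) (c := c) +
      Y_sq (m := m) (c := c) * eta m c
  rw [Ring.lie_def, Eplus]
  simp only [← smul_two_eq, show (4 : RCA m c) = 2 * 2 by norm_num, mul_assoc, smul_mul_assoc,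
    mul_smul_comm] at key ⊢
  linear_combination (norm := module) (1 / 4 : ℂ) • key

theorem Hel_Eminus : ⁅Hel m c, Eminus m c⁆ = -((2 : ℂ) • Eminus m c) := by
  have key : 2 * Hel m c * (xi m c * xi m c + eta m c * eta m c) -
      (xi m c * xi m c + eta m c * eta m c) * (2 * Hel m c) =
      -(4 * (xi m c * xi m c + eta m c * eta m c)) := by
    rw [two_Hel]
    linear_combination (norm := noncomm_ring) - xi m c * lap_X (m := m) (c := c) -
      lap_X (m := m) (c := c) * xi m c - eta m c * lap_Y (m := m) (c := c) -
      lap_Y (m := m) (c := c) * eta m c - X m c * lap_xi (m := m) (c := c) -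
      lap_xi (m := m) (c := c) * X m c - Y m c * lap_eta (m := m) (c := c) -
      lap_eta (m := m) (c := c) * Y m c
  rw [Ring.lie_def, Eminus]
  simp only [← smul_two_eq, show (4 : RCA m c) = 2 * 2 by norm_num, mul_assoc, smul_mul_assoc,
    mul_smul_comm, mul_neg, neg_mul] at key ⊢
  linear_combination (norm := module) (-1 / 4 : ℂ) • key

theorem Eplus_Eminus : ⁅Eplus m c, Eminus m c⁆ = Hel m c := by
  have key : (X m c * X m c + Y m c * Y m c) * (xi m c * xi m c + eta m c * eta m c) -
      (xi m c * xi m c + eta m c * eta m c) * (X m c * X m c + Y m c * Y m c) =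
      -(2 * (2 * Hel m c)) := by
    rw [two_Hel]
    linear_combination (norm := noncomm_ring) - lap_X (m := m) (c := c) * X m c -
      X m c * lap_X (m := m) (c := c) - lap_Y (m := m) (c := c) * Y m c -
      Y m c * lap_Y (m := m) (c := c)
  rw [Ring.lie_def, Eplus, Eminus]
  simp only [← smul_two_eq, mul_assoc, smul_mul_assoc, mul_smul_comm, mul_neg, neg_mul] at key ⊢
  linear_combination (norm := module) (-1 / 4 : ℂ) • key

theorem sigma_Eplus : ⁅sigma m c, Eplus m c⁆ = 0 := by
  rw [Ring.lie_def, sigma, Eplus, Finset.sum_mul, Finset.mul_sum, ← Finset.sum_sub_distrib]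
  refine Finset.sum_eq_zero fun j _ => ?_
  simp only [smul_mul_assoc, mul_smul_comm, sr_sq_comm]
  module

theorem sigma_Eminus : ⁅sigma m c, Eminus m c⁆ = 0 := by
  rw [Ring.lie_def, sigma, Eminus, Finset.sum_mul, Finset.mul_sum, ← Finset.sum_sub_distrib]
  refine Finset.sum_eq_zero fun j _ => ?_
  simp only [smul_mul_assoc, mul_smul_comm, mul_neg, neg_mul, sr_lap_comm]
  module

theorem Z0_Eplus : ⁅Z0 m c, Eplus m c⁆ = 0 := by
  have key : (X m c * eta m c - Y m c * xi m c) * (X m c * X m c + Y m c * Y m c) -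
      (X m c * X m c + Y m c * Y m c) * (X m c * eta m c - Y m c * xi m c) = 0 := by
    linear_combination (norm := noncomm_ring) X m c * eta_sq (m := m) (c := c) -
      Y m c * xi_sq (m := m) (c := c) + X_sq (m := m) (c := c) * eta m c -
      Y_sq (m := m) (c := c) * xi m c + 2 * X_Y (m := m) (c := c)
  rw [Ring.lie_def, Z0, Eplus]
  simp only [smul_mul_assoc, mul_smul_comm] at key ⊢
  linear_combination (norm := module) (Complex.I / 2) • key

theorem Z0_Eminus : ⁅Z0 m c, Eminus m c⁆ = 0 := by
  have key : (X m c * eta m c - Y m c * xi m c) * (xi m c * xi m c + eta m c * eta m c) -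
      (xi m c * xi m c + eta m c * eta m c) * (X m c * eta m c - Y m c * xi m c) = 0 := by
    linear_combination (norm := noncomm_ring) - X m c * lap_eta (m := m) (c := c) +
      Y m c * lap_xi (m := m) (c := c) - lap_X (m := m) (c := c) * eta m c +
      lap_Y (m := m) (c := c) * xi m c - 2 * xi_eta (m := m) (c := c)
  rw [Ring.lie_def, Z0, Eminus]
  simp only [smul_mul_assoc, mul_smul_comm, mul_neg, neg_mul] at key ⊢
  linear_combination (norm := module) (-Complex.I / 2) • key

theorem Ztilde_Eplus (ε : ℝ) : ⁅Ztilde m c ε, Eplus m c⁆ = 0 := by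
  rw [Ztilde, add_lie, smul_lie, Z0_Eplus, sigma_Eplus, smul_zero, add_zero]

theorem Ztilde_Eminus (ε : ℝ) : ⁅Ztilde m c ε, Eminus m c⁆ = 0 := by
  rw [Ztilde, add_lie, smul_lie, Z0_Eminus, sigma_Eminus, smul_zero, add_zero]

theorem Ztilde_Hel (ε : ℝ) : ⁅Ztilde m c ε, Hel m c⁆ = 0 := by
  rw [← Eplus_Eminus, leibniz_lie, Ztilde_Eplus, Ztilde_Eminus, zero_lie, lie_zero, add_zero]

end relations

/-- The realisation of `𝔲(1,1)` (complexified) in `H_c(G, E)`, with central element `Z₀ + ε σ`. -/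
def u11 (m : ℕ) [NeZero m] (c : ZMod m → ℝ) (ε : ℝ) : Gl2 →ₗ⁅ℂ⁆ RCA m c :=
  gl2Hom (Hel m c) (Eplus m c) (Eminus m c) (Ztilde m c ε)
    Hel_Eplus Hel_Eminus Eplus_Eminus (Ztilde_Hel ε) (Ztilde_Eplus ε) (Ztilde_Eminus ε)

/-- The centraliser `𝒱` of `𝔲(1,1)` in `H_c(G, E)`. -/
abbrev Cent (m : ℕ) [NeZero m] (c : ZMod m → ℝ) (ε : ℝ) : Subalgebra ℂ (RCA m c) :=
  Subalgebra.centralizer ℂ (Set.range (u11 m c ε))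

/-! ### Lowest weight modules of `𝔲(1,1)` -/

/-- The operator `H`: `v_n ↦ (μ + 2n) v_n`. -/
def lwH (μ : ℝ) : Module.End ℂ (ℕ →₀ ℂ) :=
  Finsupp.linearCombination ℂ fun n : ℕ => Finsupp.single n ((μ : ℂ) + 2 * n)

/-- The operator `E_+`: `v_n ↦ v_{n+1}`. -/
def lwP : Module.End ℂ (ℕ →₀ ℂ) :=
  Finsupp.linearCombination ℂ fun n : ℕ => Finsupp.single (n + 1) (1 : ℂ)

/-- The operator `E_-`: `v_n ↦ -n (μ + n - 1) v_{n-1}`. -/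
def lwM (μ : ℝ) : Module.End ℂ (ℕ →₀ ℂ) :=
  Finsupp.linearCombination ℂ fun n : ℕ => Finsupp.single (n - 1) (-(n * ((μ : ℂ) + n - 1)))

/-- For `μ > 0`, the lowest weight module `L_{𝔲(1,1)}(μ, ν)` with `(H, Z)`-lowest weight `(μ, ν)`,
on the space with basis `v_0, v_1, v_2, …`; here `v_0 = Finsupp.single 0 1` is the lowest weight
vector. -/
def lowestWeightRep (μ ν : ℝ) : Gl2 →ₗ⁅ℂ⁆ Module.End ℂ (ℕ →₀ ℂ) :=
  gl2Hom (lwH μ) lwP (lwM μ) ((ν : ℂ) • 1)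
    (by
      refine Finsupp.lhom_ext fun n b => ?_
      simp only [Ring.lie_def, lwH, lwP, LinearMap.sub_apply, Module.End.mul_apply,
        LinearMap.smul_apply, Finsupp.linearCombination_single, Finsupp.smul_single, smul_eq_mul,
        ← Finsupp.single_sub]
      congr 1
      push_cast
      ring)
    (by
      refine Finsupp.lhom_ext fun n b => ?_
      simp only [Ring.lie_def, lwH, lwM, LinearMap.sub_apply, Module.End.mul_apply,
        LinearMap.smul_apply, LinearMap.neg_apply, Finsupp.linearCombination_single,
        Finsupp.smul_single, smul_eq_mul, ← Finsupp.single_sub, ← Finsupp.single_neg]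
      rcases n with _ | n
      · simp
      · congr 1
        push_cast
        ring)
    (by
      refine Finsupp.lhom_ext fun n b => ?_
      simp only [Ring.lie_def, lwH, lwM, lwP, LinearMap.sub_apply, Module.End.mul_apply,
        LinearMap.smul_apply, Finsupp.linearCombination_single, Finsupp.smul_single, smul_eq_mul]
      rcases n with _ | n
      · simp [← Finsupp.single_sub]
      · simp only [Nat.add_sub_cancel, ← Finsupp.single_sub]
        congr 1
        push_cast
        ring)
    (by simp [Ring.lie_def]) (by simp [Ring.lie_def]) (by simp [Ring.lie_def])

/-- `π` is an irreducible lowest weight representation of `𝔲(1,1)` with `(H, Z)`-lowest weight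
`(μ, ν)`. -/
def IsIrreducibleLowestWeight {W : Type*} [AddCommGroup W] [Module ℂ W]
    (π : Gl2 →ₗ⁅ℂ⁆ Module.End ℂ W) (μ ν : ℝ) : Prop :=
  (∃ w : W, w ≠ 0 ∧ π !![0, 0; 1, 0] w = 0 ∧ π !![1, 0; 0, -1] w = (μ : ℂ) • w ∧
    π 1 w = (ν : ℂ) • w) ∧
  ∀ U : Submodule ℂ W, (∀ A : Gl2, ∀ w ∈ U, π A w ∈ U) → U = ⊥ ∨ U = ⊤

/-! ### Standard modules -/

section standard

variable {m : ℕ} [NeZero m] (c : ZMod m → ℝ)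
variable {V : Type*} [AddCommGroup V] [Module ℂ V] (τ : Representation ℂ (DihedralGroup m) V)

/-- The relations `h ξ ⊗ v = 0` and `h g ⊗ v = h ⊗ g v` in `H_c(G, E) ⊗ V(τ)`. -/
def inducedRel : Submodule (RCA m c) (RCA m c ⊗[ℂ] V) :=
  Submodule.span (RCA m c)
    ({t | ∃ (h : RCA m c) (e : Fin 2 → ℂ) (v : V), t = (h * vec m c e) ⊗ₜ[ℂ] v} ∪
     {t | ∃ (h : RCA m c) (g : DihedralGroup m) (v : V),
        t = (h * grp m c g) ⊗ₜ[ℂ] v - h ⊗ₜ[ℂ] (τ g v)})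

/-- The standard module `M_c(τ)`: the `H_c(G, E)`-module induced from `V(τ)`, on which `E` acts
by zero. -/
abbrev StdMod : Type _ := (RCA m c ⊗[ℂ] V) ⧸ inducedRel c τ

/-- The map `V(τ) → M_c(τ)`, `v ↦ 1 ⊗ v`. -/
def incl : V →ₗ[ℂ] StdMod c τ :=
  (Submodule.mkQ (inducedRel c τ)).restrictScalars ℂ ∘ₗ TensorProduct.mk ℂ (RCA m c) V 1

/-- The degree-`k` part `M_c(τ)_k = ℂ_k ⊗ V(τ)`. -/
def degreePart (k : ℕ) : Submodule ℂ (StdMod c τ) :=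
  Submodule.span ℂ {w | ∃ (a b : ℕ) (v : V), a + b = k ∧ w = (X m c ^ a * Y m c ^ b) • incl c τ v}

/-- The `λ`-eigenspace of `Z₀ + ε σ` in the degree-`k` part of `ker E_-`. -/
def harmonics (ε : ℝ) (k : ℕ) (lam : ℝ) : Submodule ℂ (StdMod c τ) where
  carrier := {w | w ∈ degreePart c τ k ∧ Eminus m c • w = 0 ∧
    Ztilde m c ε • w = (lam : ℂ) • w}
  add_mem' := by
    rintro a b ⟨ha, ha', ha''⟩ ⟨hb, hb', hb''⟩
    exact ⟨add_mem ha hb, by rw [smul_add, ha', hb', add_zero], by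
      rw [smul_add, ha'', hb'', smul_add]⟩
  zero_mem' := ⟨zero_mem _, smul_zero _, by rw [smul_zero, smul_zero]⟩
  smul_mem' := by
    rintro a w ⟨hw, hw', hw''⟩
    exact ⟨Submodule.smul_mem _ a hw, by rw [smul_comm, hw', smul_zero], by
      rw [smul_comm, hw'', smul_comm]⟩

/-- `M_c(τ)` carries a positive definite Hermitian form which is contravariant for the
conjugate-linear anti-involution `*` of `H_c(G, E)`, determined by `ξ^* = x`, `η^* = y`, `x^* = ξ`,
`y^* = η` and `g^* = g⁻¹`. -/
def IsUnitarisable : Prop :=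
  ∃ β : StdMod c τ →ₗ⋆[ℂ] StdMod c τ →ₗ[ℂ] ℂ,
    (∀ p q, β q p = starRingEnd ℂ (β p q)) ∧
    (∀ p, p ≠ 0 → 0 < (β p p).re) ∧
    (∀ (e : Fin 2 → ℂ) p q, β (vec m c e • p) q = β p (covec m c (star e) • q)) ∧
    (∀ (e : Fin 2 → ℂ) p q, β (covec m c e • p) q = β p (vec m c (star e) • q)) ∧
    (∀ (g : DihedralGroup m) p q, β (grp m c g • p) q = β p (grp m c g⁻¹ • q))

open Classical in
/-- `M_c(τ) = ⨁ᵢ Sᵢ ⊗ L(kᵢ + 1 - N, λᵢ)` as a joint `(𝒱, 𝔲(1,1))`-decomposition, where `Sᵢ` is the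
`λᵢ`-eigenspace of `Z₀ + ε σ` on the harmonics of degree `kᵢ`, and is stable under the centraliser
`𝒱`. The isomorphism `Φ` intertwines the actions of `𝒱` (on `Sᵢ`) and `𝔲(1,1)` (on `L`), and
restricts to the inclusion of `Sᵢ = Sᵢ ⊗ v_0`. -/
def IsJointDecomposition (ε N : ℝ) {I : Type} (deg : I → ℕ) (lam : I → ℝ)
    (S : I → Submodule (Cent m c ε) (StdMod c τ)) : Prop :=
  (∀ i, (S i : Set (StdMod c τ)) = harmonics c τ ε (deg i) (lam i)) ∧
  (∀ i, IsIrreducibleLowestWeight (lowestWeightRep (deg i + 1 - N) (lam i))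
    (deg i + 1 - N) (lam i)) ∧
  ∃ Φ : (⨁ i, S i ⊗[ℂ] (ℕ →₀ ℂ)) ≃ₗ[ℂ] StdMod c τ,
    (∀ i (s : S i), Φ (DirectSum.of _ i (s ⊗ₜ Finsupp.single 0 1)) = s) ∧
    (∀ i (a : Cent m c ε) (s : S i) (l : ℕ →₀ ℂ),
      Φ (DirectSum.of _ i ((a • s) ⊗ₜ l)) = a • Φ (DirectSum.of _ i (s ⊗ₜ l))) ∧
    (∀ i (A : Gl2) (s : S i) (l : ℕ →₀ ℂ),
      Φ (DirectSum.of _ i (s ⊗ₜ lowestWeightRep (deg i + 1 - N) (lam i) A l)) =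
        u11 m c ε A • Φ (DirectSum.of _ i (s ⊗ₜ l)))

end standard

/-! ### Irreducible representations of the dihedral group and eigenvalues -/

section eigenvalues

variable {m : ℕ} [NeZero m]

/-- The one-dimensional representation given by a character. -/
def charRep (χ : DihedralGroup m →* ℂ) : Representation ℂ (DihedralGroup m) ℂ where
  toFun g := χ g • 1
  map_one' := by simp
  map_mul' g h := by
    ext
    simp [mul_comm]

/-- The matrix of `ρ^{(u)}(g)` in the basis `z, z̄`: `s_j z = ω^{ju} z̄` and `s_j z̄ = ω^{-ju} z`. -/
def rhoMat (u : ℕ) : DihedralGroup m → Matrix (Fin 2) (Fin 2) ℂ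
  | .r k => !![ZMod.stdAddChar (k * (u : ZMod m)), 0; 0, ZMod.stdAddChar (-(k * (u : ZMod m)))]
  | .sr j => !![0, ZMod.stdAddChar (-(j * (u : ZMod m))); ZMod.stdAddChar (j * (u : ZMod m)), 0]

/-- The two-dimensional representation `ρ^{(u)}`. -/
def rho (u : ℕ) : Representation ℂ (DihedralGroup m) (Fin 2 → ℂ) where
  toFun g := Matrix.toLin' (rhoMat u g)
  map_one' := by
    have : rhoMat u (1 : DihedralGroup m) = 1 := by
      rw [DihedralGroup.one_def]
      simp [rhoMat, Matrix.one_fin_two]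
    rw [this, Matrix.toLin'_one]
    rfl
  map_mul' g h := by
    have : rhoMat u (g * h) = rhoMat u g * rhoMat u h := by
      rcases g with i | i <;> rcases h with j | j <;>
      simp [rhoMat, ← AddChar.map_add_eq_mul] <;> ring_nf <;> simp
    rw [this, Matrix.toLin'_mul]
    rfl

/-- The sum `∑_j c_j ω^{jn} χ(s_j) = χ(σ(n))`, as a complex number. -/
def sigmaCharC (c : ZMod m → ℝ) (χ : DihedralGroup m →* ℂ) (n : ℤ) : ℂ :=
  ∑ j : ZMod m, (c j : ℂ) * ZMod.stdAddChar (j * (n : ZMod m)) * χ (DihedralGroup.sr j)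

/-- `χ(σ(n))`, the sole element of the set `σ(χ)_n`, as a real number
(see `ofReal_sigmaChar`). -/
def sigmaChar (c : ZMod m → ℝ) (χ : DihedralGroup m →* ℂ) (n : ℤ) : ℝ := (sigmaCharC c χ n).re

/-- `σ_n = ∑_j c_j ω^{jn}`, which is `χ(σ(n))` for the trivial character `χ`. -/
def sigmaNum (c : ZMod m → ℝ) (n : ℤ) : ℝ := sigmaChar c 1 n

/-- The scalar `N_c(χ) = χ(σ(0))` by which `σ` acts on a one-dimensional representation. -/
def Nc (c : ZMod m → ℝ) (χ : DihedralGroup m →* ℂ) : ℝ := sigmaChar c χ 0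

/-- If `c` is invariant under conjugation, then `χ(σ(n))` is real. -/
theorem ofReal_sigmaChar (c : ZMod m → ℝ)
    (hc : ∀ i j : ZMod m, IsConj (DihedralGroup.sr i) (DihedralGroup.sr j) → c i = c j)
    (χ : DihedralGroup m →* ℂ) (n : ℤ) : (sigmaChar c χ n : ℂ) = sigmaCharC c χ n := by
  refine Complex.conj_eq_iff_re.mp ?_
  have hconj : ∀ j : ZMod m, IsConj (DihedralGroup.sr (-j)) (DihedralGroup.sr j) := fun j => by
    rw [isConj_iff]
    exact ⟨DihedralGroup.sr 0, by
      rw [DihedralGroup.inv_sr, DihedralGroup.sr_mul_sr, DihedralGroup.r_mul_sr]; simp⟩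
  have hχ : ∀ j : ZMod m, χ (DihedralGroup.sr (-j)) = χ (DihedralGroup.sr j) := fun j => by
    obtain ⟨g, hg⟩ := isConj_iff.mp (hconj j)
    rw [← hg, map_mul, map_mul, mul_comm (χ g), mul_assoc, ← map_mul, mul_inv_cancel, map_one,
      mul_one]
  have hreal : ∀ j : ZMod m, starRingEnd ℂ (χ (DihedralGroup.sr j)) = χ (DihedralGroup.sr j) :=
    fun j => by
      have h : χ (DihedralGroup.sr j) * χ (DihedralGroup.sr j) = 1 := by
        rw [← map_mul, DihedralGroup.sr_mul_self, map_one]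
      rcases mul_self_eq_one_iff.mp h with h | h <;> simp [h]
  rw [sigmaCharC, map_sum, ← Equiv.sum_comp (Equiv.neg (ZMod m))]
  refine Finset.sum_congr rfl fun j _ => ?_
  simp only [Equiv.neg_apply, map_mul, Complex.conj_ofReal, hχ, hreal, hc _ _ (hconj j)]
  rw [← AddChar.map_neg_eq_conj, neg_mul, neg_neg]

/-- `λ^+ = √((k - N)² - (1 - ε²) s²)`; the other eigenvalue is `λ^- = -λ^+`. -/
def lamPlus (ε N : ℝ) (k : ℕ) (s : ℝ) : ℝ := √((k - N) ^ 2 - (1 - ε ^ 2) * s ^ 2)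

/-- `λ_k` for a one-dimensional representation `χ`: `λ_0 = ε χ(σ(0))` and
`λ_k = λ(σ_{χ,|k|})^{sign k}` for `k ≠ 0`. -/
def lamChar (c : ZMod m → ℝ) (ε : ℝ) (χ : DihedralGroup m →* ℂ) (k : ℤ) : ℝ :=
  if k = 0 then ε * sigmaChar c χ 0
  else (k.sign : ℝ) * lamPlus ε (Nc c χ) k.natAbs (sigmaChar c χ k.natAbs)

/-- The set `Λ_k` of eigenvalues for `ρ^{(u)}` (where `N_c = 0`) if `k > 0`; we put `Λ_0 = {0}`. -/
def Lam (c : ZMod m → ℝ) (ε : ℝ) (u k : ℕ) : Set ℝ :=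
  if k = 0 then {0}
  else {lamPlus ε 0 k (sigmaNum c (k + u)), -lamPlus ε 0 k (sigmaNum c (k + u)),
    lamPlus ε 0 k (sigmaNum c (k - u)), -lamPlus ε 0 k (sigmaNum c (k - u))}

end eigenvalues

end

end DihedralCherednik

namespace DihedralCherednik

noncomputable section

/-! ### Dunkl operators on polynomials with coefficients in a module -/

section model

variable {m : ℕ} [NeZero m]

/-! Suppose σ acts on V(τ) by the scalar N: this is N_c(χ) for a character and 0 for ρ^(u).
`UForm.exists_harm` splits each homogeneous part of M_c(τ) into harmonics and E₊ times the part two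
degrees lower, so the matter reduces to diagonalising Z̃ on the finite-dimensional spaces `harm` and
to knowing how the centraliser acts there.

Diagonalisation. By `casimir`, Z₀² + σ² = (H − 1)² + 4 E₊E₋, so Z₀² + σ² = (k − N)² on harmonics of
degree k. Let w be such a harmonic that is a weight vector for the rotations and satisfies Z₀w = μw.
Reflections anticommute with Z₀, and every reflection is s₀ times a rotation, so σw = t s₀w, where t
is the sum of the c_j times the weights. On the block spanned by w and s₀w the operator Z̃ has the
matrix ((μ, εt), (εt, −μ)), whose square is the scalar μ² + ε²t² = (k − N)² − (1 − ε²)t². Here t =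
±σ_{χ,k} for a character and t = σ_{k±u} for ρ^(u).

Positivity. Since x and y are adjoint to ξ and η, the operator xξ + yη = k − N + σ is positive in
degree k > 0. Testing it on p ± s₀p gives |t| < k − N. This makes the numbers under the roots
positive and forces μ ≠ 0. For a character, degree 1 gives N < 1; for ρ^(u) this is clear from N =
0. Then E₋E₊ is injective on homogeneous elements. Modulo zz̄ only z^k and z̄^k survive, so the
harmonics of degree k have dimension at most 2 dim V(τ). One block for a character, or two
orthogonal blocks for ρ^(u), therefore exhaust them.

The centraliser. By `mem_angular_of_commute`, everything that commutes with H and E₊ is a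
combination of elements Z₀^l g: in the PBW basis the symbol of an invariant is fixed by one
coefficient for each g, and Z₀^l g realises that coefficient. Hence each block is stable under 𝒱,
and each simple eigenline of Z̃ in a block is stable too (`UForm.exists_eigenline`).

The algebra itself is controlled by `polyHom`, an action by Dunkl operators on polynomials with
coefficients in any G-module with commuting, equivariant E-action. Zero E-action realises M_c(τ);
the regular module of ℂ[E*] ⋊ G gives the independence of the PBW monomials. Finally
`UForm.isJointDecomposition` sends s ⊗ v_n to E₊ⁿs; this map is injective by orthogonality and
surjective by induction on the degree. -/

/-- `ω ^ j`. -/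
abbrev om (j : ZMod m) : ℂ := ZMod.stdAddChar j

theorem om_eq (j : ZMod m) : om j = cosj j + Complex.I * sinj j := by
  rw [cosj, sinj, mul_comm, Complex.re_add_im]

theorem om_neg_eq (j : ZMod m) : om (-j) = cosj j - Complex.I * sinj j := by
  rw [om_eq, cosj_neg, sinj_neg]; ring

theorem om_add (i j : ZMod m) : om (i + j) = om i * om j := AddChar.map_add_eq_mul _ _ _

theorem om_mul_neg (j : ZMod m) : om j * om (-j) = 1 := by
  rw [← om_add, add_neg_cancel]; exact AddChar.map_zero_eq_one _

theorem om_zero : om (0 : ZMod m) = 1 := AddChar.map_zero_eq_one _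

/-! ### The dihedral action in real and complex coordinates -/

theorem act_apply (g : DihedralGroup m) : act m g = actMat g := rfl

theorem act_sr_zero (j : ZMod m) (w : Fin 2 → ℂ) :
    (act m (.sr j)).mulVec w 0 = cosj j * w 0 + sinj j * w 1 := by
  simp [act_apply, actMat, Matrix.mulVec, dotProduct, Fin.sum_univ_two]

theorem act_sr_one (j : ZMod m) (w : Fin 2 → ℂ) :
    (act m (.sr j)).mulVec w 1 = sinj j * w 0 - cosj j * w 1 := by
  simp [act_apply, actMat, Matrix.mulVec, dotProduct, Fin.sum_univ_two]; ring

theorem act_r_zero (j : ZMod m) (w : Fin 2 → ℂ) :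
    (act m (.r j)).mulVec w 0 = cosj j * w 0 + sinj j * w 1 := by
  simp [act_apply, actMat, Matrix.mulVec, dotProduct, Fin.sum_univ_two]

theorem act_r_one (j : ZMod m) (w : Fin 2 → ℂ) :
    (act m (.r j)).mulVec w 1 = -sinj j * w 0 + cosj j * w 1 := by
  simp [act_apply, actMat, Matrix.mulVec, dotProduct, Fin.sum_univ_two]

theorem cosj_double (j : ZMod m) : cosj j = 1 - 2 * root j 0 * root j 0 := by
  rw [cosj_eq, Real.cos_two_mul]
  simp only [root, Matrix.cons_val_zero]
  norm_cast
  nlinarith [Real.sin_sq_add_cos_sq (Real.pi * j.val / m)]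

theorem cosj_double' (j : ZMod m) : cosj j = 2 * root j 1 * root j 1 - 1 := by
  rw [cosj_eq, Real.cos_two_mul]
  simp only [root, Matrix.cons_val_one]
  norm_cast
  push_cast
  ring_nf

theorem sinj_double (j : ZMod m) : sinj j = - 2 * root j 0 * root j 1 := by
  rw [sinj_eq, Real.sin_two_mul]
  simp only [root, Matrix.cons_val_zero, Matrix.cons_val_one]
  push_cast
  ring

/-- The formula for the reflection in the root `α_j`. -/
theorem act_sr_eq (j : ZMod m) (w : Fin 2 → ℂ) :
    (act m (.sr j)).mulVec w = w - (2 * (root j ⬝ᵥ w)) • root j := by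
  ext i
  fin_cases i
  · simp only [Fin.zero_eta, act_sr_zero, Pi.sub_apply, Pi.smul_apply, smul_eq_mul, dotProduct,
      Fin.sum_univ_two]
    linear_combination w 0 * cosj_double j + w 1 * sinj_double j
  · simp only [Fin.mk_one, act_sr_one, Pi.sub_apply, Pi.smul_apply, smul_eq_mul, dotProduct,
      Fin.sum_univ_two]
    linear_combination -w 1 * cosj_double' j + w 0 * sinj_double j

theorem dot_act (g : DihedralGroup m) (v w : Fin 2 → ℂ) :
    (act m g).mulVec w ⬝ᵥ v = w ⬝ᵥ (act m g⁻¹).mulVec v := by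
  rcases g with k | j
  · simp only [dotProduct, Fin.sum_univ_two, DihedralGroup.inv_r, act_r_zero, act_r_one, cosj_neg,
      sinj_neg]
    ring
  · simp only [dotProduct, Fin.sum_univ_two, DihedralGroup.inv_sr, act_sr_zero, act_sr_one]
    ring

theorem act_mulVec_mul (g h : DihedralGroup m) (v : Fin 2 → ℂ) :
    (act m (g * h)).mulVec v = (act m g).mulVec ((act m h).mulVec v) := by
  rw [map_mul, Matrix.mulVec_mulVec]

/-- The coefficient of `z` in a covector, with respect to the basis `z, z̄`. -/
def zCoef (w : Fin 2 → ℂ) : ℂ := (w 0 - Complex.I * w 1) / 2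

/-- The coefficient of `z̄` in a covector, with respect to the basis `z, z̄`. -/
def zbCoef (w : Fin 2 → ℂ) : ℂ := (w 0 + Complex.I * w 1) / 2

theorem zCoef_sr (j : ZMod m) (w : Fin 2 → ℂ) :
    zCoef ((act m (.sr j)).mulVec w) = om (-j) * zbCoef w := by
  rw [zCoef, zbCoef, act_sr_zero, act_sr_one, om_neg_eq]
  linear_combination (w 1 * sinj j / 2) * Complex.I_mul_I

theorem zbCoef_sr (j : ZMod m) (w : Fin 2 → ℂ) :
    zbCoef ((act m (.sr j)).mulVec w) = om j * zCoef w := by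
  rw [zCoef, zbCoef, act_sr_zero, act_sr_one, om_eq]
  linear_combination (w 1 * sinj j / 2) * Complex.I_mul_I

theorem zCoef_r (j : ZMod m) (w : Fin 2 → ℂ) :
    zCoef ((act m (.r j)).mulVec w) = om j * zCoef w := by
  rw [zCoef, zCoef, act_r_zero, act_r_one, om_eq]
  linear_combination (w 1 * sinj j / 2) * Complex.I_mul_I

theorem zbCoef_r (j : ZMod m) (w : Fin 2 → ℂ) :
    zbCoef ((act m (.r j)).mulVec w) = om (-j) * zbCoef w := by
  rw [zbCoef, zbCoef, act_r_zero, act_r_one, om_neg_eq]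
  linear_combination (w 1 * sinj j / 2) * Complex.I_mul_I

variable {V : Type*} [AddCommGroup V] [Module ℂ V]

/-! ### Polynomials with coefficients, and operators with prescribed commutators -/

variable (V) in
/-- Polynomials with coefficients in `V`; `single (a, b) v` stands for `z ^ a z̄ ^ b ⊗ v`. -/
abbrev Poly : Type _ := ℕ × ℕ →₀ V

/-- Multiplication by `z`. -/
def mulZ : Module.End ℂ (Poly V) := Finsupp.lmapDomain V ℂ fun p => (p.1 + 1, p.2)

/-- Multiplication by `z̄`. -/
def mulZb : Module.End ℂ (Poly V) := Finsupp.lmapDomain V ℂ fun p => (p.1, p.2 + 1)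

@[simp] theorem mulZ_single (a b : ℕ) (v : V) :
    mulZ (Finsupp.single (a, b) v) = Finsupp.single (a + 1, b) v := by
  simp [mulZ]

@[simp] theorem mulZb_single (a b : ℕ) (v : V) :
    mulZb (Finsupp.single (a, b) v) = Finsupp.single (a, b + 1) v := by
  simp [mulZb]

theorem mulZ_mulZb : (mulZ * mulZb : Module.End ℂ (Poly V)) = mulZb * mulZ := by
  refine Finsupp.lhom_ext fun p v => ?_
  obtain ⟨a, b⟩ := p
  simp

/-- Multiplication by a covector. -/
def mulCov : (Fin 2 → ℂ) →ₗ[ℂ] Module.End ℂ (Poly V) where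
  toFun w := zCoef w • mulZ + zbCoef w • mulZb
  map_add' w w' := by
    simp only [zCoef, zbCoef, Pi.add_apply]; module
  map_smul' a w := by
    simp only [zCoef, zbCoef, Pi.smul_apply, smul_eq_mul, RingHom.id_apply]; module

theorem mulCov_apply (w : Fin 2 → ℂ) :
    mulCov (V := V) w = zCoef w • mulZ + zbCoef w • mulZb := rfl

theorem mulCov_z : mulCov (V := V) ![1, Complex.I] = mulZ := by
  simp [mulCov_apply, zCoef, zbCoef]

theorem mulCov_zb : mulCov (V := V) ![1, -Complex.I] = mulZb := by
  simp [mulCov_apply, zCoef, zbCoef]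

theorem mulCov_comm (w w' : Fin 2 → ℂ) :
    mulCov (V := V) w * mulCov w' = mulCov w' * mulCov w := by
  simp only [mulCov_apply, mul_add, add_mul, smul_mul_assoc, mul_smul_comm, mulZ_mulZb]
  module

/-- The action of a group element on polynomials with coefficients in a representation. -/
def polyRepFun (τ : Representation ℂ (DihedralGroup m) V) :
    DihedralGroup m → Module.End ℂ (Poly V)
  | .r k => Finsupp.lsum ℂ fun p => om (k * ((p.1 : ZMod m) - (p.2 : ZMod m))) •
      (Finsupp.lsingle p ∘ₗ τ (.r k))
  | .sr j => Finsupp.lsum ℂ fun p => om (j * ((p.1 : ZMod m) - (p.2 : ZMod m))) •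
      (Finsupp.lsingle p.swap ∘ₗ τ (.sr j))

/-- The representation on polynomials with coefficients in a representation. -/
def polyRep (τ : Representation ℂ (DihedralGroup m) V) :
    Representation ℂ (DihedralGroup m) (Poly V) where
  toFun := polyRepFun τ
  map_one' := by
    rw [DihedralGroup.one_def]
    refine Finsupp.lhom_ext fun p v => ?_
    simp [polyRepFun]
  map_mul' := by
    have hτ : ∀ g h : DihedralGroup m, ∀ v, τ g (τ h v) = τ (g * h) v := fun g h v => by
      rw [map_mul]; rfl
    rintro (i | i) (j | j) <;> refine Finsupp.lhom_ext fun p v => ?_ <;> obtain ⟨a, b⟩ := p <;>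
    simp only [DihedralGroup.r_mul_r, DihedralGroup.r_mul_sr, DihedralGroup.sr_mul_r,
      DihedralGroup.sr_mul_sr, polyRepFun, Finsupp.lsum_single, LinearMap.smul_apply,
      LinearMap.comp_apply, Finsupp.lsingle_apply, Module.End.mul_apply, map_smul, smul_smul,
      Prod.swap_prod_mk, hτ] <;>
    congr 1 <;> rw [← om_add] <;> congr 1 <;> ring

@[simp] theorem polyRep_r_single (τ : Representation ℂ (DihedralGroup m) V) (k : ZMod m)
    (a b : ℕ) (v : V) : polyRep τ (.r k) (Finsupp.single (a, b) v) =
      om (k * ((a : ZMod m) - (b : ZMod m))) • Finsupp.single (a, b) (τ (.r k) v) := by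
  simp [polyRep, polyRepFun]

@[simp] theorem polyRep_sr_single (τ : Representation ℂ (DihedralGroup m) V) (k : ZMod m)
    (a b : ℕ) (v : V) : polyRep τ (.sr k) (Finsupp.single (a, b) v) =
      om (k * ((a : ZMod m) - (b : ZMod m))) • Finsupp.single (b, a) (τ (.sr k) v) := by
  simp [polyRep, polyRepFun]

theorem polyRep_mulCov (τ : Representation ℂ (DihedralGroup m) V) (g : DihedralGroup m)
    (w : Fin 2 → ℂ) :
    polyRep τ g * mulCov w = mulCov ((act m g).mulVec w) * polyRep τ g := by
  rcases g with k | k <;> refine Finsupp.lhom_ext fun p v => ?_ <;> obtain ⟨a, b⟩ := p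
  · have h1 : k * (((a + 1 : ℕ) : ZMod m) - (b : ZMod m)) =
      k * ((a : ZMod m) - (b : ZMod m)) + k := by push_cast; ring
    have h2 : k * ((a : ZMod m) - ((b + 1 : ℕ) : ZMod m)) =
      k * ((a : ZMod m) - (b : ZMod m)) + -k := by push_cast; ring
    simp only [Module.End.mul_apply, mulCov_apply, LinearMap.add_apply, LinearMap.smul_apply,
      mulZ_single, mulZb_single, map_add, map_smul, polyRep_r_single, zCoef_r, zbCoef_r, h1, h2,
      om_add]
    module
  · have h1 : k * (((a + 1 : ℕ) : ZMod m) - (b : ZMod m)) =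
      k * ((a : ZMod m) - (b : ZMod m)) + k := by push_cast; ring
    have h2 : k * ((a : ZMod m) - ((b + 1 : ℕ) : ZMod m)) =
      k * ((a : ZMod m) - (b : ZMod m)) + -k := by push_cast; ring
    simp only [Module.End.mul_apply, mulCov_apply, LinearMap.add_apply, LinearMap.smul_apply,
      mulZ_single, mulZb_single, map_add, map_smul, polyRep_sr_single, zCoef_sr, zbCoef_sr, h1, h2,
      om_add]
    module

/-- The restriction of `extendFrom` to `z ^ a z̄ ^ b ⊗ V`. -/
def extendCoeff (f : V →ₗ[ℂ] Poly V) (A B : Module.End ℂ (Poly V)) : ℕ → ℕ → (V →ₗ[ℂ] Poly V)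
  | 0, 0 => f
  | 0, b + 1 => mulZb ∘ₗ extendCoeff f A B 0 b + B ∘ₗ Finsupp.lsingle (0, b)
  | a + 1, b => mulZ ∘ₗ extendCoeff f A B a b + A ∘ₗ Finsupp.lsingle (a, b)

/-- The linear map `T` on polynomials with `T (1 ⊗ v) = f v`, `[T, z] = A` and `[T, z̄] = B`. -/
def extendFrom (f : V →ₗ[ℂ] Poly V) (A B : Module.End ℂ (Poly V)) : Module.End ℂ (Poly V) :=
  Finsupp.lsum ℂ fun p => extendCoeff f A B p.1 p.2

theorem extendFrom_single (f : V →ₗ[ℂ] Poly V) (A B : Module.End ℂ (Poly V)) (a b : ℕ) (v : V) :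
    extendFrom f A B (Finsupp.single (a, b) v) = extendCoeff f A B a b v := by
  simp [extendFrom]

theorem extendFrom_zero (f : V →ₗ[ℂ] Poly V) (A B : Module.End ℂ (Poly V)) (v : V) :
    extendFrom f A B (Finsupp.single (0, 0) v) = f v := by
  rw [extendFrom_single, extendCoeff]

theorem extendFrom_mulZ (f : V →ₗ[ℂ] Poly V) (A B : Module.End ℂ (Poly V)) :
    extendFrom f A B * mulZ = mulZ * extendFrom f A B + A := by
  refine Finsupp.lhom_ext fun p v => ?_
  obtain ⟨a, b⟩ := p
  simp only [Module.End.mul_apply, LinearMap.add_apply, mulZ_single, extendFrom_single,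
    extendCoeff, LinearMap.comp_apply, Finsupp.lsingle_apply]

/-- The recursion strips powers of z before powers of z̄, so [T, z] = A holds by construction, while
[T, z̄] = B must be carried through an induction on the power of z. The hypothesis is [A, z̄] = [B,
z], the compatibility that the Jacobi identity demands because z and z̄ commute. -/
theorem extendFrom_mulZb (f : V →ₗ[ℂ] Poly V) (A B : Module.End ℂ (Poly V))
    (h : A * mulZb - mulZb * A = B * mulZ - mulZ * B) :
    extendFrom f A B * mulZb = mulZb * extendFrom f A B + B := by
  refine Finsupp.lhom_ext fun p v => ?_
  obtain ⟨a, b⟩ := p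
  simp only [Module.End.mul_apply, LinearMap.add_apply, mulZb_single, extendFrom_single]
  induction a with
  | zero => simp only [extendCoeff, LinearMap.add_apply, LinearMap.comp_apply,
      Finsupp.lsingle_apply]
  | succ a ih =>
    have h1 := LinearMap.congr_fun h (Finsupp.single (a, b) v)
    have h2 := LinearMap.congr_fun (mulZ_mulZb (V := V)) (extendCoeff f A B a b v)
    simp only [Module.End.mul_apply, LinearMap.sub_apply, mulZ_single, mulZb_single] at h1 h2
    simp only [extendCoeff, LinearMap.add_apply, LinearMap.comp_apply, Finsupp.lsingle_apply, ih,
      map_add]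
    linear_combination (norm := module) h1 + h2

/-- A linear map vanishes if it vanishes on constants and intertwines multiplication by `z` and
`z̄` with some operators. -/
theorem poly_eq_zero {S A B : Module.End ℂ (Poly V)}
    (h0 : ∀ v, S (Finsupp.single (0, 0) v) = 0) (hA : S * mulZ = A * S) (hB : S * mulZb = B * S) :
    S = 0 := by
  refine Finsupp.lhom_ext fun p v => ?_
  obtain ⟨a, b⟩ := p
  induction a with
  | zero =>
    induction b with
    | zero => exact h0 v
    | succ b ih =>
      have := LinearMap.congr_fun hB (Finsupp.single (0, b) v)
      simpa [ih] using this
  | succ a ih =>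
    have := LinearMap.congr_fun hA (Finsupp.single (a, b) v)
    simpa [ih] using this

/-- With w a multiplication operator, the defect gT − T′g passes through multiplications. Combined
with `poly_eq_zero`, equivariance of a Dunkl operator then needs checking on constants only. -/
theorem intertwine_mul {R : Type*} [Ring R] {g w w' T T' C C' : R} (h1 : g * w = w' * g)
    (h2 : T * w = w * T + C) (h3 : T' * w' = w' * T' + C') (h4 : g * C = C' * g) :
    (g * T - T' * g) * w = w' * (g * T - T' * g) := by
  linear_combination (norm := noncomm_ring) g * h2 - T' * h1 - h3 * g + h4 + h1 * T

/-- By the Jacobi identity, [T, T′] commutes with w as soon as [T, C′] = [T′, C]. -/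
theorem commutator_mul {R : Type*} [Ring R] {w T T' C C' : R}
    (h1 : T * w = w * T + C) (h2 : T' * w = w * T' + C')
    (h3 : T * C' - C' * T = T' * C - C * T') :
    (T * T' - T' * T) * w = w * (T * T' - T' * T) := by
  linear_combination (norm := noncomm_ring) T * h2 + h1 * T' - T' * h1 - h2 * T + h3

/-! ### Dunkl operators with coefficients in a module -/

/-- A `G`-representation with an equivariant action of `E` by commuting operators. -/
structure EGModule (m : ℕ) [NeZero m] (V : Type*) [AddCommGroup V] [Module ℂ V] where
  rep : Representation ℂ (DihedralGroup m) V
  vec : (Fin 2 → ℂ) →ₗ[ℂ] Module.End ℂ V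
  comm : ∀ e e', vec e * vec e' = vec e' * vec e
  equivariant : ∀ g e, rep g * vec e = vec ((act m g).mulVec e) * rep g

variable (c : ZMod m → ℝ) (D : EGModule m V)

/-- The operator `[e, w] = ⟨w, e⟩ - ∑ⱼ cⱼ ⟨w, e - sⱼ e⟩ sⱼ`. -/
def cherOp (w e : Fin 2 → ℂ) : Module.End ℂ (Poly V) :=
  (w ⬝ᵥ e) • 1 - ∑ j : ZMod m, ((c j : ℂ) * (w ⬝ᵥ (e - (act m (.sr j)).mulVec e))) •
    polyRep D.rep (.sr j)

theorem cherOp_add_right (w e e' : Fin 2 → ℂ) :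
    cherOp c D w (e + e') = cherOp c D w e + cherOp c D w e' := by
  have (j : ZMod m) : w ⬝ᵥ (e + e' - (act m (.sr j)).mulVec (e + e')) =
      w ⬝ᵥ (e - (act m (.sr j)).mulVec e) + w ⬝ᵥ (e' - (act m (.sr j)).mulVec e') := by
    rw [← dotProduct_add, Matrix.mulVec_add]; congr 1; abel
  simp only [cherOp, this, mul_add, add_smul, Finset.sum_add_distrib, dotProduct_add]
  abel

theorem cherOp_smul_right (a : ℂ) (w e : Fin 2 → ℂ) :
    cherOp c D w (a • e) = a • cherOp c D w e := by
  have (j : ZMod m) : w ⬝ᵥ (a • e - (act m (.sr j)).mulVec (a • e)) =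
      a * w ⬝ᵥ (e - (act m (.sr j)).mulVec e) := by
    rw [Matrix.mulVec_smul, ← smul_sub, dotProduct_smul, smul_eq_mul]
  simp only [cherOp, this, dotProduct_smul, smul_sub, Finset.smul_sum, smul_smul, smul_eq_mul]
  congr 1
  refine Finset.sum_congr rfl fun j _ => ?_
  congr 1; ring

theorem cherOp_left (w e : Fin 2 → ℂ) : cherOp c D w e =
    zCoef w • cherOp c D ![1, Complex.I] e + zbCoef w • cherOp c D ![1, -Complex.I] e := by
  have hw (e : Fin 2 → ℂ) : w ⬝ᵥ e =
      zCoef w * (![1, Complex.I] ⬝ᵥ e) + zbCoef w * (![1, -Complex.I] ⬝ᵥ e) := by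
    simp only [dotProduct, Fin.sum_univ_two, zCoef, zbCoef, Matrix.cons_val_zero,
      Matrix.cons_val_one]
    linear_combination (w 1 * e 1) * Complex.I_mul_I
  simp only [cherOp, hw, smul_sub, Finset.smul_sum, smul_smul, mul_add, add_smul,
    Finset.sum_add_distrib]
  have h1 : ∀ j : ZMod m, ∀ a b : ℂ, (c j : ℂ) * (a * b) = a * ((c j : ℂ) * b) := fun j a b => by
    ring
  simp only [h1]
  module

/-- Both e − s e and w − s w are multiples of the same root, so the two sides are the same product
of pairings times that root. This symmetry is the compatibility condition under which the Dunkl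
operator exists. -/
theorem dot_reflect_symm (j : ZMod m) (w w' e : Fin 2 → ℂ) :
    (w ⬝ᵥ (e - (act m (.sr j)).mulVec e)) • (w' - (act m (.sr j)).mulVec w') =
    (w' ⬝ᵥ (e - (act m (.sr j)).mulVec e)) • (w - (act m (.sr j)).mulVec w) := by
  simp only [act_sr_eq, sub_sub_cancel, dotProduct_smul, smul_smul, smul_eq_mul]
  rw [dotProduct_comm (root j) w', dotProduct_comm (root j) w]
  congr 1; ring

/-- The same rank-one property, now symmetric in the two vectors; it is the source of the
commutativity of the Dunkl operators. -/
theorem dot_reflect_symm' (j : ZMod m) (w e e' : Fin 2 → ℂ) :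
    (w ⬝ᵥ (e - (act m (.sr j)).mulVec e)) • (e' - (act m (.sr j)).mulVec e') =
    (w ⬝ᵥ (e' - (act m (.sr j)).mulVec e')) • (e - (act m (.sr j)).mulVec e) := by
  simp only [act_sr_eq, sub_sub_cancel, dotProduct_smul, smul_smul, smul_eq_mul]
  congr 1; ring

theorem cherOp_mulCov (w w' e : Fin 2 → ℂ) :
    cherOp c D w e * mulCov w' - mulCov w' * cherOp c D w e =
      ∑ j : ZMod m, (c j : ℂ) • (mulCov ((w ⬝ᵥ (e - (act m (.sr j)).mulVec e)) •
        (w' - (act m (.sr j)).mulVec w')) * polyRep D.rep (.sr j)) := by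
  simp only [cherOp, sub_mul, mul_sub, smul_mul_assoc, one_mul, mul_smul_comm, mul_one,
    Finset.sum_mul, Finset.mul_sum, polyRep_mulCov, map_smul, map_sub, smul_sub, smul_smul,
    Finset.sum_sub_distrib]
  abel

/-- The Dunkl operator of a vector. -/
def dunklFun (e : Fin 2 → ℂ) : Module.End ℂ (Poly V) :=
  extendFrom (Finsupp.lsingle (0, 0) ∘ₗ D.vec e) (cherOp c D ![1, Complex.I] e)
    (cherOp c D ![1, -Complex.I] e)

theorem dunklFun_zero (e : Fin 2 → ℂ) (v : V) :
    dunklFun c D e (Finsupp.single (0, 0) v) = Finsupp.single (0, 0) (D.vec e v) := by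
  rw [dunklFun, extendFrom_zero]; rfl

theorem dunklFun_mulZ (e : Fin 2 → ℂ) :
    dunklFun c D e * mulZ = mulZ * dunklFun c D e + cherOp c D ![1, Complex.I] e :=
  extendFrom_mulZ _ _ _

theorem dunklFun_mulZb (e : Fin 2 → ℂ) :
    dunklFun c D e * mulZb = mulZb * dunklFun c D e + cherOp c D ![1, -Complex.I] e := by
  refine extendFrom_mulZb _ _ _ ?_
  rw [← mulCov_z, ← mulCov_zb, cherOp_mulCov, cherOp_mulCov]
  refine Finset.sum_congr rfl fun j _ => ?_
  rw [dot_reflect_symm]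

theorem dunklFun_mulCov (w e : Fin 2 → ℂ) :
    dunklFun c D e * mulCov w = mulCov w * dunklFun c D e + cherOp c D w e := by
  rw [mulCov_apply, cherOp_left]
  simp only [mul_add, add_mul, mul_smul_comm, smul_mul_assoc, dunklFun_mulZ, dunklFun_mulZb]
  module

/-- The Dunkl operators. -/
def dunkl : (Fin 2 → ℂ) →ₗ[ℂ] Module.End ℂ (Poly V) where
  toFun := dunklFun c D
  map_add' e e' := by
    rw [← sub_eq_zero]
    refine poly_eq_zero (A := mulZ) (B := mulZb) (fun v => ?_) ?_ ?_
    · simp only [LinearMap.sub_apply, LinearMap.add_apply, dunklFun_zero, map_add,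
        Finsupp.single_add, sub_self]
    · simp only [sub_mul, add_mul, mul_sub, mul_add, dunklFun_mulZ, cherOp_add_right]; abel
    · simp only [sub_mul, add_mul, mul_sub, mul_add, dunklFun_mulZb, cherOp_add_right]; abel
  map_smul' a e := by
    rw [← sub_eq_zero]
    refine poly_eq_zero (A := mulZ) (B := mulZb) (fun v => ?_) ?_ ?_
    · simp only [LinearMap.sub_apply, LinearMap.smul_apply, dunklFun_zero, map_smul,
        Finsupp.smul_single, RingHom.id_apply, sub_self]
    · simp only [sub_mul, smul_mul_assoc, mul_sub, mul_smul_comm, dunklFun_mulZ,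
        cherOp_smul_right, RingHom.id_apply]; module
    · simp only [sub_mul, smul_mul_assoc, mul_sub, mul_smul_comm, dunklFun_mulZb,
        cherOp_smul_right, RingHom.id_apply]; module

theorem dunkl_single_zero (e : Fin 2 → ℂ) (v : V) :
    dunkl c D e (Finsupp.single (0, 0) v) = Finsupp.single (0, 0) (D.vec e v) :=
  dunklFun_zero c D e v

theorem dunkl_mulCov (w e : Fin 2 → ℂ) :
    dunkl c D e * mulCov w = mulCov w * dunkl c D e + cherOp c D w e :=
  dunklFun_mulCov c D w e

/-- Conjugation by g permutes the reflections, by a shift of the index for a rotation and by a flip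
for a reflection. Invariance of `c` allows the sum to be reindexed along this permutation. -/
theorem polyRep_cherOp
    (hc : ∀ i j : ZMod m, IsConj (DihedralGroup.sr i) (DihedralGroup.sr j) → c i = c j)
    (g : DihedralGroup m) (w e : Fin 2 → ℂ) :
    polyRep D.rep g * cherOp c D w e =
      cherOp c D ((act m g).mulVec w) ((act m g).mulVec e) * polyRep D.rep g := by
  obtain ⟨f, hf⟩ : ∃ f : ZMod m ≃ ZMod m, ∀ j, g * .sr j = .sr (f j) * g := by
    rcases g with k | k
    · exact ⟨Equiv.subRight (2 * k), fun j => by simp; ring⟩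
    · exact ⟨Equiv.subLeft (2 * k), fun j => by simp; ring⟩
  have hdot (w e : Fin 2 → ℂ) : (act m g).mulVec w ⬝ᵥ (act m g).mulVec e = w ⬝ᵥ e := by
    rw [dot_act, ← act_mulVec_mul, inv_mul_cancel, map_one, Matrix.one_mulVec]
  simp only [cherOp, mul_sub, sub_mul, mul_smul_comm, smul_mul_assoc, mul_one, one_mul,
    Finset.mul_sum, Finset.sum_mul, hdot]
  congr 1
  rw [← Equiv.sum_comp f fun j => ((c j : ℂ) * (act m g).mulVec w ⬝ᵥ ((act m g).mulVec e -
    (act m (.sr j)).mulVec ((act m g).mulVec e))) • (polyRep D.rep (.sr j) * polyRep D.rep g)]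
  refine Finset.sum_congr rfl fun j _ => ?_
  have hcj : c (f j) = c j :=
    (hc _ _ (isConj_iff.mpr ⟨g, by rw [hf, mul_inv_cancel_right]⟩)).symm
  rw [← map_mul, ← map_mul, ← act_mulVec_mul, ← hf, act_mulVec_mul, ← Matrix.mulVec_sub, hdot, hcj]

theorem polyRep_dunkl
    (hc : ∀ i j : ZMod m, IsConj (DihedralGroup.sr i) (DihedralGroup.sr j) → c i = c j)
    (g : DihedralGroup m) (e : Fin 2 → ℂ) :
    polyRep D.rep g * dunkl c D e = dunkl c D ((act m g).mulVec e) * polyRep D.rep g := by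
  rw [← sub_eq_zero]
  have key (w : Fin 2 → ℂ) : (polyRep D.rep g * dunkl c D e -
      dunkl c D ((act m g).mulVec e) * polyRep D.rep g) * mulCov w =
      mulCov ((act m g).mulVec w) * (polyRep D.rep g * dunkl c D e -
      dunkl c D ((act m g).mulVec e) * polyRep D.rep g) := by
    have h1 := polyRep_mulCov D.rep g w
    have h2 := dunkl_mulCov c D w e
    have h3 := dunkl_mulCov c D ((act m g).mulVec w) ((act m g).mulVec e)
    have h4 := polyRep_cherOp c D hc g w e
    exact intertwine_mul h1 h2 h3 h4
  refine poly_eq_zero (fun v => ?_) (mulCov_z (V := V) ▸ key _) (mulCov_zb (V := V) ▸ key _)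
  have h := LinearMap.congr_fun (D.equivariant g e) v
  rcases g with k | k <;> simp_all [dunkl_single_zero]

theorem dunkl_cherOp
    (hc : ∀ i j : ZMod m, IsConj (DihedralGroup.sr i) (DihedralGroup.sr j) → c i = c j)
    (w e e' : Fin 2 → ℂ) :
    dunkl c D e * cherOp c D w e' - cherOp c D w e' * dunkl c D e =
      - ∑ j : ZMod m, (c j : ℂ) • (dunkl c D ((w ⬝ᵥ (e' - (act m (.sr j)).mulVec e')) •
        (e - (act m (.sr j)).mulVec e)) * polyRep D.rep (.sr j)) := by
  simp only [cherOp, sub_mul, mul_sub, smul_mul_assoc, one_mul, mul_smul_comm, mul_one,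
    Finset.sum_mul, Finset.mul_sum, polyRep_dunkl c D hc, map_smul, map_sub, smul_sub, smul_smul,
    Finset.sum_sub_distrib]
  abel

/-- The commutator of two Dunkl operators commutes with all multiplications, so it vanishes once it
vanishes on constants, where it is the commutator of the E-action on the coefficients. -/
theorem dunkl_comm
    (hc : ∀ i j : ZMod m, IsConj (DihedralGroup.sr i) (DihedralGroup.sr j) → c i = c j)
    (e e' : Fin 2 → ℂ) : dunkl c D e * dunkl c D e' = dunkl c D e' * dunkl c D e := by
  rw [← sub_eq_zero]
  have key (w : Fin 2 → ℂ) : (dunkl c D e * dunkl c D e' - dunkl c D e' * dunkl c D e) *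
      mulCov w = mulCov w * (dunkl c D e * dunkl c D e' - dunkl c D e' * dunkl c D e) := by
    have h1 := dunkl_mulCov c D w e
    have h2 := dunkl_mulCov c D w e'
    have h3 : dunkl c D e * cherOp c D w e' - cherOp c D w e' * dunkl c D e =
        dunkl c D e' * cherOp c D w e - cherOp c D w e * dunkl c D e' := by
      rw [dunkl_cherOp c D hc, dunkl_cherOp c D hc]
      simp only [dot_reflect_symm' _ w e e']
    exact commutator_mul h1 h2 h3
  refine poly_eq_zero (fun v => ?_) (mulCov_z (V := V) ▸ key _) (mulCov_zb (V := V) ▸ key _)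
  have h := LinearMap.congr_fun (D.comm e e') v
  simp_all [dunkl_single_zero]

/-! ### The Cherednik algebra acting by Dunkl operators -/

/-- The action of the generators of the rational Cherednik algebra. -/
def genOp : Gen m → Module.End ℂ (Poly V)
  | .vec e => dunkl c D e
  | .covec w => mulCov w
  | .grp g => polyRep D.rep g

theorem cherOp_eq (w e : Fin 2 → ℂ) : cherOp c D w e = algebraMap ℂ _ (w ⬝ᵥ e) -
    2 * ∑ j : ZMod m, ((w ⬝ᵥ root j) * (root j ⬝ᵥ e) * (c j : ℂ)) • polyRep D.rep (.sr j) := by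
  rw [cherOp, Algebra.algebraMap_eq_smul_one, Finset.mul_sum]
  congr 1
  refine Finset.sum_congr rfl fun j _ => ?_
  rw [act_sr_eq, sub_sub_cancel, dotProduct_smul, smul_eq_mul,
    show ∀ x : Module.End ℂ (Poly V), 2 * x = (2 : ℂ) • x from fun x => by rw [two_smul, two_mul],
    smul_smul]
  congr 1; ring

/-- The induced module of an `E`- and `G`-module, as a representation of the rational Cherednik
algebra on polynomials. -/
def polyHom (hc : ∀ i j : ZMod m, IsConj (DihedralGroup.sr i) (DihedralGroup.sr j) → c i = c j) :
    RCA m c →ₐ[ℂ] Module.End ℂ (Poly V) :=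
  RingQuot.liftAlgHom ℂ ⟨FreeAlgebra.lift ℂ (genOp c D), by
    intro a b h
    cases h with
    | vec_add v v' => simp [genOp]
    | vec_smul a v => simp [genOp]
    | covec_add v v' => simp [genOp]
    | covec_smul a v => simp [genOp]
    | grp_one => simp [genOp]
    | grp_mul g g' => simp [genOp]
    | grp_vec g v => simp [genOp, polyRep_dunkl c D hc]
    | grp_covec g v => simp [genOp, polyRep_mulCov]
    | vec_comm v v' => simp only [map_mul, FreeAlgebra.lift_ι_apply, genOp, dunkl_comm c D hc v v']
    | covec_comm w w' => simp only [map_mul, FreeAlgebra.lift_ι_apply, genOp, mulCov_comm w w']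
    | cherednik v w =>
      simp only [map_sub, map_mul, map_sum, map_smul, AlgHom.commutes, map_ofNat,
        FreeAlgebra.lift_ι_apply, genOp, dunkl_mulCov, ← cherOp_eq, add_sub_cancel_left]⟩

variable (hc : ∀ i j : ZMod m, IsConj (DihedralGroup.sr i) (DihedralGroup.sr j) → c i = c j)

theorem polyHom_mk (a : FreeAlgebra ℂ (Gen m)) :
    polyHom c D hc (mk m c a) = FreeAlgebra.lift ℂ (genOp c D) a :=
  RingQuot.liftAlgHom_mkAlgHom_apply ℂ _ _ _

theorem polyHom_vec (e : Fin 2 → ℂ) : polyHom c D hc (vec m c e) = dunkl c D e := by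
  rw [vec, polyHom_mk, FreeAlgebra.lift_ι_apply, genOp]

theorem polyHom_covec (e : Fin 2 → ℂ) : polyHom c D hc (covec m c e) = mulCov e := by
  rw [covec, polyHom_mk, FreeAlgebra.lift_ι_apply, genOp]

theorem polyHom_grp (g : DihedralGroup m) : polyHom c D hc (grp m c g) = polyRep D.rep g := by
  rw [grp, polyHom_mk, FreeAlgebra.lift_ι_apply, genOp]

end model

/-! ### Complex coordinates -/

section complexCoordinates

variable (m : ℕ) [NeZero m] (c : ZMod m → ℝ)

/-- `z = x + i y`. -/
def zC : RCA m c := covec m c ![1, Complex.I]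

/-- `z̄ = x - i y`. -/
def zbC : RCA m c := covec m c ![1, -Complex.I]

/-- `∂ = ξ - i η`. -/
def dV : RCA m c := vec m c ![1, -Complex.I]

/-- `∂̄ = ξ + i η`. -/
def dbV : RCA m c := vec m c ![1, Complex.I]

end complexCoordinates

/-! ### Commutation relations for z, z̄, ∂, ∂̄ -/

section complexRelations

variable {m : ℕ} [NeZero m] {c : ZMod m → ℝ}

theorem zC_eq : zC m c = X m c + Complex.I • Y m c := by
  rw [zC, covec_eq]; simp

theorem zbC_eq : zbC m c = X m c - Complex.I • Y m c := by
  rw [zbC, covec_eq]; simp [sub_eq_add_neg]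

theorem dV_eq : dV m c = xi m c - Complex.I • eta m c := by
  rw [dV, vec_eq]; simp [sub_eq_add_neg]

theorem dbV_eq : dbV m c = xi m c + Complex.I • eta m c := by
  rw [dbV, vec_eq]; simp

theorem I_smul_I_smul {M : Type*} [AddCommGroup M] [Module ℂ M] (x : M) :
    Complex.I • Complex.I • x = -x := by
  rw [smul_smul, Complex.I_mul_I, neg_one_smul]

theorem commute_zC_zbC : Commute (zC m c) (zbC m c) := by
  have h := X_Y (m := m) (c := c)
  simp only [Commute, SemiconjBy, zC_eq, zbC_eq, mul_add, add_mul, mul_sub, sub_mul,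
    smul_mul_assoc, mul_smul_comm, h]
  module

theorem commute_dV_dbV : Commute (dV m c) (dbV m c) := by
  have h := xi_eta (m := m) (c := c)
  simp only [Commute, SemiconjBy, dV_eq, dbV_eq, mul_add, add_mul, mul_sub, sub_mul,
    smul_mul_assoc, mul_smul_comm, h]
  module

theorem grp_mul_grp (g h : DihedralGroup m) : grp m c g * grp m c h = grp m c (g * h) := by
  simpa [grp] using (mk_rel (Rel.grp_mul (c := c) g h)).symm

theorem grp_one : grp m c 1 = 1 := by
  simpa [grp] using mk_rel (Rel.grp_one (m := m) (c := c))

theorem act_sr_z (j : ZMod m) :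
    (act m (.sr j)).mulVec ![1, Complex.I] = om j • ![1, -Complex.I] := by
  ext i; fin_cases i
  · simp only [Fin.zero_eta, act_sr_zero, om_eq]; simp; ring
  · simp only [Fin.mk_one, act_sr_one, om_eq]; simp
    linear_combination sinj j * Complex.I_mul_I

theorem act_sr_zb (j : ZMod m) :
    (act m (.sr j)).mulVec ![1, -Complex.I] = om (-j) • ![1, Complex.I] := by
  ext i; fin_cases i
  · simp only [Fin.zero_eta, act_sr_zero, om_neg_eq]; simp; ring
  · simp only [Fin.mk_one, act_sr_one, om_neg_eq]; simp
    linear_combination sinj j * Complex.I_mul_I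

theorem act_r_z (j : ZMod m) :
    (act m (.r j)).mulVec ![1, Complex.I] = om j • ![1, Complex.I] := by
  ext i; fin_cases i
  · simp only [Fin.zero_eta, act_r_zero, om_eq]; simp; ring
  · simp only [Fin.mk_one, act_r_one, om_eq]; simp
    linear_combination -sinj j * Complex.I_mul_I

theorem act_r_zb (j : ZMod m) :
    (act m (.r j)).mulVec ![1, -Complex.I] = om (-j) • ![1, -Complex.I] := by
  ext i; fin_cases i
  · simp only [Fin.zero_eta, act_r_zero, om_neg_eq]; simp; ring
  · simp only [Fin.mk_one, act_r_one, om_neg_eq]; simp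
    linear_combination -sinj j * Complex.I_mul_I

theorem sr_zC (j : ZMod m) :
    grp m c (.sr j) * zC m c = om j • (zbC m c * grp m c (.sr j)) := by
  rw [zC, grp_covec, act_sr_z, covec_smul, smul_mul_assoc, zbC]

theorem sr_zbC (j : ZMod m) :
    grp m c (.sr j) * zbC m c = om (-j) • (zC m c * grp m c (.sr j)) := by
  rw [zbC, grp_covec, act_sr_zb, covec_smul, smul_mul_assoc, zC]

theorem r_zC (j : ZMod m) :
    grp m c (.r j) * zC m c = om j • (zC m c * grp m c (.r j)) := by
  rw [zC, grp_covec, act_r_z, covec_smul, smul_mul_assoc]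

theorem r_zbC (j : ZMod m) :
    grp m c (.r j) * zbC m c = om (-j) • (zbC m c * grp m c (.r j)) := by
  rw [zbC, grp_covec, act_r_zb, covec_smul, smul_mul_assoc]

theorem sr_dbV (j : ZMod m) :
    grp m c (.sr j) * dbV m c = om j • (dV m c * grp m c (.sr j)) := by
  rw [dbV, grp_vec, act_sr_z, vec_smul, smul_mul_assoc, dV]

theorem sr_dV (j : ZMod m) :
    grp m c (.sr j) * dV m c = om (-j) • (dbV m c * grp m c (.sr j)) := by
  rw [dV, grp_vec, act_sr_zb, vec_smul, smul_mul_assoc, dbV]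

theorem r_dbV (j : ZMod m) :
    grp m c (.r j) * dbV m c = om j • (dbV m c * grp m c (.r j)) := by
  rw [dbV, grp_vec, act_r_z, vec_smul, smul_mul_assoc]

theorem r_dV (j : ZMod m) :
    grp m c (.r j) * dV m c = om (-j) • (dV m c * grp m c (.r j)) := by
  rw [dV, grp_vec, act_r_zb, vec_smul, smul_mul_assoc]

/-- The commutator of a vector and a covector lies in the group algebra. -/
theorem vec_covec_mem (v w : Fin 2 → ℂ) : ∃ C ∈ Submodule.span ℂ (Set.range (grp m c)),
    vec m c v * covec m c w = covec m c w * vec m c v + C := by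
  refine ⟨_, ?_, (sub_eq_iff_eq_add'.mp (cherednik v w))⟩
  refine sub_mem ?_ ?_
  · rw [Algebra.algebraMap_eq_smul_one, ← grp_one]
    exact Submodule.smul_mem _ _ (Submodule.subset_span ⟨1, rfl⟩)
  · rw [← smul_two_eq]
    exact Submodule.smul_mem _ _ (Submodule.sum_mem _ fun j _ =>
      Submodule.smul_mem _ _ (Submodule.subset_span ⟨_, rfl⟩))

theorem Eplus_eq : Eplus m c = (1 / 2 : ℂ) • (zC m c * zbC m c) := by
  have h := X_Y (m := m) (c := c)
  simp only [Eplus, zC_eq, zbC_eq, add_mul, mul_sub, smul_mul_assoc, mul_smul_comm, h, smul_add,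
    smul_sub, I_smul_I_smul]
  module

/-- In this form the behaviour under G is visible: rotations fix both terms and reflections exchange
them. -/
theorem Z0_eq : Z0 m c = (1 / 2 : ℂ) • (zbC m c * dbV m c - zC m c * dV m c) := by
  simp only [Z0, zC_eq, zbC_eq, dV_eq, dbV_eq, mul_add, add_mul, mul_sub, sub_mul,
    smul_mul_assoc, mul_smul_comm]
  module

theorem commute_Eplus_zC : Commute (Eplus m c) (zC m c) := by
  rw [Eplus_eq]
  exact ((Commute.refl _).mul_left commute_zC_zbC.symm).smul_left _

theorem commute_Eplus_zbC : Commute (Eplus m c) (zbC m c) := by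
  rw [Eplus_eq]
  exact (commute_zC_zbC.mul_left (Commute.refl _)).smul_left _

theorem commute_Eplus_grp (g : DihedralGroup m) : Commute (Eplus m c) (grp m c g) := by
  rw [Eplus_eq]
  refine Commute.smul_left ?_ _
  show _ = _
  symm
  rcases g with j | j
  · rw [← mul_assoc, r_zC, smul_mul_assoc, mul_assoc, r_zbC, mul_smul_comm, smul_smul, om_mul_neg,
      one_smul, mul_assoc]
  · rw [← mul_assoc, sr_zC, smul_mul_assoc, mul_assoc, sr_zbC, mul_smul_comm, smul_smul,
      om_mul_neg, one_smul, ← mul_assoc, commute_zC_zbC.eq]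

theorem Eplus_xi : Eplus m c * xi m c = xi m c * Eplus m c - X m c := by
  have h := xi_sq (m := m) (c := c)
  rw [← smul_two_eq] at h
  simp only [Eplus, smul_mul_assoc, mul_smul_comm]
  linear_combination (norm := module) (-1 / 2 : ℂ) • h

theorem Eplus_eta : Eplus m c * eta m c = eta m c * Eplus m c - Y m c := by
  have h := eta_sq (m := m) (c := c)
  rw [← smul_two_eq] at h
  simp only [Eplus, smul_mul_assoc, mul_smul_comm]
  linear_combination (norm := module) (-1 / 2 : ℂ) • h

theorem Eminus_X : Eminus m c * X m c = X m c * Eminus m c - xi m c := by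
  have h := lap_X (m := m) (c := c)
  rw [← smul_two_eq] at h
  simp only [Eminus, smul_mul_assoc, mul_smul_comm, neg_mul, mul_neg]
  linear_combination (norm := module) (-1 / 2 : ℂ) • h

theorem Eminus_Y : Eminus m c * Y m c = Y m c * Eminus m c - eta m c := by
  have h := lap_Y (m := m) (c := c)
  rw [← smul_two_eq] at h
  simp only [Eminus, smul_mul_assoc, mul_smul_comm, neg_mul, mul_neg]
  linear_combination (norm := module) (-1 / 2 : ℂ) • h

theorem Hel_eq : Hel m c = Eplus m c * Eminus m c - Eminus m c * Eplus m c := by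
  rw [← Eplus_Eminus, Ring.lie_def]

theorem commute_Eplus_X : Commute (Eplus m c) (X m c) := by
  rw [Eplus]; exact Commute.smul_left (X_sq (m := m) (c := c)).symm _

theorem commute_Eplus_Y : Commute (Eplus m c) (Y m c) := by
  rw [Eplus]; exact Commute.smul_left (Y_sq (m := m) (c := c)).symm _

theorem commute_Eminus_xi : Commute (Eminus m c) (xi m c) := by
  rw [Eminus]; exact (Commute.smul_left (lap_xi (m := m) (c := c)) _).neg_left

theorem commute_Eminus_eta : Commute (Eminus m c) (eta m c) := by
  rw [Eminus]; exact (Commute.smul_left (lap_eta (m := m) (c := c)) _).neg_left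

/-- Since H = [E₊, E₋], the commutator with a linear element follows from the Jacobi identity: E₋
turns x into −ξ, E₊ turns ξ into −x, and E₊ commutes with x. The next three relations have the same
origin. -/
theorem Hel_X : Hel m c * X m c = X m c * Hel m c + X m c := by
  rw [Hel_eq]
  linear_combination (norm := noncomm_ring) Eplus m c * Eminus_X (m := m) (c := c) -
    Eplus_xi (m := m) (c := c) + (commute_Eplus_X (m := m) (c := c)).eq * Eminus m c -
    Eminus m c * (commute_Eplus_X (m := m) (c := c)).eq - Eminus_X (m := m) (c := c) * Eplus m c

theorem Hel_Y : Hel m c * Y m c = Y m c * Hel m c + Y m c := by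
  rw [Hel_eq]
  linear_combination (norm := noncomm_ring) Eplus m c * Eminus_Y (m := m) (c := c) -
    Eplus_eta (m := m) (c := c) + (commute_Eplus_Y (m := m) (c := c)).eq * Eminus m c -
    Eminus m c * (commute_Eplus_Y (m := m) (c := c)).eq - Eminus_Y (m := m) (c := c) * Eplus m c

theorem Hel_xi : Hel m c * xi m c = xi m c * Hel m c - xi m c := by
  rw [Hel_eq]
  linear_combination (norm := noncomm_ring) Eplus m c * (commute_Eminus_xi (m := m) (c := c)).eq +
    Eplus_xi (m := m) (c := c) * Eminus m c - Eminus m c * Eplus_xi (m := m) (c := c) +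
    Eminus_X (m := m) (c := c) - (commute_Eminus_xi (m := m) (c := c)).eq * Eplus m c

theorem Hel_eta : Hel m c * eta m c = eta m c * Hel m c - eta m c := by
  rw [Hel_eq]
  linear_combination (norm := noncomm_ring) Eplus m c * (commute_Eminus_eta (m := m) (c := c)).eq +
    Eplus_eta (m := m) (c := c) * Eminus m c - Eminus m c * Eplus_eta (m := m) (c := c) +
    Eminus_Y (m := m) (c := c) - (commute_Eminus_eta (m := m) (c := c)).eq * Eplus m c

theorem Hel_zC : Hel m c * zC m c = zC m c * Hel m c + zC m c := by
  simp only [zC_eq, mul_add, add_mul, smul_mul_assoc, mul_smul_comm, Hel_X, Hel_Y]; module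

theorem Hel_zbC : Hel m c * zbC m c = zbC m c * Hel m c + zbC m c := by
  simp only [zbC_eq, mul_sub, sub_mul, smul_mul_assoc, mul_smul_comm, Hel_X, Hel_Y]; module

theorem Hel_dV : Hel m c * dV m c = dV m c * Hel m c - dV m c := by
  simp only [dV_eq, mul_sub, sub_mul, smul_mul_assoc, mul_smul_comm, Hel_xi, Hel_eta]; module

theorem Hel_dbV : Hel m c * dbV m c = dbV m c * Hel m c - dbV m c := by
  simp only [dbV_eq, mul_add, add_mul, smul_mul_assoc, mul_smul_comm, Hel_xi, Hel_eta]; module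

theorem Eplus_dV : Eplus m c * dV m c = dV m c * Eplus m c - zbC m c := by
  simp only [dV_eq, zbC_eq, mul_sub, sub_mul, smul_mul_assoc, mul_smul_comm, Eplus_xi, Eplus_eta]
  module

theorem Eplus_dbV : Eplus m c * dbV m c = dbV m c * Eplus m c - zC m c := by
  simp only [dbV_eq, zC_eq, mul_add, add_mul, smul_mul_assoc, mul_smul_comm, Eplus_xi, Eplus_eta]
  module

theorem Eminus_eq : Eminus m c = (-1 / 2 : ℂ) • (dV m c * dbV m c) := by
  have h := xi_eta (m := m) (c := c)
  simp only [Eminus, dV_eq, dbV_eq, mul_add, sub_mul, smul_mul_assoc, mul_smul_comm, h, smul_add,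
    smul_sub, I_smul_I_smul]
  module

theorem commute_Eminus_grp (g : DihedralGroup m) : Commute (Eminus m c) (grp m c g) := by
  rw [Eminus_eq]
  refine Commute.smul_left ?_ _
  show _ = _
  symm
  rcases g with j | j
  · rw [← mul_assoc, r_dV, smul_mul_assoc, mul_assoc, r_dbV, mul_smul_comm, smul_smul,
      mul_comm (om (-j)), om_mul_neg, one_smul, mul_assoc]
  · rw [← mul_assoc, sr_dV, smul_mul_assoc, mul_assoc, sr_dbV, mul_smul_comm, smul_smul,
      mul_comm (om (-j)), om_mul_neg, one_smul, ← mul_assoc, commute_dV_dbV.eq]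

theorem commute_Hel_grp (g : DihedralGroup m) : Commute (Hel m c) (grp m c g) := by
  rw [Hel_eq]
  exact ((commute_Eplus_grp g).mul_left (commute_Eminus_grp g)).sub_left
    ((commute_Eminus_grp g).mul_left (commute_Eplus_grp g))

theorem r_Z0 (j : ZMod m) : grp m c (.r j) * Z0 m c = Z0 m c * grp m c (.r j) := by
  rw [Z0_eq, mul_smul_comm, smul_mul_assoc, mul_sub, sub_mul, ← mul_assoc, r_zbC, ← mul_assoc,
    r_zC, smul_mul_assoc, mul_assoc, r_dbV, smul_mul_assoc, mul_assoc (zC m c), r_dV]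
  simp only [mul_smul_comm, smul_smul, om_mul_neg, mul_comm (om (-j)), one_smul, mul_assoc]

/-- A reflection interchanges z with z̄ and ∂ with ∂̄ with mutually inverse phases, so it swaps the
two terms of Z₀, which carry opposite signs. -/
theorem sr_Z0 (j : ZMod m) : grp m c (.sr j) * Z0 m c = -(Z0 m c * grp m c (.sr j)) := by
  rw [Z0_eq, mul_smul_comm, smul_mul_assoc, mul_sub, sub_mul, ← mul_assoc, sr_zbC, ← mul_assoc,
    sr_zC, smul_mul_assoc, mul_assoc, sr_dbV, smul_mul_assoc, mul_assoc (zbC m c), sr_dV]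
  simp only [mul_smul_comm, smul_smul, om_mul_neg, mul_comm (om (-j)), one_smul, mul_assoc]
  module

end complexRelations

/-! ### The Poincaré–Birkhoff–Witt basis -/

section pbw

variable {m : ℕ} [NeZero m] {c : ZMod m → ℝ}

variable (c) in
/-- The normally ordered monomial `z ^ a z̄ ^ b ∂ ^ i ∂̄ ^ j g`. -/
def mono (a b i j : ℕ) (g : DihedralGroup m) : RCA m c :=
  zC m c ^ a * zbC m c ^ b * dV m c ^ i * dbV m c ^ j * grp m c g

variable (c) in
/-- The span of the normally ordered monomials of degree less than `n`. -/
def Fl (n : ℕ) : Submodule ℂ (RCA m c) :=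
  Submodule.span ℂ {w | ∃ a b i j g, a + b + i + j < n ∧ w = mono c a b i j g}

theorem mono_mem {a b i j n : ℕ} (h : a + b + i + j < n) (g : DihedralGroup m) :
    mono c a b i j g ∈ Fl c n := Submodule.subset_span ⟨a, b, i, j, g, h, rfl⟩

theorem Fl_le {n n' : ℕ} (h : n ≤ n') : Fl c n ≤ Fl c n' :=
  Submodule.span_mono fun _ ⟨a, b, i, j, g, h', e⟩ => ⟨a, b, i, j, g, h'.trans_le h, e⟩

theorem Fl_induction {n n' : ℕ} (f : RCA m c →ₗ[ℂ] RCA m c)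
    (h : ∀ a b i j g, a + b + i + j < n → f (mono c a b i j g) ∈ Fl c n') {x : RCA m c}
    (hx : x ∈ Fl c n) : f x ∈ Fl c n' := by
  have : Fl c n ≤ (Fl c n').comap f := Submodule.span_le.mpr fun _ ⟨a, b, i, j, g, h', e⟩ => by
    subst e; exact h a b i j g h'
  exact this hx

theorem zC_mul_mono (a b i j : ℕ) (g : DihedralGroup m) :
    zC m c * mono c a b i j g = mono c (a + 1) b i j g := by
  simp only [mono, pow_succ', mul_assoc]

theorem zbC_mul_mono (a b i j : ℕ) (g : DihedralGroup m) :
    zbC m c * mono c a b i j g = mono c a (b + 1) i j g := by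
  simp only [mono, pow_succ' (zbC m c), ← mul_assoc, (commute_zC_zbC.pow_left a).eq]

theorem zC_mul_mem {n : ℕ} {x : RCA m c} (hx : x ∈ Fl c n) : zC m c * x ∈ Fl c (n + 1) :=
  Fl_induction (LinearMap.mulLeft ℂ (zC m c)) (fun a b i j g h => by
    rw [LinearMap.mulLeft_apply, zC_mul_mono]; exact mono_mem (by omega) g) hx

theorem zbC_mul_mem {n : ℕ} {x : RCA m c} (hx : x ∈ Fl c n) : zbC m c * x ∈ Fl c (n + 1) :=
  Fl_induction (LinearMap.mulLeft ℂ (zbC m c)) (fun a b i j g h => by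
    rw [LinearMap.mulLeft_apply, zbC_mul_mono]; exact mono_mem (by omega) g) hx

theorem mul_pow_of_mul_eq_smul {R : Type*} [Ring R] [Algebra ℂ R] {g x y : R} {s : ℂ}
    (h : g * x = s • (y * g)) (n : ℕ) : g * x ^ n = s ^ n • (y ^ n * g) := by
  induction n with
  | zero => simp
  | succ n ih =>
    rw [pow_succ, ← mul_assoc, ih, smul_mul_assoc, mul_assoc, h, mul_smul_comm, smul_smul,
      ← pow_succ, ← mul_assoc, ← pow_succ]

theorem grp_mul_mono (h : DihedralGroup m) (a b i j : ℕ) (g : DihedralGroup m) :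
    ∃ s : ℂ, grp m c h * mono c a b i j g = s • mono c a b i j (h * g) ∨
      grp m c h * mono c a b i j g = s • mono c b a j i (h * g) := by
  rcases h with k | k
  · refine ⟨om k ^ a * om (-k) ^ b * om (-k) ^ i * om k ^ j, Or.inl ?_⟩
    simp only [mono, ← mul_assoc, mul_pow_of_mul_eq_smul (r_zC k)]
    simp only [mul_assoc, smul_mul_assoc,
      mul_pow_of_mul_eq_smul (r_zbC k), mul_smul_comm, mul_pow_of_mul_eq_smul (r_dV k),
      mul_pow_of_mul_eq_smul (r_dbV k), grp_mul_grp, smul_smul]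
  · refine ⟨om k ^ a * om (-k) ^ b * om (-k) ^ i * om k ^ j, Or.inr ?_⟩
    have h1 := (commute_zC_zbC (m := m) (c := c)).pow_pow b a
    have h2 := (commute_dV_dbV (m := m) (c := c)).pow_pow j i
    simp only [mono, ← mul_assoc, mul_pow_of_mul_eq_smul (sr_zC k), h1.eq]
    simp only [mul_assoc, smul_mul_assoc,
      mul_pow_of_mul_eq_smul (sr_zbC k), mul_smul_comm, mul_pow_of_mul_eq_smul (sr_dV k),
      mul_pow_of_mul_eq_smul (sr_dbV k), grp_mul_grp, smul_smul]
    simp only [← mul_assoc (dbV m c ^ _), ← h2.eq, mul_assoc]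

theorem grp_mul_mem {n : ℕ} {x : RCA m c} (h : DihedralGroup m) (hx : x ∈ Fl c n) :
    grp m c h * x ∈ Fl c n :=
  Fl_induction (LinearMap.mulLeft ℂ (grp m c h)) (fun a b i j g h' => by
    rw [LinearMap.mulLeft_apply]
    obtain ⟨s, e | e⟩ := grp_mul_mono (c := c) h a b i j g <;> rw [e] <;>
    exact Submodule.smul_mem _ _ (mono_mem (by omega) _)) hx

theorem grpAlg_mul_mem {n : ℕ} {x C : RCA m c} (hC : C ∈ Submodule.span ℂ (Set.range (grp m c)))
    (hx : x ∈ Fl c n) : C * x ∈ Fl c n := by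
  induction hC using Submodule.span_induction with
  | mem y hy => obtain ⟨g, rfl⟩ := hy; exact grp_mul_mem g hx
  | zero => rw [zero_mul]; exact zero_mem _
  | add y z _ _ hy hz => rw [add_mul]; exact add_mem hy hz
  | smul a y _ hy => rw [smul_mul_assoc]; exact Submodule.smul_mem _ _ hy

/-- Moving ∂ to the right past a covector costs an element of the group algebra, which removes both
factors. The error therefore lies two degrees below the leading monomial, one degree better than a
filtration argument strictly needs; the symbol calculations for the centraliser rely on this gain.
-/
theorem dV_mul_mono (a b i j : ℕ) (g : DihedralGroup m) :
    dV m c * mono c a b i j g - mono c a b (i + 1) j g ∈ Fl c (a + b + i + j) := by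
  induction a with
  | zero =>
    induction b with
    | zero =>
      have : dV m c * mono c 0 0 i j g - mono c 0 0 (i + 1) j g = 0 := by
        simp only [mono, pow_succ', mul_assoc, pow_zero, one_mul, sub_self]
      rw [this]; exact zero_mem _
    | succ b ih =>
      obtain ⟨C, hC, e⟩ := vec_covec_mem (c := c) ![1, -Complex.I] ![1, -Complex.I]
      rw [← dV, ← zbC] at e
      have : dV m c * mono c 0 (b + 1) i j g - mono c 0 (b + 1) (i + 1) j g =
          zbC m c * (dV m c * mono c 0 b i j g - mono c 0 b (i + 1) j g) +
          C * mono c 0 b i j g := by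
        rw [← zbC_mul_mono, ← zbC_mul_mono, ← mul_assoc, e]; noncomm_ring
      rw [this]
      refine add_mem (Fl_le (by omega) (zbC_mul_mem ih)) (grpAlg_mul_mem hC (mono_mem (by omega) g))
  | succ a ih =>
    obtain ⟨C, hC, e⟩ := vec_covec_mem (c := c) ![1, -Complex.I] ![1, Complex.I]
    rw [← dV, ← zC] at e
    have : dV m c * mono c (a + 1) b i j g - mono c (a + 1) b (i + 1) j g =
        zC m c * (dV m c * mono c a b i j g - mono c a b (i + 1) j g) +
        C * mono c a b i j g := by
      rw [← zC_mul_mono, ← zC_mul_mono, ← mul_assoc, e]; noncomm_ring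
    rw [this]
    refine add_mem (Fl_le (by omega) (zC_mul_mem ih)) (grpAlg_mul_mem hC (mono_mem (by omega) g))

theorem dbV_mul_mono (a b i j : ℕ) (g : DihedralGroup m) :
    dbV m c * mono c a b i j g - mono c a b i (j + 1) g ∈ Fl c (a + b + i + j) := by
  induction a with
  | zero =>
    induction b with
    | zero =>
      have : dbV m c * mono c 0 0 i j g - mono c 0 0 i (j + 1) g = 0 := by
        simp only [mono, pow_succ', pow_zero, one_mul]
        rw [← mul_assoc, ← mul_assoc, ← mul_assoc, (commute_dV_dbV.pow_left i).eq, sub_self]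
      rw [this]; exact zero_mem _
    | succ b ih =>
      obtain ⟨C, hC, e⟩ := vec_covec_mem (c := c) ![1, Complex.I] ![1, -Complex.I]
      rw [← dbV, ← zbC] at e
      have : dbV m c * mono c 0 (b + 1) i j g - mono c 0 (b + 1) i (j + 1) g =
          zbC m c * (dbV m c * mono c 0 b i j g - mono c 0 b i (j + 1) g) +
          C * mono c 0 b i j g := by
        rw [← zbC_mul_mono, ← zbC_mul_mono, ← mul_assoc, e]; noncomm_ring
      rw [this]
      refine add_mem (Fl_le (by omega) (zbC_mul_mem ih)) (grpAlg_mul_mem hC (mono_mem (by omega) g))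
  | succ a ih =>
    obtain ⟨C, hC, e⟩ := vec_covec_mem (c := c) ![1, Complex.I] ![1, Complex.I]
    rw [← dbV, ← zC] at e
    have : dbV m c * mono c (a + 1) b i j g - mono c (a + 1) b i (j + 1) g =
        zC m c * (dbV m c * mono c a b i j g - mono c a b i (j + 1) g) +
        C * mono c a b i j g := by
      rw [← zC_mul_mono, ← zC_mul_mono, ← mul_assoc, e]; noncomm_ring
    rw [this]
    refine add_mem (Fl_le (by omega) (zC_mul_mem ih)) (grpAlg_mul_mem hC (mono_mem (by omega) g))

theorem dV_mul_mem {n : ℕ} {x : RCA m c} (hx : x ∈ Fl c n) : dV m c * x ∈ Fl c (n + 1) :=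
  Fl_induction (LinearMap.mulLeft ℂ (dV m c)) (fun a b i j g h => by
    rw [LinearMap.mulLeft_apply, ← sub_add_cancel (dV m c * _) (mono c a b (i + 1) j g)]
    exact add_mem (Fl_le (by omega) (dV_mul_mono a b i j g)) (mono_mem (by omega) g)) hx

theorem dbV_mul_mem {n : ℕ} {x : RCA m c} (hx : x ∈ Fl c n) : dbV m c * x ∈ Fl c (n + 1) :=
  Fl_induction (LinearMap.mulLeft ℂ (dbV m c)) (fun a b i j g h => by
    rw [LinearMap.mulLeft_apply, ← sub_add_cancel (dbV m c * _) (mono c a b i (j + 1) g)]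
    exact add_mem (Fl_le (by omega) (dbV_mul_mono a b i j g)) (mono_mem (by omega) g)) hx

theorem vec_eq' (e : Fin 2 → ℂ) : vec m c e = zbCoef e • dV m c + zCoef e • dbV m c := by
  have : e = zbCoef e • ![1, -Complex.I] + zCoef e • ![1, Complex.I] := by
    ext i
    fin_cases i
    · simp [zCoef, zbCoef]; ring
    · simp [zCoef, zbCoef]; linear_combination (e 1) * Complex.I_mul_I
  rw [dV, dbV, ← vec_smul, ← vec_smul, ← vec_add, ← this]

theorem covec_eq' (e : Fin 2 → ℂ) : covec m c e = zbCoef e • zbC m c + zCoef e • zC m c := by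
  have : e = zbCoef e • ![1, -Complex.I] + zCoef e • ![1, Complex.I] := by
    ext i
    fin_cases i
    · simp [zCoef, zbCoef]; ring
    · simp [zCoef, zbCoef]; linear_combination (e 1) * Complex.I_mul_I
  rw [zC, zbC, ← covec_smul, ← covec_smul, ← covec_add, ← this]

/-- Induction principle for the rational Cherednik algebra. -/
theorem RCA_induction {p : RCA m c → Prop} (scalar : ∀ a : ℂ, p (algebraMap ℂ _ a))
    (vec : ∀ e, p (vec m c e)) (covec : ∀ w, p (covec m c w)) (grp : ∀ g, p (grp m c g))
    (add : ∀ a b, p a → p b → p (a + b)) (mul : ∀ a b, p a → p b → p (a * b)) (x : RCA m c) :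
    p x := by
  obtain ⟨f, rfl⟩ := RingQuot.mkAlgHom_surjective ℂ (Rel m c) x
  induction f using FreeAlgebra.induction with
  | grade0 r => rw [AlgHom.commutes]; exact scalar r
  | grade1 g => cases g with
    | vec e => exact vec e
    | covec w => exact covec w
    | grp g => exact grp g
  | mul a b ha hb => rw [map_mul]; exact mul _ _ ha hb
  | add a b ha hb => rw [map_add]; exact add _ _ ha hb

theorem exists_mem_Fl (x : RCA m c) : ∃ n, x ∈ Fl c n := by
  -- The claim is strengthened to say that left multiplication by x raises the filtration by a
  -- bounded amount. This passes to sums and products, and applying it to the empty monomial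
  -- recovers the membership of x.
  suffices H : ∀ x : RCA m c, ∃ k, ∀ n, ∀ y ∈ Fl c n, x * y ∈ Fl c (n + k) by
    obtain ⟨k, hk⟩ := H x
    have h1 := hk 1 (mono c 0 0 0 0 1) (mono_mem (by omega) _)
    simp only [mono, pow_zero, mul_one, grp_one] at h1
    exact ⟨_, h1⟩
  intro x
  induction x using RCA_induction with
  | scalar a => exact ⟨0, fun n y hy => by
      rw [← Algebra.smul_def]; exact Submodule.smul_mem _ _ hy⟩
  | vec e => exact ⟨1, fun n y hy => by
      rw [vec_eq', add_mul, smul_mul_assoc, smul_mul_assoc]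
      exact add_mem (Submodule.smul_mem _ _ (dV_mul_mem hy))
        (Submodule.smul_mem _ _ (dbV_mul_mem hy))⟩
  | covec e => exact ⟨1, fun n y hy => by
      rw [covec_eq', add_mul, smul_mul_assoc, smul_mul_assoc]
      exact add_mem (Submodule.smul_mem _ _ (zbC_mul_mem hy))
        (Submodule.smul_mem _ _ (zC_mul_mem hy))⟩
  | grp g => exact ⟨0, fun n y hy => grp_mul_mem g hy⟩
  | add a b ha hb =>
    obtain ⟨k, hk⟩ := ha
    obtain ⟨k', hk'⟩ := hb
    exact ⟨k + k', fun n y hy => by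
      rw [add_mul]
      exact add_mem (Fl_le (by omega) (hk n y hy)) (Fl_le (by omega) (hk' n y hy))⟩
  | mul a b ha hb =>
    obtain ⟨k, hk⟩ := ha
    obtain ⟨k', hk'⟩ := hb
    exact ⟨k' + k, fun n y hy => by
      rw [mul_assoc, ← add_assoc]
      exact hk _ _ (hk' _ _ hy)⟩

/-! ### Linear independence of the ordered monomials -/

variable (m) in
/-- The exponents of normally ordered monomials. -/
abbrev MonoIdx : Type := ℕ × ℕ × ℕ × ℕ × DihedralGroup m

variable (m) in
/-- The regular representation of `G`. -/
def regularRep : Representation ℂ (DihedralGroup m) (DihedralGroup m →₀ ℂ) where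
  toFun g := Finsupp.lmapDomain ℂ ℂ (g * ·)
  map_one' := Finsupp.lhom_ext fun g a => by simp
  map_mul' g h := Finsupp.lhom_ext fun g a => by simp [mul_assoc]

variable (m) in
/-- The regular module of `ℂ[E^*] ⋊ G`. -/
def regularEG : EGModule m (Poly (DihedralGroup m →₀ ℂ)) where
  rep := polyRep (regularRep m)
  vec := mulCov
  comm := mulCov_comm
  equivariant := polyRep_mulCov _

theorem polyHom_zC {V : Type*} [AddCommGroup V] [Module ℂ V] (D : EGModule m V)
    (hc : ∀ i j : ZMod m, IsConj (DihedralGroup.sr i) (DihedralGroup.sr j) → c i = c j) :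
    polyHom c D hc (zC m c) = mulZ := by rw [zC, polyHom_covec, mulCov_z]

theorem polyHom_zbC {V : Type*} [AddCommGroup V] [Module ℂ V] (D : EGModule m V)
    (hc : ∀ i j : ZMod m, IsConj (DihedralGroup.sr i) (DihedralGroup.sr j) → c i = c j) :
    polyHom c D hc (zbC m c) = mulZb := by rw [zbC, polyHom_covec, mulCov_zb]

theorem mulZ_pow_single {V : Type*} [AddCommGroup V] [Module ℂ V] (n a b : ℕ) (v : V) :
    (mulZ ^ n : Module.End ℂ (Poly V)) (Finsupp.single (a, b) v) =
      Finsupp.single (a + n, b) v := by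
  induction n with
  | zero => rfl
  | succ n ih => rw [pow_succ', Module.End.mul_apply, ih, mulZ_single, add_assoc]

theorem mulZb_pow_single {V : Type*} [AddCommGroup V] [Module ℂ V] (n a b : ℕ) (v : V) :
    (mulZb ^ n : Module.End ℂ (Poly V)) (Finsupp.single (a, b) v) =
      Finsupp.single (a, b + n) v := by
  induction n with
  | zero => rfl
  | succ n ih => rw [pow_succ', Module.End.mul_apply, ih, mulZb_single, add_assoc]

theorem dunkl_pow_single_zero {V : Type*} [AddCommGroup V] [Module ℂ V] (D : EGModule m V)
    (e : Fin 2 → ℂ) (n : ℕ) (v : V) :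
    (dunkl c D e ^ n) (Finsupp.single (0, 0) v) = Finsupp.single (0, 0) ((D.vec e ^ n) v) := by
  induction n with
  | zero => rfl
  | succ n ih => rw [pow_succ', Module.End.mul_apply, ih, dunkl_single_zero, pow_succ',
      Module.End.mul_apply]

/-- On constants a vector acts through the coefficient module, where ∂ is multiplication by z̄ and
∂̄ is multiplication by z; hence the order (j, i) of the inner exponents. Distinct monomials send
the cyclic vector to distinct basis vectors, so they are independent. -/
theorem polyHom_mono
    (hc : ∀ i j : ZMod m, IsConj (DihedralGroup.sr i) (DihedralGroup.sr j) → c i = c j)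
    (a b i j : ℕ) (g : DihedralGroup m) :
    polyHom c (regularEG m) hc (mono c a b i j g)
      (Finsupp.single (0, 0) (Finsupp.single (0, 0) (Finsupp.single 1 1))) =
    Finsupp.single (a, b) (Finsupp.single (j, i) (Finsupp.single g 1)) := by
  have hg : polyRep (regularEG m).rep g
      (Finsupp.single (0, 0) (Finsupp.single (0, 0) (Finsupp.single 1 1))) =
      Finsupp.single (0, 0) (Finsupp.single (0, 0) (Finsupp.single g 1)) := by
    rcases g with k | k <;> simp [regularEG, regularRep]
  simp only [mono, map_mul, map_pow, Module.End.mul_apply, polyHom_grp, hg, polyHom_zC,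
    polyHom_zbC, dV, dbV, polyHom_vec, dunkl_pow_single_zero]
  simp only [regularEG, mulCov_z, mulCov_zb, mulZ_pow_single, mulZb_pow_single, zero_add]

theorem linearIndependent_mono
    (hc : ∀ i j : ZMod m, IsConj (DihedralGroup.sr i) (DihedralGroup.sr j) → c i = c j) :
    LinearIndependent ℂ fun q : MonoIdx m => mono c q.1 q.2.1 q.2.2.1 q.2.2.2.1 q.2.2.2.2 := by
  classical
  rw [linearIndependent_iff']
  intro s f hf q hq
  have h := congrArg (fun x => polyHom c (regularEG m) hc x
      (Finsupp.single (0, 0) (Finsupp.single (0, 0) (Finsupp.single 1 1)))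
      (q.1, q.2.1) (q.2.2.2.1, q.2.2.1) q.2.2.2.2) hf
  simp only [map_sum, map_smul, LinearMap.sum_apply, LinearMap.smul_apply, polyHom_mono,
    Finsupp.finsetSum_apply, Finsupp.smul_apply, map_zero, LinearMap.zero_apply,
    Finsupp.zero_apply] at h
  rw [Finset.sum_eq_single q] at h
  · simpa using h
  · intro q' _ hne
    by_contra hne'
    apply hne
    simp only [Finsupp.single_apply] at hne'
    split_ifs at hne' with h1
    · simp only [Finsupp.single_apply] at hne'
      split_ifs at hne' with h2
      · simp only [Finsupp.single_apply] at hne'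
        split_ifs at hne' with h3
        · simp only [Prod.mk.injEq] at h1 h2
          ext1; · exact h1.1
          ext1; · exact h1.2
          ext1; · exact h2.2
          ext1; · exact h2.1
          exact h3
        · simp at hne'
      · simp at hne'
    · simp at hne'
  · exact fun h => absurd hq h

/-- The PBW basis of the rational Cherednik algebra. -/
def pbwBasis (hc : ∀ i j : ZMod m, IsConj (DihedralGroup.sr i) (DihedralGroup.sr j) → c i = c j) :
    Module.Basis (MonoIdx m) ℂ (RCA m c) :=
  Module.Basis.mk (linearIndependent_mono hc) fun x _ => by
    obtain ⟨n, hn⟩ := exists_mem_Fl x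
    refine Submodule.span_mono ?_ hn
    rintro _ ⟨a, b, i, j, g, _, rfl⟩
    exact ⟨(a, b, i, j, g), rfl⟩

end pbw

/-! ### The centraliser of `𝔰𝔩(2)` -/

section centraliser

variable {m : ℕ} [NeZero m] {c : ZMod m → ℝ}

theorem Hel_mul_pow {x : RCA m c} {t : ℂ} (h : Hel m c * x = x * Hel m c + t • x) (n : ℕ) :
    Hel m c * x ^ n = x ^ n * Hel m c + (n * t) • x ^ n := by
  induction n with
  | zero => simp
  | succ n ih =>
    rw [pow_succ, ← mul_assoc, ih, add_mul, mul_assoc, h, smul_mul_assoc, mul_add, mul_smul_comm,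
      ← mul_assoc]
    push_cast
    module

theorem Hel_mul_mul {x y : RCA m c} {s t : ℂ} (hx : Hel m c * x = x * Hel m c + s • x)
    (hy : Hel m c * y = y * Hel m c + t • y) :
    Hel m c * (x * y) = (x * y) * Hel m c + (s + t) • (x * y) := by
  rw [← mul_assoc, hx, add_mul, mul_assoc, hy, smul_mul_assoc, mul_add, mul_smul_comm,
      ← mul_assoc]
  module

theorem Hel_mul_mono (a b i j : ℕ) (g : DihedralGroup m) :
    Hel m c * mono c a b i j g = mono c a b i j g * Hel m c +
      ((a : ℂ) + b - i - j) • mono c a b i j g := by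
  have h1 := Hel_mul_pow (c := c) (t := 1) (by rw [Hel_zC, one_smul]) a
  have h2 := Hel_mul_pow (c := c) (t := 1) (by rw [Hel_zbC, one_smul]) b
  have h3 := Hel_mul_pow (c := c) (t := -1) (by rw [Hel_dV, neg_one_smul, sub_eq_add_neg]) i
  have h4 := Hel_mul_pow (c := c) (t := -1) (by rw [Hel_dbV, neg_one_smul, sub_eq_add_neg]) j
  have h5 : Hel m c * grp m c g = grp m c g * Hel m c + (0 : ℂ) • grp m c g := by
    rw [(commute_Hel_grp g).eq, zero_smul, add_zero]
  have := Hel_mul_mul (Hel_mul_mul (Hel_mul_mul (Hel_mul_mul h1 h2) h3) h4) h5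
  rw [mono, this]
  congr 2
  ring

/-- On symbols, [E₊, ·] is the derivation with ∂ ↦ −z̄ and ∂̄ ↦ −z. The truncated exponents i − 1
and j − 1 come with the factors i and j, so they do no harm at zero. -/
theorem Eplus_mul_mono_aux (i j : ℕ) (g : DihedralGroup m) :
    Eplus m c * mono c 0 0 i j g - mono c 0 0 i j g * Eplus m c +
      (i : ℂ) • mono c 0 1 (i - 1) j g + (j : ℂ) • mono c 1 0 i (j - 1) g ∈ Fl c (i + j) := by
  induction i with
  | zero =>
    induction j with
    | zero =>
      have : mono c 0 0 0 0 g = grp m c g := by simp [mono]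
      simp [this, (commute_Eplus_grp g).eq]
    | succ j ih =>
      set M := mono c 0 0 0 j g with hM
      have e1 : mono c 0 0 0 (j + 1) g = dbV m c * M := by
        simp only [hM, mono, pow_succ', pow_zero, one_mul, mul_assoc]
      have e2 : mono c 1 0 0 j g = zC m c * M := by rw [hM, zC_mul_mono]
      have e3 : (j : ℂ) • (dbV m c * mono c 1 0 0 (j - 1) g - mono c 1 0 0 j g) ∈
          Fl c (0 + (j + 1)) := by
        rcases j with _ | j
        · simp
        · exact Submodule.smul_mem _ _ (Fl_le (by omega) (dbV_mul_mono 1 0 0 j g))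
      have e4 := dbV_mul_mem ih
      simp only [Nat.cast_zero, zero_smul, add_zero, Nat.add_sub_cancel] at e4 ⊢
      rw [e1]
      have e5 : Eplus m c * (dbV m c * M) = dbV m c * (Eplus m c * M) - zC m c * M := by
        rw [← mul_assoc, Eplus_dbV, sub_mul, mul_assoc]
      have : Eplus m c * (dbV m c * M) - dbV m c * M * Eplus m c +
          ((j + 1 : ℕ) : ℂ) • mono c 1 0 0 j g =
          dbV m c * (Eplus m c * M - M * Eplus m c + (j : ℂ) • mono c 1 0 0 (j - 1) g) -
          (j : ℂ) • (dbV m c * mono c 1 0 0 (j - 1) g - mono c 1 0 0 j g) := by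
        rw [e5, e2]
        simp only [mul_add, mul_sub, mul_smul_comm, mul_assoc]
        push_cast
        module
      rw [this]
      exact sub_mem (Fl_le (by omega) e4) e3
  | succ i ih =>
    set M := mono c 0 0 i j g with hM
    have e1 : mono c 0 0 (i + 1) j g = dV m c * M := by
      simp only [hM, mono, pow_succ', pow_zero, one_mul, mul_assoc]
    have e2 : mono c 0 1 i j g = zbC m c * M := by rw [hM, zbC_mul_mono]
    have e3 : (i : ℂ) • (dV m c * mono c 0 1 (i - 1) j g - mono c 0 1 i j g) ∈
        Fl c (i + 1 + j) := by
      rcases i with _ | i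
      · simp
      · exact Submodule.smul_mem _ _ (Fl_le (by omega) (dV_mul_mono 0 1 i j g))
    have e3' : (j : ℂ) • (dV m c * mono c 1 0 i (j - 1) g - mono c 1 0 (i + 1) (j - 1) g) ∈
        Fl c (i + 1 + j) := by
      rcases j with _ | j
      · simp
      · exact Submodule.smul_mem _ _ (Fl_le (by omega) (dV_mul_mono 1 0 i j g))
    have e4 := dV_mul_mem ih
    simp only [Nat.add_sub_cancel] at e4 ⊢
    rw [e1]
    have e5 : Eplus m c * (dV m c * M) = dV m c * (Eplus m c * M) - zbC m c * M := by
      rw [← mul_assoc, Eplus_dV, sub_mul, mul_assoc]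
    have : Eplus m c * (dV m c * M) - dV m c * M * Eplus m c +
        ((i + 1 : ℕ) : ℂ) • mono c 0 1 i j g + (j : ℂ) • mono c 1 0 (i + 1) (j - 1) g =
        dV m c * (Eplus m c * M - M * Eplus m c + (i : ℂ) • mono c 0 1 (i - 1) j g +
          (j : ℂ) • mono c 1 0 i (j - 1) g) -
        (i : ℂ) • (dV m c * mono c 0 1 (i - 1) j g - mono c 0 1 i j g) -
        (j : ℂ) • (dV m c * mono c 1 0 i (j - 1) g - mono c 1 0 (i + 1) (j - 1) g) := by
      rw [e5, e2]
      simp only [mul_add, mul_sub, mul_smul_comm, mul_assoc]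
      push_cast
      module
    rw [this]
    exact sub_mem (sub_mem (Fl_le (by omega) e4) e3) e3'

theorem Eplus_mul_mono (a b i j : ℕ) (g : DihedralGroup m) :
    Eplus m c * mono c a b i j g - mono c a b i j g * Eplus m c +
      (i : ℂ) • mono c a (b + 1) (i - 1) j g + (j : ℂ) • mono c (a + 1) b i (j - 1) g ∈
      Fl c (a + b + i + j) := by
  induction a with
  | zero =>
    induction b with
    | zero => simpa using Eplus_mul_mono_aux (c := c) i j g
    | succ b ih =>
      have e := zbC_mul_mem ih
      simp only [mul_add, mul_sub, mul_smul_comm, ← mul_assoc, zbC_mul_mono,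
        ← commute_Eplus_zbC.eq] at e
      rw [mul_assoc, zbC_mul_mono] at e
      exact Fl_le (by omega) e
  | succ a ih =>
    have e := zC_mul_mem ih
    simp only [mul_add, mul_sub, mul_smul_comm, ← mul_assoc, zC_mul_mono,
      ← commute_Eplus_zC.eq] at e
    rw [mul_assoc, zC_mul_mono] at e
    exact Fl_le (by omega) e

/-! ### PBW coefficients of invariant elements -/

variable (hc : ∀ i j : ZMod m, IsConj (DihedralGroup.sr i) (DihedralGroup.sr j) → c i = c j)

/-- The coefficients with respect to the PBW basis. -/
def coef (a b i j : ℕ) (g : DihedralGroup m) : RCA m c →ₗ[ℂ] ℂ :=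
  (pbwBasis hc).coord (a, b, i, j, g)

open Classical in
theorem coef_mono (a b i j : ℕ) (g : DihedralGroup m) (a' b' i' j' : ℕ) (g' : DihedralGroup m) :
    coef hc a b i j g (mono c a' b' i' j' g') =
      if a' = a ∧ b' = b ∧ i' = i ∧ j' = j ∧ g' = g then 1 else 0 := by
  have : mono c a' b' i' j' g' = pbwBasis hc (a', b', i', j', g') := by
    rw [pbwBasis, Module.Basis.mk_apply]
  rw [coef, this, Module.Basis.coord_apply, Module.Basis.repr_self, Finsupp.single_apply]
  simp only [Prod.mk.injEq]

theorem coef_eq_zero {n a b i j : ℕ} {g : DihedralGroup m} {x : RCA m c} (hx : x ∈ Fl c n)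
    (h : n ≤ a + b + i + j) : coef hc a b i j g x = 0 := by
  classical
  have : Fl c n ≤ LinearMap.ker (coef hc a b i j g) := by
    refine Submodule.span_le.mpr ?_
    rintro _ ⟨a', b', i', j', g', h', rfl⟩
    rw [SetLike.mem_coe, LinearMap.mem_ker, coef_mono, if_neg]
    omega
  exact this hx

theorem mem_Fl_of_coef {n : ℕ} {x : RCA m c} (hx : x ∈ Fl c (n + 1))
    (h : ∀ a b i j g, a + b + i + j = n → coef hc a b i j g x = 0) : x ∈ Fl c n := by
  rw [← (pbwBasis hc).linearCombination_repr x, Finsupp.linearCombination_apply, Finsupp.sum]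
  refine Submodule.sum_mem _ fun q hq => ?_
  obtain ⟨a, b, i, j, g⟩ := q
  rw [pbwBasis, Module.Basis.mk_apply]
  refine Submodule.smul_mem _ _ (mono_mem ?_ g)
  dsimp only
  by_contra hlt
  refine Finsupp.mem_support_iff.mp hq ?_
  rcases Nat.lt_or_ge n (a + b + i + j) with h' | h'
  · exact coef_eq_zero hc (a := a) (b := b) (i := i) (j := j) (g := g) hx h'
  · exact h a b i j g (by omega)

theorem linearMap_eq_of_mono {n : ℕ} {f f' : RCA m c →ₗ[ℂ] ℂ}
    (h : ∀ a b i j g, a + b + i + j < n → f (mono c a b i j g) = f' (mono c a b i j g))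
    {x : RCA m c} (hx : x ∈ Fl c n) : f x = f' x := by
  have : Fl c n ≤ LinearMap.eqLocus f f' := by
    refine Submodule.span_le.mpr ?_
    rintro _ ⟨a', b', i', j', g', h', rfl⟩
    exact h _ _ _ _ _ h'
  exact this hx

/-- Taking the commutator with H is diagonal in the PBW basis, with eigenvalue a + b − i − j, so
only monomials of weight zero occur in an element commuting with H. -/
theorem coef_Hel {x : RCA m c} (hx : Hel m c * x = x * Hel m c) (a b i j : ℕ)
    (g : DihedralGroup m) (h : a + b ≠ i + j) : coef hc a b i j g x = 0 := by
  classical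
  have key : coef hc a b i j g (Hel m c * x - x * Hel m c) =
      ((a : ℂ) + b - i - j) * coef hc a b i j g x := by
    obtain ⟨n, hn⟩ := exists_mem_Fl x
    refine linearMap_eq_of_mono
      (f := coef hc a b i j g ∘ₗ (LinearMap.mulLeft ℂ (Hel m c) - LinearMap.mulRight ℂ (Hel m c)))
      (f' := ((a : ℂ) + b - i - j) • coef hc a b i j g) (fun a' b' i' j' g' _ => ?_) hn
    simp only [LinearMap.comp_apply, LinearMap.sub_apply, LinearMap.mulLeft_apply,
      LinearMap.mulRight_apply, Hel_mul_mono, add_sub_cancel_left, map_smul, LinearMap.smul_apply,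
      coef_mono, smul_eq_mul]
    split_ifs with h
    · obtain ⟨rfl, rfl, rfl, rfl, rfl⟩ := h
      rfl
    · simp
  rw [hx, sub_self, map_zero, eq_comm, mul_eq_zero] at key
  refine key.resolve_left fun h' => h ?_
  have : ((a + b : ℕ) : ℂ) = ((i + j : ℕ) : ℂ) := by
    push_cast; linear_combination h'
  exact_mod_cast this

-- This is the top-degree part of [E₊, x] = 0. Under the derivation ∂ ↦ −z̄, ∂̄ ↦ −z a given
-- monomial arises from exactly two others, one with a factor z̄ traded back for ∂ and one with z
-- traded back for ∂̄. The case distinctions cover monomials without z̄ or without z, where no such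
-- trade exists.
open Classical in
theorem coef_Eplus {n : ℕ} {x : RCA m c} (hn : x ∈ Fl c (n + 1))
    (hx : Eplus m c * x = x * Eplus m c) {a b i j : ℕ}
    (g : DihedralGroup m) (h : a + b + i + j = n) :
    (if b = 0 then 0 else ((i : ℂ) + 1) * coef hc a (b - 1) (i + 1) j g x) +
    (if a = 0 then 0 else ((j : ℂ) + 1) * coef hc (a - 1) b i (j + 1) g x) = 0 := by
  have key : coef hc a b i j g (Eplus m c * x - x * Eplus m c) +
      ((if b = 0 then 0 else ((i : ℂ) + 1)) * coef hc a (b - 1) (i + 1) j g x +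
      (if a = 0 then 0 else ((j : ℂ) + 1)) * coef hc (a - 1) b i (j + 1) g x) = 0 := by
    refine linearMap_eq_of_mono
      (f := coef hc a b i j g ∘ₗ
        (LinearMap.mulLeft ℂ (Eplus m c) - LinearMap.mulRight ℂ (Eplus m c)) +
        ((if b = 0 then 0 else ((i : ℂ) + 1)) • coef hc a (b - 1) (i + 1) j g +
        (if a = 0 then 0 else ((j : ℂ) + 1)) • coef hc (a - 1) b i (j + 1) g))
      (f' := 0) (fun a' b' i' j' g' hlt => ?_) hn
    have e := coef_eq_zero hc (g := g) (Eplus_mul_mono (c := c) a' b' i' j' g')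
      (show a' + b' + i' + j' ≤ a + b + i + j by omega)
    simp only [map_add, map_smul, smul_eq_mul] at e
    simp only [LinearMap.add_apply, LinearMap.comp_apply, LinearMap.sub_apply,
      LinearMap.mulLeft_apply, LinearMap.mulRight_apply, LinearMap.smul_apply, smul_eq_mul,
      LinearMap.zero_apply]
    have e1 : (i' : ℂ) * coef hc a b i j g (mono c a' (b' + 1) (i' - 1) j' g') =
        (if b = 0 then 0 else ((i : ℂ) + 1)) *
          coef hc a (b - 1) (i + 1) j g (mono c a' b' i' j' g') := by
      rw [coef_mono, coef_mono]
      rcases i' with _ | i'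
      · simp
      · rcases b with _ | b
        · simp
        · simp only [Nat.add_sub_cancel, Nat.add_right_cancel_iff]
          split_ifs with h1 <;> simp_all
    have e2 : (j' : ℂ) * coef hc a b i j g (mono c (a' + 1) b' i' (j' - 1) g') =
        (if a = 0 then 0 else ((j : ℂ) + 1)) *
          coef hc (a - 1) b i (j + 1) g (mono c a' b' i' j' g') := by
      rw [coef_mono, coef_mono]
      rcases j' with _ | j'
      · simp
      · rcases a with _ | a
        · simp
        · simp only [Nat.add_sub_cancel, Nat.add_right_cancel_iff]
          split_ifs with h1 <;> simp_all
    linear_combination e - e1 - e2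
  rw [hx, sub_self, map_zero, zero_add, ite_mul, ite_mul, zero_mul, zero_mul] at key
  exact key

/-- Of the two leading terms of Z₀x, the one with z∂ always contains z and so cannot contribute to a
monomial free of z. What remains is half of z̄∂̄x. -/
theorem coef_Z0_mul {l : ℕ} {x : RCA m c} (hx : x ∈ Fl c (2 * l + 1)) (g : DihedralGroup m) :
    coef hc 0 (l + 1) 0 (l + 1) g (Z0 m c * x) = 1 / 2 * coef hc 0 l 0 l g x := by
  classical
  refine linearMap_eq_of_mono (f := coef hc 0 (l + 1) 0 (l + 1) g ∘ₗ LinearMap.mulLeft ℂ (Z0 m c))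
      (f' := (1 / 2 : ℂ) • coef hc 0 l 0 l g) (fun a b i j g' hlt => ?_) hx
  have h1 := coef_eq_zero hc (g := g) (zbC_mul_mem (dbV_mul_mono (c := c) a b i j g'))
    (show a + b + i + j + 1 ≤ 0 + (l + 1) + 0 + (l + 1) by omega)
  have h2 := coef_eq_zero hc (g := g) (zC_mul_mem (dV_mul_mono (c := c) a b i j g'))
    (show a + b + i + j + 1 ≤ 0 + (l + 1) + 0 + (l + 1) by omega)
  simp only [mul_sub, map_sub, zC_mul_mono, zbC_mul_mono, coef_mono, ← mul_assoc] at h1 h2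
  simp only [LinearMap.comp_apply, LinearMap.mulLeft_apply, LinearMap.smul_apply, smul_eq_mul,
    Z0_eq, smul_mul_assoc, sub_mul, map_smul, map_sub, coef_mono]
  simp only [Nat.add_right_cancel_iff, Nat.add_eq_zero_iff, one_ne_zero, and_false, false_and,
    if_false, sub_zero] at h1 h2
  rw [h2, sub_zero, sub_eq_zero.mp h1]

theorem Z0_pow_mul_grp_mem (l : ℕ) (g : DihedralGroup m) :
    Z0 m c ^ l * grp m c g ∈ Fl c (2 * l + 1) := by
  induction l with
  | zero =>
    have : grp m c g = mono c 0 0 0 0 g := by simp [mono]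
    rw [pow_zero, one_mul, this]
    exact mono_mem (by omega) g
  | succ l ih =>
    rw [pow_succ', mul_assoc, Z0_eq, smul_mul_assoc, sub_mul, mul_assoc, mul_assoc, ← Z0_eq]
    exact Submodule.smul_mem _ _ (sub_mem (Fl_le (by omega) (zbC_mul_mem (dbV_mul_mem ih)))
      (Fl_le (by omega) (zC_mul_mem (dV_mul_mem ih))))

theorem coef_Z0_pow [DecidableEq (DihedralGroup m)] (l : ℕ) (g g' : DihedralGroup m) :
    coef hc 0 l 0 l g (Z0 m c ^ l * grp m c g') = if g' = g then (1 / 2) ^ l else 0 := by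
  induction l with
  | zero =>
    have : grp m c g' = mono c 0 0 0 0 g' := by simp [mono]
    rw [pow_zero, one_mul, this, coef_mono]
    simp
  | succ l ih =>
    rw [pow_succ', mul_assoc, coef_Z0_mul hc (Z0_pow_mul_grp_mem l g'), ih, mul_ite, mul_zero,
      ← pow_succ']

/-- The symbol of an `𝔰𝔩(2)`-invariant element is determined by one coefficient. -/
theorem coef_eq_zero_of_invariant {l : ℕ} {x : RCA m c} (hn : x ∈ Fl c (2 * l + 1))
    (hx : Eplus m c * x = x * Eplus m c) (g : DihedralGroup m)
    (h0 : coef hc 0 l 0 l g x = 0) {a i : ℕ} (ha : a ≤ l) (hi : i ≤ l) :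
    coef hc a (l - a) i (l - i) g x = 0 := by
  have cast_ne (n : ℕ) : (n : ℂ) + 1 ≠ 0 := Nat.cast_add_one_ne_zero n
  -- the recurrence in the interior and at the two ends
  have step (a i : ℕ) (ha : a < l) (hi : i < l) :
      ((i : ℂ) + 1) * coef hc (a + 1) (l - (a + 1)) (i + 1) (l - (i + 1)) g x +
      (((l - (i + 1) : ℕ) : ℂ) + 1) * coef hc a (l - a) i (l - i) g x = 0 := by
    have := coef_Eplus hc hn hx (a := a + 1) (b := l - a) (i := i) (j := l - (i + 1)) g (by omega)
    rw [if_neg (by omega), if_neg (by omega), Nat.add_sub_cancel, Nat.sub_sub,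
      show l - (i + 1) + 1 = l - i by omega] at this
    exact this
  have low (i : ℕ) (hi : i < l) : coef hc 0 l (i + 1) (l - (i + 1)) g x = 0 := by
    have := coef_Eplus hc hn hx (a := 0) (b := l + 1) (i := i) (j := l - (i + 1)) g (by omega)
    rw [if_neg (by omega), if_pos rfl, Nat.add_sub_cancel, add_zero] at this
    exact (mul_eq_zero.mp this).resolve_left (cast_ne i)
  have high (i : ℕ) (hi : i < l) : coef hc l 0 i (l - i) g x = 0 := by
    have := coef_Eplus hc hn hx (a := l + 1) (b := 0) (i := i) (j := l - (i + 1)) g (by omega)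
    rw [if_pos rfl, if_neg (by omega), Nat.add_sub_cancel, zero_add,
      show l - (i + 1) + 1 = l - i by omega] at this
    exact (mul_eq_zero.mp this).resolve_left (cast_ne _)
  -- The recurrence `step` links (a, i) with (a + 1, i + 1), so it propagates along lines of
  -- constant a − i. Lines with i < a end at a = l, where `high` applies; the others begin at a = 0,
  -- where `low` or the hypothesis on the single coefficient applies.
  rcases Nat.lt_or_ge i a with hia | hia
  · induction hd : l - a generalizing a i with
    | zero =>
      obtain rfl : a = l := by omega
      exact high i hia
    | succ d ih =>
      have h1 := ih (a := a + 1) (i := i + 1) (by omega) (by omega) (by omega) (by omega)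
      have h2 := step a i (by omega) (by omega)
      rw [show d = l - (a + 1) by omega] at h1
      rw [h1, mul_zero, zero_add] at h2
      rw [← hd]
      exact (mul_eq_zero.mp h2).resolve_left (cast_ne _)
  · induction a generalizing i with
    | zero =>
      rcases i with _ | i
      · exact h0
      · exact low i hi
    | succ a ih =>
      obtain ⟨i, rfl⟩ : ∃ i', i = i' + 1 := ⟨i - 1, by omega⟩
      have h1 := ih (i := i) (by omega) (by omega) (by omega)
      have h2 := step a i (by omega) (by omega)
      rw [h1, mul_zero, add_zero] at h2
      exact (mul_eq_zero.mp h2).resolve_left (cast_ne _)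

variable (c) in
/-- The span of the elements `Z₀ ^ l g`. -/
def angular : Submodule ℂ (RCA m c) :=
  Submodule.span ℂ {w | ∃ l g, w = Z0 m c ^ l * grp m c g}

theorem commute_Hel_Z0 : Commute (Hel m c) (Z0 m c) := by
  have h1 : Commute (Z0 m c) (Eplus m c) := sub_eq_zero.mp Z0_Eplus
  have h2 : Commute (Z0 m c) (Eminus m c) := sub_eq_zero.mp Z0_Eminus
  rw [Hel_eq]
  exact ((h1.mul_right h2).sub_right (h2.mul_right h1)).symm

/-- The centraliser of `𝔰𝔩(2)` in the rational Cherednik algebra is generated by `Z₀` and `G`. -/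
theorem mem_angular_of_commute
    (hc : ∀ i j : ZMod m, IsConj (DihedralGroup.sr i) (DihedralGroup.sr j) → c i = c j)
    {x : RCA m c} (hH : Hel m c * x = x * Hel m c)
    (hE : Eplus m c * x = x * Eplus m c) : x ∈ angular c := by
  classical
  obtain ⟨n, hn⟩ := exists_mem_Fl x
  induction n generalizing x with
  | zero =>
    have : Fl c 0 = ⊥ := Submodule.span_eq_bot.mpr (by rintro _ ⟨a, b, i, j, g, h, -⟩; omega)
    rw [this, Submodule.mem_bot] at hn
    rw [hn]; exact zero_mem _
  | succ n ih =>
    -- Weight zero means a + b = i + j, so a top degree that is odd has no nonzero coefficients.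
    -- Only even top degree 2l needs a correction.
    rcases Nat.even_or_odd' n with ⟨l, rfl | rfl⟩
    · have hZ : Commute (Eplus m c) (Z0 m c) := (sub_eq_zero.mp Z0_Eplus).symm
      -- The coefficient of z̄^l ∂̄^l g in Z₀^l g is (1/2)^l, so the factor 2^l makes x and y agree
      -- in these coefficients. Their difference is again invariant and hence lies one step lower in
      -- the filtration.
      set y : RCA m c := ∑ g, ((2 : ℂ) ^ l * coef hc 0 l 0 l g x) • (Z0 m c ^ l * grp m c g) with hy
      have hyA : y ∈ angular c := Submodule.sum_mem _ fun g _ =>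
        Submodule.smul_mem _ _ (Submodule.subset_span ⟨l, g, rfl⟩)
      have hyE : Commute (Eplus m c) y := Commute.sum_right _ _ _ fun g _ =>
        ((hZ.pow_right l).mul_right (commute_Eplus_grp g)).smul_right _
      have hyH : Commute (Hel m c) y := Commute.sum_right _ _ _ fun g _ =>
        ((commute_Hel_Z0.pow_right l).mul_right (commute_Hel_grp g)).smul_right _
      have hyF : y ∈ Fl c (2 * l + 1) := Submodule.sum_mem _ fun g _ =>
        Submodule.smul_mem _ _ (Z0_pow_mul_grp_mem l g)
      have h1 : x - y ∈ Fl c (2 * l + 1) := sub_mem hn hyF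
      have h2 : Eplus m c * (x - y) = (x - y) * Eplus m c := by
        rw [mul_sub, sub_mul, hE, hyE.eq]
      have h3 : Hel m c * (x - y) = (x - y) * Hel m c := by
        rw [mul_sub, sub_mul, hH, hyH.eq]
      have h4 (g : DihedralGroup m) : coef hc 0 l 0 l g (x - y) = 0 := by
        rw [map_sub, hy, map_sum]
        simp only [map_smul, coef_Z0_pow, smul_eq_mul, mul_ite, mul_zero, Finset.sum_ite_eq',
          Finset.mem_univ, if_true]
        rw [mul_right_comm, ← mul_pow]
        norm_num
      rw [← sub_add_cancel x y]
      refine add_mem (ih h3 h2 (mem_Fl_of_coef hc h1 fun a b i j g h => ?_)) hyA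
      by_cases hab : a + b = i + j
      · obtain ⟨rfl, rfl⟩ : b = l - a ∧ j = l - i := by omega
        exact coef_eq_zero_of_invariant hc h1 h2 g (h4 g) (by omega) (by omega)
      · exact coef_Hel hc h3 a b i j g hab
    · exact ih hH hE (mem_Fl_of_coef hc hn fun a b i j g h =>
        coef_Hel hc hH a b i j g (by omega))

end centraliser

/-! ### Standard modules -/

section standardModule

variable {m : ℕ} [NeZero m] {c : ZMod m → ℝ}
variable {V : Type*} [AddCommGroup V] [Module ℂ V] {τ : Representation ℂ (DihedralGroup m) V}

theorem mk_tmul (h : RCA m c) (v : V) :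
    (Submodule.Quotient.mk (h ⊗ₜ[ℂ] v) : StdMod c τ) = h • incl c τ v := by
  show _ = h • Submodule.Quotient.mk ((1 : RCA m c) ⊗ₜ[ℂ] v)
  rw [← Submodule.Quotient.mk_smul, TensorProduct.smul_tmul', smul_eq_mul, mul_one]

theorem vec_smul_incl (e : Fin 2 → ℂ) (v : V) : vec m c e • incl c τ v = 0 := by
  rw [← mk_tmul, Submodule.Quotient.mk_eq_zero]
  exact Submodule.subset_span (Or.inl ⟨1, e, v, by rw [one_mul]⟩)

theorem grp_smul_incl (g : DihedralGroup m) (v : V) :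
    grp m c g • incl c τ v = incl c τ (τ g v) := by
  rw [← one_smul (RCA m c) (incl c τ (τ g v)), ← mk_tmul, ← mk_tmul, Submodule.Quotient.eq]
  exact Submodule.subset_span (Or.inr ⟨1, g, v, by rw [one_mul]⟩)

/-- The action of an element of the algebra, as a linear map. -/
abbrev op (a : RCA m c) : Module.End ℂ (StdMod c τ) := Algebra.lsmul ℂ ℂ (StdMod c τ) a

theorem op_apply (a : RCA m c) (x : StdMod c τ) : op a x = a • x := rfl

theorem std_induction {p : StdMod c τ → Prop} (zero : p 0) (incl_mem : ∀ v, p (incl c τ v))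
    (add : ∀ x y, p x → p y → p (x + y)) (smul : ∀ (a : RCA m c) x, p x → p (a • x))
    (x : StdMod c τ) : p x := by
  obtain ⟨t, rfl⟩ := Submodule.Quotient.mk_surjective _ x
  induction t with
  | zero => exact zero
  | tmul h v => rw [mk_tmul]; exact smul _ _ (incl_mem v)
  | add x y hx hy => rw [Submodule.Quotient.mk_add]; exact add _ _ hx hy

variable (τ) in
/-- A `G`-representation, as a module on which `E` acts by zero. -/
def trivialEG : EGModule m V where
  rep := τ
  vec := 0
  comm := by simp
  equivariant := by simp

/-! ### The polynomial realisation of a standard module -/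

section realisation

variable (τ)
variable (hc : ∀ i j : ZMod m, IsConj (DihedralGroup.sr i) (DihedralGroup.sr j) → c i = c j)

/-- The evaluation of `H_c(G, E) ⊗ V` on the polynomial realisation. -/
def preRealise : RCA m c ⊗[ℂ] V →ₗ[ℂ] Poly V :=
  TensorProduct.lift
    (((polyHom c (trivialEG τ) hc).toLinearMap.flip ∘ₗ Finsupp.lsingle (0, 0)).flip)

theorem preRealise_tmul (h : RCA m c) (v : V) : preRealise τ hc (h ⊗ₜ v) =
    polyHom c (trivialEG τ) hc h (Finsupp.single (0, 0) v) := rfl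

theorem preRealise_smul (h : RCA m c) (t : RCA m c ⊗[ℂ] V) :
    preRealise τ hc (h • t) = polyHom c (trivialEG τ) hc h (preRealise τ hc t) := by
  induction t with
  | zero => simp
  | tmul h' v => rw [TensorProduct.smul_tmul', preRealise_tmul, preRealise_tmul, smul_eq_mul,
      map_mul, Module.End.mul_apply]
  | add x y hx hy => rw [smul_add, map_add, hx, hy, map_add, map_add]

theorem preRealise_rel {t : RCA m c ⊗[ℂ] V} (ht : t ∈ inducedRel c τ) :
    preRealise τ hc t = 0 := by
  induction ht using Submodule.span_induction with
  | mem t ht =>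
    rcases ht with ⟨h, e, v, rfl⟩ | ⟨h, g, v, rfl⟩
    · rw [preRealise_tmul, map_mul, Module.End.mul_apply, polyHom_vec, dunkl_single_zero]
      simp [trivialEG]
    · rw [map_sub, preRealise_tmul, preRealise_tmul, map_mul, Module.End.mul_apply, polyHom_grp]
      rcases g with k | k <;> simp [trivialEG]
  | zero => rw [map_zero]
  | add x y _ _ hx hy => rw [map_add, hx, hy, add_zero]
  | smul a x _ hx => rw [preRealise_smul, hx, map_zero]

/-- The standard module maps to its polynomial realisation. -/
def realise : StdMod c τ →ₗ[ℂ] Poly V :=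
  ((inducedRel c τ).restrictScalars ℂ).liftQ (preRealise τ hc)
    (fun _ ht => preRealise_rel τ hc ht) ∘ₗ
    (Submodule.Quotient.restrictScalarsEquiv ℂ (inducedRel c τ)).symm.toLinearMap

theorem realise_smul_incl (h : RCA m c) (v : V) : realise τ hc (h • incl c τ v) =
    polyHom c (trivialEG τ) hc h (Finsupp.single (0, 0) v) := by
  rw [← mk_tmul]; rfl

theorem realise_smul (h : RCA m c) (x : StdMod c τ) : realise τ hc (h • x) =
    polyHom c (trivialEG τ) hc h (realise τ hc x) := by
  induction x using std_induction generalizing h with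
  | zero => simp
  | incl_mem v =>
    rw [realise_smul_incl, ← one_smul (RCA m c) (incl c τ v), realise_smul_incl, map_one,
      Module.End.one_apply]
  | add x y hx hy => rw [smul_add, map_add, hx, hy, map_add, map_add]
  | smul a x hx => rw [← mul_smul, hx, hx, map_mul, Module.End.mul_apply]

theorem realise_incl (v : V) : realise τ hc (incl c τ v) = Finsupp.single (0, 0) v := by
  rw [← one_smul (RCA m c) (incl c τ v), realise_smul_incl, map_one, Module.End.one_apply]

theorem incl_injective
    (hc : ∀ i j : ZMod m, IsConj (DihedralGroup.sr i) (DihedralGroup.sr j) → c i = c j) :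
    Function.Injective (incl c τ) := fun v w h => by
  have := congrArg (realise τ hc) h
  rw [realise_incl, realise_incl] at this
  exact Finsupp.single_injective _ this

end realisation

/-! ### The grading -/

theorem degreePart_zero : degreePart c τ 0 = LinearMap.range (incl c τ) := by
  apply le_antisymm
  · refine Submodule.span_le.mpr ?_
    rintro _ ⟨a, b, v, hab, rfl⟩
    obtain ⟨rfl, rfl⟩ : a = 0 ∧ b = 0 := by omega
    exact ⟨v, by simp⟩
  · rintro _ ⟨v, rfl⟩
    exact Submodule.subset_span ⟨0, 0, v, rfl, by simp⟩

theorem incl_mem_degreePart (v : V) : incl c τ v ∈ degreePart c τ 0 := by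
  rw [degreePart_zero]; exact ⟨v, rfl⟩

/-- Each degree is produced from the previous one by x and y; this is the induction step for the
statements about homogeneous elements below. -/
theorem degreePart_succ_le {k : ℕ} {W : Submodule ℂ (StdMod c τ)}
    (hX : ∀ x ∈ degreePart c τ k, X m c • x ∈ W) (hY : ∀ x ∈ degreePart c τ k, Y m c • x ∈ W) :
    degreePart c τ (k + 1) ≤ W := by
  refine Submodule.span_le.mpr ?_
  rintro _ ⟨a, b, v, hab, rfl⟩
  rcases a with _ | a
  · obtain rfl : b = k + 1 := by omega
    rw [pow_zero, one_mul, pow_succ', mul_smul]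
    exact hY _ (Submodule.subset_span ⟨0, k, v, by omega, by rw [pow_zero, one_mul]⟩)
  · rw [pow_succ', mul_assoc, mul_smul]
    exact hX _ (Submodule.subset_span ⟨a, b, v, by omega, rfl⟩)

theorem degreePart_induction {k k' : ℕ} (f : StdMod c τ →ₗ[ℂ] StdMod c τ)
    (h : ∀ a b v, a + b = k → f ((X m c ^ a * Y m c ^ b) • incl c τ v) ∈ degreePart c τ k')
    {x : StdMod c τ} (hx : x ∈ degreePart c τ k) : f x ∈ degreePart c τ k' := by
  have : degreePart c τ k ≤ (degreePart c τ k').comap f := Submodule.span_le.mpr <| by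
    rintro _ ⟨a, b, v, hab, rfl⟩
    exact h a b v hab
  exact this hx

theorem X_smul_mem {k : ℕ} {x : StdMod c τ} (hx : x ∈ degreePart c τ k) :
    X m c • x ∈ degreePart c τ (k + 1) :=
  degreePart_induction (op (X m c)) (fun a b v h => Submodule.subset_span
    ⟨a + 1, b, v, by omega, by rw [op_apply, ← mul_smul, ← mul_assoc, ← pow_succ']⟩) hx

theorem Y_smul_mem {k : ℕ} {x : StdMod c τ} (hx : x ∈ degreePart c τ k) :
    Y m c • x ∈ degreePart c τ (k + 1) :=
  degreePart_induction (op (Y m c)) (fun a b v h => Submodule.subset_span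
    ⟨a, b + 1, v, by omega, by
      have : Commute (X m c ^ a) (Y m c) := Commute.pow_left X_Y a
      rw [op_apply, ← mul_smul, ← mul_assoc, ← this.eq, mul_assoc, ← pow_succ']⟩) hx

theorem covec_smul_mem {k : ℕ} {x : StdMod c τ} (w : Fin 2 → ℂ) (hx : x ∈ degreePart c τ k) :
    covec m c w • x ∈ degreePart c τ (k + 1) := by
  rw [covec_eq, add_smul, smul_assoc, smul_assoc]
  exact add_mem (Submodule.smul_mem _ _ (X_smul_mem hx)) (Submodule.smul_mem _ _ (Y_smul_mem hx))

theorem zC_smul_mem {k : ℕ} {x : StdMod c τ} (hx : x ∈ degreePart c τ k) :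
    zC m c • x ∈ degreePart c τ (k + 1) := covec_smul_mem _ hx

theorem zbC_smul_mem {k : ℕ} {x : StdMod c τ} (hx : x ∈ degreePart c τ k) :
    zbC m c • x ∈ degreePart c τ (k + 1) := covec_smul_mem _ hx

theorem Eplus_smul_mem {k : ℕ} {x : StdMod c τ} (hx : x ∈ degreePart c τ k) :
    Eplus m c • x ∈ degreePart c τ (k + 2) := by
  rw [Eplus_eq, smul_assoc, mul_smul]
  exact Submodule.smul_mem _ _ (zC_smul_mem (zbC_smul_mem hx))

theorem grp_smul_mem {k : ℕ} {x : StdMod c τ} (g : DihedralGroup m) (hx : x ∈ degreePart c τ k) :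
    grp m c g • x ∈ degreePart c τ k := by
  induction k generalizing x with
  | zero =>
    rw [degreePart_zero] at hx ⊢
    obtain ⟨v, rfl⟩ := hx
    exact ⟨_, (grp_smul_incl g v).symm⟩
  | succ k ih =>
    suffices h : ∀ w : Fin 2 → ℂ, ∀ x ∈ degreePart c τ k,
        covec m c w • x ∈ (degreePart c τ (k + 1)).comap (op (grp m c g)) from
      degreePart_succ_le (h _) (h _) hx
    intro w x hx
    rw [Submodule.mem_comap, op_apply, ← mul_smul, grp_covec, mul_smul]
    exact covec_smul_mem _ (ih hx)

theorem grpAlg_smul_mem {k : ℕ} {x : StdMod c τ} {C : RCA m c}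
    (hC : C ∈ Submodule.span ℂ (Set.range (grp m c))) (hx : x ∈ degreePart c τ k) :
    C • x ∈ degreePart c τ k := by
  induction hC using Submodule.span_induction with
  | mem y hy => obtain ⟨g, rfl⟩ := hy; exact grp_smul_mem g hx
  | zero => rw [zero_smul]; exact zero_mem _
  | add y z _ _ hy hz => rw [add_smul]; exact add_mem hy hz
  | smul a y _ hy => rw [smul_assoc]; exact Submodule.smul_mem _ _ hy

theorem vec_smul_zero {x : StdMod c τ} (e : Fin 2 → ℂ) (hx : x ∈ degreePart c τ 0) :
    vec m c e • x = 0 := by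
  rw [degreePart_zero] at hx
  obtain ⟨v, rfl⟩ := hx
  exact vec_smul_incl e v

/-- A vector moved past a covector leaves an element of the group algebra, which preserves degrees;
the base case uses that vectors kill 1 ⊗ V. -/
theorem vec_smul_mem {k : ℕ} {x : StdMod c τ} (e : Fin 2 → ℂ) (hx : x ∈ degreePart c τ (k + 1)) :
    vec m c e • x ∈ degreePart c τ k := by
  induction k generalizing x with
  | zero =>
    suffices h : ∀ w : Fin 2 → ℂ, ∀ x ∈ degreePart c τ 0,
        covec m c w • x ∈ (degreePart c τ 0).comap (op (vec m c e)) from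
      degreePart_succ_le (h _) (h _) hx
    intro w x hx
    obtain ⟨C, hC, h⟩ := vec_covec_mem (c := c) e w
    rw [Submodule.mem_comap, op_apply, ← mul_smul, h, add_smul, mul_smul, vec_smul_zero e hx,
      smul_zero, zero_add]
    exact grpAlg_smul_mem hC hx
  | succ k ih =>
    suffices h : ∀ w : Fin 2 → ℂ, ∀ x ∈ degreePart c τ (k + 1),
        covec m c w • x ∈ (degreePart c τ (k + 1)).comap (op (vec m c e)) from
      degreePart_succ_le (h _) (h _) hx
    intro w x hx
    obtain ⟨C, hC, h⟩ := vec_covec_mem (c := c) e w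
    rw [Submodule.mem_comap, op_apply, ← mul_smul, h, add_smul, mul_smul]
    exact add_mem (covec_smul_mem _ (ih hx)) (grpAlg_smul_mem hC hx)

theorem Eminus_smul_mem {k : ℕ} {x : StdMod c τ} (hx : x ∈ degreePart c τ (k + 2)) :
    Eminus m c • x ∈ degreePart c τ k := by
  rw [Eminus_eq, smul_assoc, mul_smul]
  exact Submodule.smul_mem _ _ (vec_smul_mem _ (vec_smul_mem _ hx))

theorem Eminus_smul_one {x : StdMod c τ} (hx : x ∈ degreePart c τ 1) : Eminus m c • x = 0 := by
  rw [Eminus_eq, smul_assoc, mul_smul, dV, dbV, vec_smul_zero _ (vec_smul_mem _ hx), smul_zero]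

theorem Eminus_smul_zero {x : StdMod c τ} (hx : x ∈ degreePart c τ 0) : Eminus m c • x = 0 := by
  rw [Eminus_eq, smul_assoc, mul_smul, dbV, vec_smul_zero _ hx, smul_zero, smul_zero]

theorem Z0_smul_mem {k : ℕ} {x : StdMod c τ} (hx : x ∈ degreePart c τ k) :
    Z0 m c • x ∈ degreePart c τ k := by
  rw [Z0_eq, smul_assoc, sub_smul, mul_smul, mul_smul]
  refine Submodule.smul_mem _ _ ?_
  rcases k with _ | k
  · rw [dV, dbV, vec_smul_zero _ hx, vec_smul_zero _ hx, smul_zero, smul_zero, sub_zero]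
    exact zero_mem _
  · exact sub_mem (zbC_smul_mem (vec_smul_mem _ hx)) (zC_smul_mem (vec_smul_mem _ hx))

/-- The sum of the homogeneous parts is stable under all generators of the algebra and contains 1 ⊗
V, which generates the standard module. -/
theorem iSup_degreePart : ⨆ k, degreePart c τ k = ⊤ := by
  rw [eq_top_iff]
  rintro x -
  have key (a : RCA m c) : ∀ x ∈ ⨆ k, degreePart c τ k, a • x ∈ ⨆ k, degreePart c τ k := by
    have lift {a : RCA m c} (h : ∀ k, ∀ x ∈ degreePart c τ k, ∃ k', a • x ∈ degreePart c τ k') :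
        ∀ x ∈ ⨆ k, degreePart c τ k, a • x ∈ ⨆ k, degreePart c τ k := fun x hx => by
      have : ⨆ k, degreePart c τ k ≤ (⨆ k, degreePart c τ k).comap (op a) :=
        iSup_le fun k x hx => by
          obtain ⟨k', hk'⟩ := h k x hx
          exact Submodule.mem_iSup_of_mem k' hk'
      exact this hx
    induction a using RCA_induction with
    | scalar a => intro x hx; rw [algebraMap_smul]; exact Submodule.smul_mem _ _ hx
    | vec e =>
      refine lift fun k x hx => ?_
      rcases k with _ | k
      · exact ⟨0, by rw [vec_smul_zero _ hx]; exact zero_mem _⟩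
      · exact ⟨k, vec_smul_mem _ hx⟩
    | covec w => exact lift fun k x hx => ⟨k + 1, covec_smul_mem _ hx⟩
    | grp g => exact lift fun k x hx => ⟨k, grp_smul_mem _ hx⟩
    | add a b ha hb => intro x hx; rw [add_smul]; exact add_mem (ha x hx) (hb x hx)
    | mul a b ha hb => intro x hx; rw [mul_smul]; exact ha _ (hb x hx)
  induction x using std_induction with
  | zero => exact zero_mem _
  | incl_mem v => exact Submodule.mem_iSup_of_mem 0 (incl_mem_degreePart v)
  | add x y hx hy => exact add_mem hx hy
  | smul a x hx => exact key a x hx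

instance finite_degreePart [FiniteDimensional ℂ V] (k : ℕ) :
    FiniteDimensional ℂ (degreePart c τ k) := by
  induction k with
  | zero => rw [degreePart_zero]; infer_instance
  | succ k ih =>
    have h : degreePart c τ (k + 1) ≤
        (degreePart c τ k).map (op (X m c)) ⊔ (degreePart c τ k).map (op (Y m c)) :=
      degreePart_succ_le (fun x hx => Submodule.mem_sup_left ⟨x, hx, rfl⟩)
        (fun x hx => Submodule.mem_sup_right ⟨x, hx, rfl⟩)
    exact Submodule.finiteDimensional_of_le h

/-- The scalar by which `H` acts on the part of degree `k`. -/
theorem Hel_smul {N : ℝ} (hN : ∀ v, sigma m c • incl c τ v = (N : ℂ) • incl c τ v) {k : ℕ}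
    {x : StdMod c τ} (hx : x ∈ degreePart c τ k) :
    Hel m c • x = ((k : ℂ) + 1 - N) • x := by
  induction k generalizing x with
  | zero =>
    rw [degreePart_zero] at hx
    obtain ⟨v, rfl⟩ := hx
    rw [Hel, sub_smul, add_smul, add_smul, mul_smul, mul_smul, xi, eta, vec_smul_incl,
      vec_smul_incl, hN, one_smul]
    simp only [smul_zero, Nat.cast_zero]
    module
  | succ k ih =>
    have h : degreePart c τ (k + 1) ≤
        LinearMap.ker (op (Hel m c) - (((k + 1 : ℕ) : ℂ) + 1 - N) • (1 : Module.End ℂ _)) := by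
      refine degreePart_succ_le (fun x hx => ?_) (fun x hx => ?_) <;>
      rw [LinearMap.mem_ker, LinearMap.sub_apply, LinearMap.smul_apply, Module.End.one_apply,
        op_apply, ← mul_smul]
      · rw [Hel_X, add_smul, mul_smul, ih hx, smul_comm (X m c) ((k : ℂ) + 1 - N)]
        generalize X m c • x = y
        push_cast
        module
      · rw [Hel_Y, add_smul, mul_smul, ih hx, smul_comm (Y m c) ((k : ℂ) + 1 - N)]
        generalize Y m c • x = y
        push_cast
        module
    have := h hx
    rwa [LinearMap.mem_ker, LinearMap.sub_apply, sub_eq_zero, LinearMap.smul_apply,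
      Module.End.one_apply, op_apply] at this

/-! ### Harmonics and the part two degrees lower -/

variable (c τ) in
/-- The harmonics of degree `k`. -/
def harm (k : ℕ) : Submodule ℂ (StdMod c τ) :=
  degreePart c τ k ⊓ LinearMap.ker (op (Eminus m c))

theorem mem_harm {k : ℕ} {x : StdMod c τ} :
    x ∈ harm c τ k ↔ x ∈ degreePart c τ k ∧ Eminus m c • x = 0 := Iff.rfl

theorem mem_harmonics {ε : ℝ} {k : ℕ} {lam : ℝ} {x : StdMod c τ} : x ∈ harmonics c τ ε k lam ↔
    x ∈ harm c τ k ∧ Ztilde m c ε • x = (lam : ℂ) • x := by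
  rw [mem_harm, and_assoc]; rfl

theorem grp_smul_harm {k : ℕ} {x : StdMod c τ} (g : DihedralGroup m) (hx : x ∈ harm c τ k) :
    grp m c g • x ∈ harm c τ k := by
  rw [mem_harm] at hx ⊢
  exact ⟨grp_smul_mem g hx.1, by
    rw [← mul_smul, (commute_Eminus_grp g).eq, mul_smul, hx.2, smul_zero]⟩

theorem commute_Eminus_Z0 : Commute (Eminus m c) (Z0 m c) := (sub_eq_zero.mp Z0_Eminus).symm

theorem Z0_smul_harm {k : ℕ} {x : StdMod c τ} (hx : x ∈ harm c τ k) :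
    Z0 m c • x ∈ harm c τ k := by
  rw [mem_harm] at hx ⊢
  exact ⟨Z0_smul_mem hx.1, by
    rw [← mul_smul, commute_Eminus_Z0.eq, mul_smul, hx.2, smul_zero]⟩

variable (c τ) in
/-- The part of degree `k - 2`. -/
def lowerPart : ℕ → Submodule ℂ (StdMod c τ)
  | 0 => ⊥
  | 1 => ⊥
  | k + 2 => degreePart c τ k

theorem covec_smul_lowerPart {k : ℕ} {x : StdMod c τ} (w : Fin 2 → ℂ)
    (hx : x ∈ lowerPart c τ k) : covec m c w • x ∈ lowerPart c τ (k + 1) := by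
  rcases k with _ | _ | k
  · rw [lowerPart, Submodule.mem_bot] at hx
    rw [hx, smul_zero]; exact zero_mem _
  · rw [lowerPart, Submodule.mem_bot] at hx
    rw [hx, smul_zero]; exact zero_mem _
  · exact covec_smul_mem w hx

theorem grp_smul_lowerPart {k : ℕ} {x : StdMod c τ} (g : DihedralGroup m)
    (hx : x ∈ lowerPart c τ k) : grp m c g • x ∈ lowerPart c τ k := by
  rcases k with _ | _ | k
  · rw [lowerPart, Submodule.mem_bot] at hx
    rw [hx, smul_zero]; exact zero_mem _
  · rw [lowerPart, Submodule.mem_bot] at hx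
    rw [hx, smul_zero]; exact zero_mem _
  · exact grp_smul_mem g hx

theorem Eplus_smul_lowerPart {k : ℕ} {x : StdMod c τ} (hx : x ∈ lowerPart c τ k) :
    Eplus m c • x ∈ degreePart c τ k := by
  rcases k with _ | _ | k
  · rw [lowerPart, Submodule.mem_bot] at hx
    rw [hx, smul_zero]; exact zero_mem _
  · rw [lowerPart, Submodule.mem_bot] at hx
    rw [hx, smul_zero]; exact zero_mem _
  · exact Eplus_smul_mem hx

/-! ### Pure powers of z and z̄ modulo the image of E₊ -/

variable (c τ) in
/-- The map `(v, v') ↦ z ^ k v + z̄ ^ k v'`. -/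
def extremal (k : ℕ) : V × V →ₗ[ℂ] StdMod c τ :=
  (op (zC m c ^ k) ∘ₗ incl c τ).coprod (op (zbC m c ^ k) ∘ₗ incl c τ)

theorem extremal_apply (k : ℕ) (v v' : V) :
    extremal c τ k (v, v') = zC m c ^ k • incl c τ v + zbC m c ^ k • incl c τ v' := by
  rw [extremal, LinearMap.coprod_apply]; rfl

theorem extremal_mem (k : ℕ) (p : V × V) : extremal c τ k p ∈ degreePart c τ k := by
  rw [extremal_apply]
  have h1 (v : V) : zC m c ^ k • incl c τ v ∈ degreePart c τ k := by
    induction k with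
    | zero => rw [pow_zero, one_smul]; exact incl_mem_degreePart v
    | succ k ih => rw [pow_succ', mul_smul]; exact zC_smul_mem ih
  have h2 (v : V) : zbC m c ^ k • incl c τ v ∈ degreePart c τ k := by
    clear h1
    induction k with
    | zero => rw [pow_zero, one_smul]; exact incl_mem_degreePart v
    | succ k ih => rw [pow_succ', mul_smul]; exact zbC_smul_mem ih
  exact add_mem (h1 _) (h2 _)

theorem X_eq_z : X m c = (1 / 2 : ℂ) • (zC m c + zbC m c) := by
  rw [zC_eq, zbC_eq]; module

theorem Y_eq_z : Y m c = (-Complex.I / 2) • (zC m c - zbC m c) := by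
  rw [zC_eq, zbC_eq, show X m c + Complex.I • Y m c - (X m c - Complex.I • Y m c) =
    (2 * Complex.I) • Y m c by module, smul_smul,
    show -Complex.I / 2 * (2 * Complex.I) = 1 by linear_combination -Complex.I_mul_I, one_smul]

theorem zC_mul_zbC : zC m c * zbC m c = (2 : ℂ) • Eplus m c := by
  rw [Eplus_eq]; module

/-- Because zz̄ = 2E₊, every mixed monomial lies in the image of E₊, and only the pure powers of z
and z̄ remain. This supplies the upper bound for the dimension of the harmonics. -/
theorem degreePart_le_sup (k : ℕ) : degreePart c τ k ≤
    LinearMap.range (extremal c τ k) ⊔ (lowerPart c τ k).map (op (Eplus m c)) := by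
  induction k with
  | zero =>
    rw [degreePart_zero]
    rintro _ ⟨v, rfl⟩
    exact Submodule.mem_sup_left ⟨(v, 0), by simp [extremal_apply]⟩
  | succ k ih =>
    set W := LinearMap.range (extremal c τ (k + 1)) ⊔
      (lowerPart c τ (k + 1)).map (op (Eplus m c)) with hW
    have hlow {x : StdMod c τ} (hx : x ∈ lowerPart c τ (k + 1)) : Eplus m c • x ∈ W :=
      Submodule.mem_sup_right ⟨x, hx, rfl⟩
    have hr (v v' : V) : zC m c ^ (k + 1) • incl c τ v + zbC m c ^ (k + 1) • incl c τ v' ∈ W :=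
      Submodule.mem_sup_left ⟨(v, v'), extremal_apply _ _ _⟩
    have hr1 (v : V) : zC m c ^ (k + 1) • incl c τ v ∈ W := by simpa using hr v 0
    have hr2 (v : V) : zbC m c ^ (k + 1) • incl c τ v ∈ W := by simpa using hr 0 v
    have hz : ∀ x ∈ degreePart c τ k, zC m c • x ∈ W := by
      intro x hx
      obtain ⟨_, ⟨⟨v, v'⟩, rfl⟩, _, ⟨q, hq, rfl⟩, rfl⟩ := Submodule.mem_sup.mp (ih hx)
      rw [op_apply, extremal_apply, smul_add, smul_add, ← mul_smul, ← mul_smul, ← mul_smul,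
        ← pow_succ', ← commute_Eplus_zC.eq, mul_smul (Eplus m c)]
      refine add_mem (add_mem (hr1 v) ?_) (hlow (covec_smul_lowerPart _ hq))
      -- In degree 0 the second summand is a constant, so multiplying it by z gives a pure power;
      -- from degree 1 on the product contains zz̄.
      rcases k with _ | k
      · simpa using hr1 v'
      · rw [pow_succ', ← mul_assoc, zC_mul_zbC, smul_mul_assoc, smul_assoc, mul_smul]
        refine Submodule.smul_mem _ _ (hlow ?_)
        have := extremal_mem (c := c) (τ := τ) k (0, v')
        rw [extremal_apply, map_zero, smul_zero, zero_add] at this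
        exact this
    have hzb : ∀ x ∈ degreePart c τ k, zbC m c • x ∈ W := by
      intro x hx
      obtain ⟨_, ⟨⟨v, v'⟩, rfl⟩, _, ⟨q, hq, rfl⟩, rfl⟩ := Submodule.mem_sup.mp (ih hx)
      rw [op_apply, extremal_apply, smul_add, smul_add, ← mul_smul, ← mul_smul, ← mul_smul,
        ← pow_succ', ← commute_Eplus_zbC.eq, mul_smul (Eplus m c)]
      refine add_mem (add_mem ?_ (hr2 v')) (hlow (covec_smul_lowerPart _ hq))
      rcases k with _ | k
      · simpa using hr2 v
      · rw [pow_succ', ← mul_assoc, ← commute_zC_zbC.eq, zC_mul_zbC, smul_mul_assoc, smul_assoc,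
          mul_smul]
        refine Submodule.smul_mem _ _ (hlow ?_)
        have := extremal_mem (c := c) (τ := τ) k (v, 0)
        rw [extremal_apply, map_zero, smul_zero, add_zero] at this
        exact this
    refine degreePart_succ_le (fun x hx => ?_) (fun x hx => ?_)
    · rw [X_eq_z, smul_assoc, add_smul]
      exact Submodule.smul_mem _ _ (add_mem (hz x hx) (hzb x hx))
    · rw [Y_eq_z, smul_assoc, sub_smul]
      exact Submodule.smul_mem _ _ (sub_mem (hz x hx) (hzb x hx))

/-- In the polynomial realisation E₊ is multiplication by zz̄/2, whose image has no pure powers of z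
or z̄. Comparing the coefficients of z^k and z̄^k gives the claim; positivity of k keeps these two
monomials apart. -/
theorem extremal_eq_zero_of_Eplus
    (hc : ∀ i j : ZMod m, IsConj (DihedralGroup.sr i) (DihedralGroup.sr j) → c i = c j)
    {k : ℕ} (hk : 0 < k) {v v' : V} {q : StdMod c τ}
    (h : extremal c τ k (v, v') = Eplus m c • q) : v = 0 ∧ v' = 0 := by
  have h1 := congrArg (realise τ hc) h
  have h2 (f : Poly V) (a b : ℕ) (hab : a = 0 ∨ b = 0) : mulZ (mulZb f) (a, b) = 0 := by
    induction f using Finsupp.induction_linear with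
    | zero => simp
    | add f g hf hg => simp [hf, hg]
    | single p v =>
      obtain ⟨a', b'⟩ := p
      rw [mulZb_single, mulZ_single, Finsupp.single_apply, if_neg]
      rw [Prod.mk.injEq]; omega
  rw [extremal_apply, map_add, realise_smul, realise_smul, realise_smul, map_pow, map_pow,
    realise_incl, realise_incl, Eplus_eq, map_smul, map_mul, polyHom_zC, polyHom_zbC,
    mulZ_pow_single, mulZb_pow_single, zero_add, LinearMap.smul_apply, Module.End.mul_apply] at h1
  constructor
  · have := DFunLike.congr_fun h1 (k, 0)
    simpa [h2, Finsupp.single_apply, hk.ne, hk.ne'] using this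
  · have := DFunLike.congr_fun h1 (0, k)
    simpa [h2, Finsupp.single_apply, hk.ne, hk.ne'] using this

end standardModule

/-! ### The Casimir identity -/

section casimir

variable {m : ℕ} [NeZero m] {c : ZMod m → ℝ}

theorem sr_X (j : ZMod m) :
    grp m c (.sr j) * X m c = (cosj j • X m c + sinj j • Y m c) * grp m c (.sr j) := by
  rw [X, grp_covec, covec_eq]; simp [act, actMat, X]

theorem sr_Y (j : ZMod m) :
    grp m c (.sr j) * Y m c = (sinj j • X m c - cosj j • Y m c) * grp m c (.sr j) := by
  rw [Y, grp_covec, covec_eq]; simp [act, actMat, Y, X, sub_eq_add_neg]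

/-- Here s_j x = (cos x + sin y) s_j at the doubled angle, and the double-angle formulas turn the
coefficients into products of coordinates of the root. -/
theorem sigma_X : sigma m c * X m c =
    X m c * (sab m c 1 1 - sab m c 0 0) - (2 : ℂ) • (Y m c * sab m c 1 0) := by
  simp only [sigma, sab, Finset.sum_mul, Finset.mul_sum, ← Finset.sum_sub_distrib, Finset.smul_sum]
  refine Finset.sum_congr rfl fun j _ => ?_
  simp only [smul_mul_assoc, sr_X, add_mul, mul_sub, mul_smul_comm]
  rw [sinj_double, show cosj j = root j 1 * root j 1 - root j 0 * root j 0 by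
    linear_combination (1 / 2 : ℂ) * (cosj_double j + cosj_double' j)]
  module

theorem sigma_Y : sigma m c * Y m c =
    Y m c * (sab m c 0 0 - sab m c 1 1) - (2 : ℂ) • (X m c * sab m c 1 0) := by
  simp only [sigma, sab, Finset.sum_mul, Finset.mul_sum, ← Finset.sum_sub_distrib, Finset.smul_sum]
  refine Finset.sum_congr rfl fun j _ => ?_
  simp only [smul_mul_assoc, sr_Y, sub_mul, mul_sub, mul_smul_comm]
  rw [sinj_double, show cosj j = root j 1 * root j 1 - root j 0 * root j 0 by
    linear_combination (1 / 2 : ℂ) * (cosj_double j + cosj_double' j)]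
  module

theorem commute_Hel_sigma : Commute (Hel m c) (sigma m c) :=
  Commute.sum_right _ _ _ fun _ _ => (commute_Hel_grp _).smul_right _

/-- For c = 0 this is the planar identity (r∂_r)² + ∂_θ² = r²Δ. In general the terms arising from
moving vectors past covectors assemble to 2σ times the Euler operator. Stating it in an abstract
ring leaves a purely noncommutative polynomial identity. -/
theorem casimir_aux {R : Type*} [Ring R] {x y ξ η s00 s11 s10 σ : R} (hxy : x * y = y * x)
    (h1 : ξ * x = x * ξ + 1 - 2 * s00) (h2 : η * y = y * η + 1 - 2 * s11)
    (h3 : ξ * y = y * ξ - 2 * s10) (h4 : η * x = x * η - 2 * s10)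
    (h5 : σ * x = x * (s11 - s00) - 2 * (y * s10))
    (h6 : σ * y = y * (s00 - s11) - 2 * (x * s10)) :
    (x * ξ + y * η) * (x * ξ + y * η) + (x * η - y * ξ) * (x * η - y * ξ) =
      2 * σ * (x * ξ + y * η) + (x * x + y * y) * (ξ * ξ + η * η) := by
  linear_combination (norm := noncomm_ring) x * h1 * ξ + x * h3 * η + y * h4 * ξ + y * h2 * η +
    x * h4 * η - x * h2 * ξ - y * h1 * η + y * h3 * ξ - 2 * h5 * ξ - 2 * h6 * η +
    hxy * ξ * η - hxy * η * ξ

/-- With xξ + yη = H − 1 + σ the preceding identity becomes quadratic in H − 1 and σ. These commute,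
the mixed terms cancel, and −r²Δ is 4E₊E₋. -/
theorem casimir : Z0 m c * Z0 m c + sigma m c * sigma m c =
    (Hel m c - 1) * (Hel m c - 1) + (4 : ℂ) • (Eplus m c * Eminus m c) := by
  have h5 := sigma_X (m := m) (c := c)
  have h6 := sigma_Y (m := m) (c := c)
  rw [smul_two_eq] at h5 h6
  have key := casimir_aux X_Y xi_X eta_Y xi_Y eta_X h5 h6
  have e1 : Z0 m c * Z0 m c = -((X m c * eta m c - Y m c * xi m c) *
      (X m c * eta m c - Y m c * xi m c)) := by
    rw [Z0, smul_mul_assoc, mul_smul_comm, I_smul_I_smul]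
  have e2 : (4 : ℂ) • (Eplus m c * Eminus m c) =
      -((X m c * X m c + Y m c * Y m c) * (xi m c * xi m c + eta m c * eta m c)) := by
    rw [Eplus, Eminus, smul_mul_assoc, mul_neg, mul_smul_comm]
    module
  have e3 : X m c * xi m c + Y m c * eta m c = Hel m c - 1 + sigma m c := by
    rw [Hel]; abel
  rw [e3] at key
  rw [e1, e2]
  linear_combination (norm := noncomm_ring) -key + (commute_Hel_sigma (m := m) (c := c)).eq

theorem commute_grp_sigma
    (hc : ∀ i j : ZMod m, IsConj (DihedralGroup.sr i) (DihedralGroup.sr j) → c i = c j)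
    (g : DihedralGroup m) : Commute (grp m c g) (sigma m c) := by
  obtain ⟨f, hf⟩ : ∃ f : ZMod m ≃ ZMod m, ∀ j, g * .sr j = .sr (f j) * g := by
    rcases g with k | k
    · exact ⟨Equiv.subRight (2 * k), fun j => by simp; ring⟩
    · exact ⟨Equiv.subLeft (2 * k), fun j => by simp; ring⟩
  show _ * _ = _ * _
  rw [sigma, Finset.sum_mul, Finset.mul_sum,
    ← Equiv.sum_comp f fun j => (c j : ℂ) • grp m c (.sr j) * grp m c g]
  refine Finset.sum_congr rfl fun j _ => ?_
  have hcj : c (f j) = c j :=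
    (hc _ _ (isConj_iff.mpr ⟨g, by rw [hf, mul_inv_cancel_right]⟩)).symm
  rw [mul_smul_comm, smul_mul_assoc, grp_mul_grp, grp_mul_grp, hf, hcj]

end casimir

/-! ### Contravariant forms -/

section forms

variable {m : ℕ} [NeZero m] {c : ZMod m → ℝ}
variable {V : Type*} [AddCommGroup V] [Module ℂ V] {τ : Representation ℂ (DihedralGroup m) V}

variable (c τ) in
/-- A positive definite contravariant Hermitian form on a standard module. -/
structure UForm where
  form : StdMod c τ →ₗ⋆[ℂ] StdMod c τ →ₗ[ℂ] ℂ
  herm : ∀ p q, form q p = starRingEnd ℂ (form p q)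
  pos : ∀ p, p ≠ 0 → 0 < (form p p).re
  vec_adj : ∀ (e : Fin 2 → ℂ) p q, form (vec m c e • p) q = form p (covec m c (star e) • q)
  covec_adj : ∀ (e : Fin 2 → ℂ) p q, form (covec m c e • p) q = form p (vec m c (star e) • q)
  grp_adj : ∀ (g : DihedralGroup m) p q, form (grp m c g • p) q = form p (grp m c g⁻¹ • q)

/-! ### Adjoint elements and orthogonality -/

namespace UForm

variable (B : UForm c τ)

/-- `a` and `b` are adjoint to each other. -/
def Adj (a b : RCA m c) : Prop := ∀ p q, B.form (a • p) q = B.form p (b • q)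

variable {B}

theorem Adj.mul {a a' b b' : RCA m c} (h : B.Adj a a') (h' : B.Adj b b') :
    B.Adj (a * b) (b' * a') := fun p q => by
  rw [mul_smul, h, h', mul_smul]

theorem Adj.add {a a' b b' : RCA m c} (h : B.Adj a a') (h' : B.Adj b b') :
    B.Adj (a + b) (a' + b') := fun p q => by
  rw [add_smul, map_add, LinearMap.add_apply, h, h', add_smul, map_add]

theorem Adj.smul {a a' : RCA m c} (h : B.Adj a a') (s : ℂ) :
    B.Adj (s • a) (starRingEnd ℂ s • a') := fun p q => by
  rw [smul_assoc, map_smulₛₗ, LinearMap.smul_apply, h, smul_assoc,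
    LinearMap.map_smul]

theorem Adj.neg {a a' : RCA m c} (h : B.Adj a a') : B.Adj (-a) (-a') := fun p q => by
  rw [neg_smul, map_neg, LinearMap.neg_apply, h, neg_smul, map_neg]

theorem Adj.sub {a a' b b' : RCA m c} (h : B.Adj a a') (h' : B.Adj b b') :
    B.Adj (a - b) (a' - b') := by
  rw [sub_eq_add_neg, sub_eq_add_neg]; exact h.add h'.neg

theorem Adj.sum {ι : Type*} {s : Finset ι} {a a' : ι → RCA m c} (h : ∀ i, B.Adj (a i) (a' i)) :
    B.Adj (∑ i ∈ s, a i) (∑ i ∈ s, a' i) := fun p q => by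
  rw [Finset.sum_smul, map_sum, LinearMap.sum_apply, Finset.sum_smul, map_sum]
  exact Finset.sum_congr rfl fun i _ => h i p q

theorem star_e0 : star (![1, 0] : Fin 2 → ℂ) = ![1, 0] := by
  ext i; fin_cases i <;> simp

theorem star_e1 : star (![0, 1] : Fin 2 → ℂ) = ![0, 1] := by
  ext i; fin_cases i <;> simp

variable (B)

theorem adj_X : B.Adj (X m c) (xi m c) := fun p q => by rw [X, B.covec_adj, star_e0, xi]

theorem adj_Y : B.Adj (Y m c) (eta m c) := fun p q => by rw [Y, B.covec_adj, star_e1, eta]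

theorem adj_xi : B.Adj (xi m c) (X m c) := fun p q => by rw [X, xi, B.vec_adj, star_e0]

theorem adj_eta : B.Adj (eta m c) (Y m c) := fun p q => by rw [Y, eta, B.vec_adj, star_e1]

theorem adj_sr (j : ZMod m) : B.Adj (grp m c (.sr j)) (grp m c (.sr j)) := fun p q => by
  rw [B.grp_adj, DihedralGroup.inv_sr]

theorem adj_sigma : B.Adj (sigma m c) (sigma m c) := by
  have := Adj.sum (s := Finset.univ) fun j => (B.adj_sr j).smul (c j : ℂ)
  simp only [Complex.conj_ofReal] at this
  exact this

theorem adj_Eplus : B.Adj (Eplus m c) (-Eminus m c) := by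
  have := ((B.adj_X.mul B.adj_X).add (B.adj_Y.mul B.adj_Y)).smul (1 / 2)
  rw [show starRingEnd ℂ (1 / 2) = 1 / 2 by
    simp [Complex.conj_ofNat]] at this
  rw [Eminus, neg_neg]; exact this

theorem adj_Eminus : B.Adj (Eminus m c) (-Eplus m c) := by
  have := (((B.adj_xi.mul B.adj_xi).add (B.adj_eta.mul B.adj_eta)).smul (1 / 2)).neg
  rw [show starRingEnd ℂ (1 / 2) = 1 / 2 by
    simp [Complex.conj_ofNat]] at this
  exact this

theorem adj_Hel : B.Adj (Hel m c) (Hel m c) := by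
  have := (B.adj_Eplus.mul B.adj_Eminus).sub (B.adj_Eminus.mul B.adj_Eplus)
  rw [neg_mul_neg, neg_mul_neg, ← Hel_eq] at this
  exact this

theorem adj_Z0 : B.Adj (Z0 m c) (Z0 m c) := by
  have := ((B.adj_X.mul B.adj_eta).sub (B.adj_Y.mul B.adj_xi)).smul Complex.I
  have e : starRingEnd ℂ Complex.I • (Y m c * xi m c - X m c * eta m c) = Z0 m c := by
    rw [Complex.conj_I, Z0]; module
  rw [e] at this
  exact this

theorem adj_Ztilde (ε : ℝ) : B.Adj (Ztilde m c ε) (Ztilde m c ε) := by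
  have := B.adj_Z0.add (B.adj_sigma.smul (ε : ℂ))
  rw [Complex.conj_ofReal] at this
  exact this

theorem eq_zero_of_form {p : StdMod c τ} (h : B.form p p = 0) : p = 0 := by
  by_contra hp
  have := B.pos p hp
  rw [h] at this
  exact lt_irrefl _ this

theorem form_symm_zero {p q : StdMod c τ} (h : B.form p q = 0) : B.form q p = 0 := by
  rw [B.herm, h, map_zero]

theorem nonneg (p : StdMod c τ) : 0 ≤ (B.form p p).re := by
  by_cases hp : p = 0
  · simp [hp]
  · exact (B.pos p hp).le

variable {B}

/-- Eigenvalues of self-adjoint elements are real. -/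
theorem conj_eigenvalue {a : RCA m c} (ha : B.Adj a a) {p : StdMod c τ} (hp : p ≠ 0) {s : ℂ}
    (h : a • p = s • p) : starRingEnd ℂ s = s := by
  have h1 := ha p p
  rw [h, map_smulₛₗ, LinearMap.smul_apply, map_smul, smul_eq_mul, smul_eq_mul] at h1
  refine mul_right_cancel₀ (fun h0 => hp (B.eq_zero_of_form h0)) h1

/-- Eigenvectors of self-adjoint elements with different eigenvalues are orthogonal. -/
theorem orthogonal {a : RCA m c} (ha : B.Adj a a) {p q : StdMod c τ} {s t : ℂ}
    (hp : a • p = s • p) (hq : a • q = t • q) (hst : s ≠ t) : B.form p q = 0 := by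
  by_cases hp0 : p = 0
  · simp [hp0]
  have hs := conj_eigenvalue ha hp0 hp
  have h1 := ha p q
  rw [hp, hq, map_smulₛₗ, LinearMap.smul_apply, map_smul, smul_eq_mul, smul_eq_mul, hs] at h1
  by_contra h0
  exact hst (mul_right_cancel₀ h0 h1)

variable (B)

-- Elements of degree k + 1 are sums of x- and y-multiples, and pairing p with x q equals pairing ξp
-- with q. So p is orthogonal to its whole degree, in particular to itself.
include B in
theorem eq_zero_of_vec {k : ℕ} {p : StdMod c τ} (hp : p ∈ degreePart c τ (k + 1))
    (h1 : xi m c • p = 0) (h2 : eta m c • p = 0) : p = 0 := by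
  have : degreePart c τ (k + 1) ≤ LinearMap.ker (B.form p) := by
    refine degreePart_succ_le (fun x _ => ?_) (fun x _ => ?_)
    · rw [LinearMap.mem_ker, ← B.adj_xi, h1, map_zero, LinearMap.zero_apply]
    · rw [LinearMap.mem_ker, ← B.adj_eta, h2, map_zero, LinearMap.zero_apply]
  exact B.eq_zero_of_form (this hp)

/-! ### Consequences of positivity -/

variable {N : ℝ} (hN : ∀ v, sigma m c • incl c τ v = (N : ℂ) • incl c τ v)

include B hN

/-- The operator `x ξ + y η = k - N + σ` is positive definite in degree `k > 0`. -/
theorem sigma_eigenvalue_pos {k : ℕ} (hk : 0 < k) {p : StdMod c τ} (hp : p ∈ degreePart c τ k)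
    (h0 : p ≠ 0) {s : ℝ} (hs : sigma m c • p = (s : ℂ) • p) : 0 < k - N + s := by
  obtain ⟨k, rfl⟩ : ∃ k', k = k' + 1 := ⟨k - 1, by omega⟩
  have e1 : (X m c * xi m c + Y m c * eta m c) • p = (((k + 1 : ℕ) - N + s : ℝ) : ℂ) • p := by
    rw [show X m c * xi m c + Y m c * eta m c = Hel m c - 1 + sigma m c by rw [Hel]; abel,
      add_smul, sub_smul, Hel_smul hN hp, hs, one_smul]
    push_cast
    module
  have e2 : B.form p ((X m c * xi m c + Y m c * eta m c) • p) =
      B.form (xi m c • p) (xi m c • p) + B.form (eta m c • p) (eta m c • p) := by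
    rw [add_smul, map_add, mul_smul, mul_smul, B.adj_xi, B.adj_eta]
  rw [e1, map_smul, smul_eq_mul] at e2
  have e3 := congrArg Complex.re e2
  rw [Complex.re_ofReal_mul, Complex.add_re] at e3
  have h1 := B.nonneg (xi m c • p)
  have h2 := B.nonneg (eta m c • p)
  have h3 := B.pos p h0
  have h4 : 0 < (B.form (xi m c • p) (xi m c • p)).re +
      (B.form (eta m c • p) (eta m c • p)).re := by
    by_cases hx : xi m c • p = 0
    · by_cases hy : eta m c • p = 0
      · exact absurd (B.eq_zero_of_vec hp hx hy) h0
      · exact add_pos_of_nonneg_of_pos h1 (B.pos _ hy)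
    · exact add_pos_of_pos_of_nonneg (B.pos _ hx) h2
  rw [← e3] at h4
  exact (pos_iff_pos_of_mul_pos h4).mpr h3

/-- An eigenvector of `H` of the right weight is homogeneous. -/
theorem mem_degreePart_of_Hel {k : ℕ} {p : StdMod c τ}
    (hp : Hel m c • p = ((k : ℂ) + 1 - N) • p) : p ∈ degreePart c τ k := by
  have htop : degreePart c τ k ⊔ ⨆ j, ⨆ (_ : j ≠ k), degreePart c τ j = ⊤ := by
    rw [eq_top_iff, ← iSup_degreePart]
    refine iSup_le fun j => ?_
    by_cases hj : j = k
    · subst hj; exact le_sup_left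
    · exact le_sup_of_le_right (le_iSup₂_of_le j hj le_rfl)
  -- After splitting off the degree-k part, the remainder q is an H-eigenvector with the weight of
  -- degree k, yet it is a sum of elements of other degrees. Self-adjointness of H makes q
  -- orthogonal to all of those, hence to itself.
  obtain ⟨p', hp', q, hq, rfl⟩ := Submodule.mem_sup.mp (htop ▸ Submodule.mem_top (x := p))
  have h1 : Hel m c • q = ((k : ℂ) + 1 - N) • q := by
    rw [smul_add, smul_add, Hel_smul hN hp'] at hp
    exact add_left_cancel hp
  have h2 : ⨆ j, ⨆ (_ : j ≠ k), degreePart c τ j ≤ LinearMap.ker (B.form q) :=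
    iSup₂_le fun j hj x hx => by
      refine orthogonal B.adj_Hel h1 (Hel_smul hN hx) fun h => hj ?_
      have : (k : ℂ) = j := by linear_combination h
      exact_mod_cast this.symm
  rw [B.eq_zero_of_form (h2 hq), add_zero]
  exact hp'

/-- `E₊` is injective on homogeneous elements. -/
theorem eq_zero_of_Eminus_Eplus (hN1 : N < 1) {k : ℕ} {p : StdMod c τ}
    (hp : p ∈ degreePart c τ k) (h : Eminus m c • Eplus m c • p = 0) : p = 0 := by
  by_contra h0
  have e1 : Eminus m c • Eplus m c • p = Eplus m c • Eminus m c • p - ((k : ℂ) + 1 - N) • p := by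
    rw [← Hel_smul hN hp, Hel_eq, sub_smul, mul_smul, mul_smul]; abel
  -- Pairing E₋E₊p = 0 with p yields |E₋p|² = −(k + 1 − N)|p|², where the left side is non-negative
  -- and the right side is negative unless p = 0.
  have e2 : B.form (Eminus m c • p) (Eminus m c • p) =
      -(((k + 1 - N : ℝ) : ℂ) * B.form p p) := by
    rw [B.adj_Eminus, neg_smul, map_neg, sub_eq_zero.mp (e1.symm.trans h), map_smul, smul_eq_mul]
    push_cast
    ring
  have e3 := congrArg Complex.re e2
  rw [Complex.neg_re, Complex.re_ofReal_mul] at e3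
  have h1 := B.nonneg (Eminus m c • p)
  have h2 : 0 < (k + 1 - N : ℝ) * (B.form p p).re :=
    mul_pos (by have : (0 : ℝ) ≤ k := k.cast_nonneg; linarith) (B.pos p h0)
  linarith

theorem lowerPart_eq_zero (hN1 : N < 1) {k : ℕ} {p : StdMod c τ}
    (hp : p ∈ lowerPart c τ k) (h : Eminus m c • Eplus m c • p = 0) : p = 0 := by
  rcases k with _ | _ | k
  · exact hp
  · exact hp
  · exact B.eq_zero_of_Eminus_Eplus hN hN1 hp h

/-- Every homogeneous element is the sum of a harmonic one and a multiple of `E₊`. -/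
theorem exists_harm [FiniteDimensional ℂ V] (hN1 : N < 1) {k : ℕ} {p : StdMod c τ}
    (hp : p ∈ degreePart c τ k) :
    ∃ h ∈ harm c τ k, ∃ q ∈ lowerPart c τ k, p = h + Eplus m c • q := by
  rcases k with _ | _ | k
  · exact ⟨p, ⟨hp, Eminus_smul_zero hp⟩, 0, zero_mem _, by rw [smul_zero, add_zero]⟩
  · exact ⟨p, ⟨hp, Eminus_smul_one hp⟩, 0, zero_mem _, by rw [smul_zero, add_zero]⟩
  -- The correction q must solve E₋E₊q = E₋p. This endomorphism of a finite-dimensional space is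
  -- injective, hence surjective.
  · have hmaps : ∀ x ∈ degreePart c τ k, op (Eminus m c * Eplus m c) x ∈ degreePart c τ k :=
      fun x hx => by
        rw [op_apply, mul_smul]; exact Eminus_smul_mem (Eplus_smul_mem hx)
    let T := (op (τ := τ) (Eminus m c * Eplus m c)).restrict hmaps
    have hT : Function.Injective T := by
      rw [injective_iff_map_eq_zero]
      rintro ⟨x, hx⟩ h
      have h' : (Eminus m c * Eplus m c) • x = 0 := congrArg Subtype.val h
      rw [mul_smul] at h'
      exact Subtype.ext (B.eq_zero_of_Eminus_Eplus hN hN1 hx h')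
    obtain ⟨⟨q, hq⟩, hqT⟩ := LinearMap.injective_iff_surjective.mp hT
      ⟨Eminus m c • p, Eminus_smul_mem hp⟩
    have h' : (Eminus m c * Eplus m c) • q = Eminus m c • p := congrArg Subtype.val hqT
    refine ⟨p - Eplus m c • q, ⟨sub_mem hp (Eplus_smul_mem hq), ?_⟩, q, hq, by abel⟩
    show Eminus m c • (p - Eplus m c • q) = 0
    rw [smul_sub, ← mul_smul, h', sub_self]

theorem harm_unique (hN1 : N < 1) {k : ℕ} {h h' q q' : StdMod c τ} (hh : h ∈ harm c τ k)
    (hh' : h' ∈ harm c τ k) (hq : q ∈ lowerPart c τ k) (hq' : q' ∈ lowerPart c τ k)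
    (e : h + Eplus m c • q = h' + Eplus m c • q') : h = h' := by
  have e1 : Eplus m c • (q - q') = h' - h := by
    rw [smul_sub]; linear_combination (norm := abel) e
  have e2 : q - q' = 0 := by
    refine B.lowerPart_eq_zero hN hN1 (sub_mem hq hq') ?_
    rw [e1, smul_sub, (mem_harm.mp hh).2, (mem_harm.mp hh').2, sub_self]
  rw [e2, smul_zero] at e1
  exact (sub_eq_zero.mp e1.symm).symm

/-- Harmonics meet the image of E₊ trivially, while that image and the pure powers of z and z̄ span
the whole degree. So the dimension of the harmonics is at most that of the space of pure powers. -/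
theorem finrank_harm_le [FiniteDimensional ℂ V] (hN1 : N < 1) (k : ℕ) :
    Module.finrank ℂ (harm c τ k) ≤ 2 * Module.finrank ℂ V := by
  set L := (lowerPart c τ k).map (op (Eplus m c)) with hL
  have hLle : L ≤ degreePart c τ k := by
    rintro _ ⟨q, hq, rfl⟩; exact Eplus_smul_lowerPart hq
  have hHle : harm c τ k ≤ degreePart c τ k := inf_le_left
  have : FiniteDimensional ℂ L := Submodule.finiteDimensional_of_le hLle
  have : FiniteDimensional ℂ (harm c τ k) := Submodule.finiteDimensional_of_le hHle
  have h1 : harm c τ k ⊓ L = ⊥ := by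
    rw [eq_bot_iff]
    rintro _ ⟨hx, ⟨q, hq, rfl⟩⟩
    have : q = 0 := B.lowerPart_eq_zero hN hN1 hq hx.2
    rw [this, map_zero]; exact zero_mem _
  have h2 := Submodule.finrank_sup_add_finrank_inf_eq (harm c τ k) L
  rw [h1, finrank_bot, add_zero] at h2
  have h3 := Submodule.finrank_mono (sup_le hHle hLle)
  have h4 := (Submodule.finrank_mono (degreePart_le_sup (c := c) (τ := τ) k)).trans
    (Submodule.finrank_add_le_finrank_add_finrank _ _)
  rw [← hL] at h4
  have h5 : Module.finrank ℂ (LinearMap.range (extremal c τ k)) ≤ 2 * Module.finrank ℂ V := by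
    refine (LinearMap.finrank_range_le _).trans ?_
    rw [Module.finrank_prod]; omega
  omega

omit B in
/-- The square of `Z₀` on harmonics. -/
theorem Z0_sq_harm {k : ℕ} {h : StdMod c τ} (hh : h ∈ harm c τ k) :
    Z0 m c • Z0 m c • h + sigma m c • sigma m c • h = (((k : ℂ) - N) ^ 2) • h := by
  have e : (Hel m c - 1) • h = ((k : ℂ) - N) • h := by
    rw [sub_smul, one_smul, Hel_smul hN hh.1]; module
  rw [← mul_smul, ← mul_smul, ← add_smul, casimir, add_smul, smul_assoc, mul_smul (Eplus m c),
    (mem_harm.mp hh).2, smul_zero, smul_zero, add_zero, mul_smul, e,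
    smul_comm (Hel m c - 1) ((k : ℂ) - N) h, e, smul_smul, sq]

end UForm

end forms

attribute [local instance 100] LieRing.ofAssociativeRing

/-! ### Irreducibility of lowest weight modules -/

section lowestWeight

theorem gl2Hom_apply {L : Type*} [LieRing L] [LieAlgebra ℂ L] (h p q z : L)
    (hp : ⁅h, p⁆ = (2 : ℂ) • p) (hq : ⁅h, q⁆ = -((2 : ℂ) • q)) (pq : ⁅p, q⁆ = h)
    (zh : ⁅z, h⁆ = 0) (zp : ⁅z, p⁆ = 0) (zq : ⁅z, q⁆ = 0) (A : Gl2) :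
    gl2Hom h p q z hp hq pq zh zp zq A =
      ((A 0 0 - A 1 1) / 2) • h + A 0 1 • p + A 1 0 • q + ((A 0 0 + A 1 1) / 2) • z := rfl

theorem lowestWeightRep_apply (μ ν : ℝ) (A : Gl2) : lowestWeightRep μ ν A =
    ((A 0 0 - A 1 1) / 2) • lwH μ + A 0 1 • lwP + A 1 0 • lwM μ +
      ((A 0 0 + A 1 1) / 2) • ((ν : ℂ) • (1 : Module.End ℂ (ℕ →₀ ℂ))) := gl2Hom_apply ..

theorem lwH_single (μ : ℝ) (n : ℕ) (a : ℂ) :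
    lwH μ (Finsupp.single n a) = Finsupp.single n (a * ((μ : ℂ) + 2 * n)) := by
  rw [lwH, Finsupp.linearCombination_single, Finsupp.smul_single, smul_eq_mul]

theorem lwP_single (n : ℕ) (a : ℂ) :
    lwP (Finsupp.single n a) = Finsupp.single (n + 1) a := by
  rw [lwP, Finsupp.linearCombination_single, Finsupp.smul_single, smul_eq_mul, mul_one]

theorem lwM_single (μ : ℝ) (n : ℕ) (a : ℂ) :
    lwM μ (Finsupp.single n a) = Finsupp.single (n - 1) (a * (-(n * ((μ : ℂ) + n - 1)))) := by
  rw [lwM, Finsupp.linearCombination_single, Finsupp.smul_single, smul_eq_mul]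

theorem lwM_apply (μ : ℝ) (f : ℕ →₀ ℂ) (n : ℕ) :
    lwM μ f n = -((n + 1 : ℂ) * ((μ : ℂ) + n)) * f (n + 1) := by
  induction f using Finsupp.induction_linear with
  | zero => simp
  | add f g hf hg => rw [map_add, Finsupp.add_apply, hf, hg, Finsupp.add_apply]; ring
  | single k a =>
    rw [lwM_single, Finsupp.single_apply, Finsupp.single_apply]
    rcases k with _ | k
    · simp
    · simp only [Nat.add_sub_cancel, Nat.add_right_cancel_iff]
      split_ifs with h
      · subst h; push_cast; ring
      · simp

/-- For μ > 0 the coefficients (n + 1)(μ + n) of E₋ never vanish, so E₋ lowers the top index of any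
nonzero vector until a multiple of v₀ is reached; E₊ then produces every v_n. -/
theorem isIrreducibleLowestWeight {μ ν : ℝ} (hμ : 0 < μ) :
    IsIrreducibleLowestWeight (lowestWeightRep μ ν) μ ν := by
  refine ⟨⟨Finsupp.single 0 1, by simp, ?_, ?_, ?_⟩, fun U hU => ?_⟩
  · simp [lowestWeightRep_apply, lwM_single]
  · simp [lowestWeightRep_apply, lwH_single]
  · simp [lowestWeightRep_apply]
  · by_cases hbot : U = ⊥
    · exact Or.inl hbot
    refine Or.inr ?_
    have hM : ∀ f ∈ U, lwM μ f ∈ U := fun f hf => by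
      simpa [lowestWeightRep_apply] using hU !![0, 0; 1, 0] f hf
    have hP : ∀ f ∈ U, lwP f ∈ U := fun f hf => by
      simpa [lowestWeightRep_apply] using hU !![0, 1; 0, 0] f hf
    have key : ∀ n : ℕ, ∀ f ∈ U, f n ≠ 0 → (∀ k, n < k → f k = 0) → Finsupp.single 0 1 ∈ U := by
      intro n
      induction n with
      | zero =>
        intro f hf h0 hk
        have : f = f 0 • Finsupp.single 0 1 := by
          ext k
          rcases k with _ | k
          · simp
          · simp [hk (k + 1) (by omega)]
        rw [this] at hf
        exact (Submodule.smul_mem_iff _ h0).mp hf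
      | succ n ih =>
        intro f hf h0 hk
        refine ih _ (hM f hf) ?_ fun k hnk => ?_
        · rw [lwM_apply]
          refine mul_ne_zero (neg_ne_zero.mpr (mul_ne_zero (Nat.cast_add_one_ne_zero n) ?_)) h0
          have : (0 : ℝ) < μ + n := by positivity
          exact_mod_cast this.ne'
        · rw [lwM_apply, hk _ (by omega), mul_zero]
    obtain ⟨f, hf, hf0⟩ := (Submodule.ne_bot_iff U).mp hbot
    have hne : f.support.Nonempty := Finsupp.support_nonempty_iff.mpr hf0
    have h0 : Finsupp.single 0 1 ∈ U := key (f.support.max' hne) f hf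
      (Finsupp.mem_support_iff.mp (f.support.max'_mem hne)) fun k hk => by
        by_contra h
        exact absurd (f.support.le_max' k (Finsupp.mem_support_iff.mpr h)) (by omega)
    have hn : ∀ n, Finsupp.single n (1 : ℂ) ∈ U := fun n => by
      induction n with
      | zero => exact h0
      | succ n ih => have := hP _ ih; rwa [lwP_single] at this
    rw [eq_top_iff]
    rintro f -
    induction f using Finsupp.induction_linear with
    | zero => exact zero_mem _
    | add f g hf hg => exact add_mem hf hg
    | single n a =>
      rw [← mul_one a, ← smul_eq_mul, ← Finsupp.smul_single]
      exact Submodule.smul_mem _ _ (hn n)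

end lowestWeight

/-! ### Joint decompositions -/

section joint

variable {m : ℕ} [NeZero m] {c : ZMod m → ℝ}

theorem u11_apply (ε : ℝ) (A : Gl2) : u11 m c ε A =
    ((A 0 0 - A 1 1) / 2) • Hel m c + A 0 1 • Eplus m c + A 1 0 • Eminus m c +
      ((A 0 0 + A 1 1) / 2) • Ztilde m c ε := gl2Hom_apply ..

/-! ### Elements commuting with 𝔲(1,1) -/

section cent

variable {ε : ℝ} (a : Cent m c ε)

theorem cent_u11 (A : Gl2) : Commute (u11 m c ε A) (a : RCA m c) :=
  Subalgebra.mem_centralizer_iff ℂ |>.mp a.2 _ ⟨A, rfl⟩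

theorem cent_Hel : Commute (Hel m c) (a : RCA m c) := by
  simpa [u11_apply] using cent_u11 a !![1, 0; 0, -1]

theorem cent_Eplus : Commute (Eplus m c) (a : RCA m c) := by
  simpa [u11_apply] using cent_u11 a !![0, 1; 0, 0]

theorem cent_Eminus : Commute (Eminus m c) (a : RCA m c) := by
  simpa [u11_apply] using cent_u11 a !![0, 0; 1, 0]

theorem cent_Ztilde : Commute (Ztilde m c ε) (a : RCA m c) := by
  simpa [u11_apply] using cent_u11 a 1

end cent

variable {V : Type*} [AddCommGroup V] [Module ℂ V] {τ : Representation ℂ (DihedralGroup m) V}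

theorem Hel_smul_pow {μ : ℂ} {h : StdMod c τ} (hH : Hel m c • h = μ • h) (n : ℕ) :
    Hel m c • Eplus m c ^ n • h = (μ + 2 * n) • Eplus m c ^ n • h := by
  induction n with
  | zero => simpa using hH
  | succ n ih =>
    have e : Hel m c * Eplus m c = Eplus m c * Hel m c + (2 : ℂ) • Eplus m c := by
      have := Hel_Eplus (m := m) (c := c)
      rw [Ring.lie_def, sub_eq_iff_eq_add'] at this
      exact this
    rw [pow_succ', mul_smul, ← mul_smul (Hel m c), e, add_smul, mul_smul, ih,
      smul_comm (Eplus m c) (μ + 2 * n), smul_assoc]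
    generalize Eplus m c • Eplus m c ^ n • h = y
    push_cast
    module

theorem Eminus_smul_pow {μ : ℂ} {h : StdMod c τ} (hH : Hel m c • h = μ • h)
    (hE : Eminus m c • h = 0) (n : ℕ) :
    Eminus m c • Eplus m c ^ (n + 1) • h = -(((n : ℂ) + 1) * (μ + n)) • Eplus m c ^ n • h := by
  have e (y : StdMod c τ) :
      Eminus m c • Eplus m c • y = Eplus m c • Eminus m c • y - Hel m c • y := by
    rw [Hel_eq, sub_smul, mul_smul, mul_smul]; abel
  induction n with
  | zero =>
    rw [zero_add, pow_one, pow_zero, one_smul, e, hE, smul_zero, hH]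
    push_cast
    module
  | succ n ih =>
    rw [pow_succ', mul_smul, e, ih, Hel_smul_pow hH,
      smul_comm (Eplus m c) (-(((n : ℂ) + 1) * (μ + n))), ← mul_smul (Eplus m c), ← pow_succ']
    generalize Eplus m c ^ (n + 1) • h = y
    push_cast
    module

namespace UForm

variable (B : UForm c τ)

/-- Each E₊ moves to the other side of the form as −E₋ and uses up one power there. With unequal
powers, E₋ finally hits a lowest weight vector. -/
theorem form_pow_ne {μ' : ℂ} {s s' : StdMod c τ} (hs' : Hel m c • s' = μ' • s')
    (hE : Eminus m c • s = 0) (hE' : Eminus m c • s' = 0) {n n' : ℕ}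
    (hn : n ≠ n') : B.form (Eplus m c ^ n • s) (Eplus m c ^ n' • s') = 0 := by
  induction n generalizing n' with
  | zero =>
    obtain ⟨k, rfl⟩ : ∃ k, n' = k + 1 := ⟨n' - 1, by omega⟩
    refine B.form_symm_zero ?_
    rw [pow_succ', mul_smul, B.adj_Eplus, pow_zero, one_smul, neg_smul, hE, neg_zero, map_zero]
  | succ n ih =>
    rcases n' with _ | n'
    · rw [pow_succ', mul_smul, B.adj_Eplus, pow_zero, one_smul, neg_smul, hE', neg_zero, map_zero]
    · rw [pow_succ', mul_smul, B.adj_Eplus, neg_smul, Eminus_smul_pow hs' hE', map_neg, map_smul,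
        ih (by omega), smul_zero, neg_zero]

/-- The constant is the product of the factors (j + 1)(μ + j) for j < n. It does not depend on the
two vectors, so E₊ⁿ preserves the form on lowest weight vectors up to a nonzero scalar. -/
theorem form_pow_eq {μ : ℝ} (hμ : 0 < μ) (n : ℕ) :
    ∃ C : ℂ, C ≠ 0 ∧ ∀ s s' : StdMod c τ, Hel m c • s' = (μ : ℂ) • s' → Eminus m c • s' = 0 →
      B.form (Eplus m c ^ n • s) (Eplus m c ^ n • s') = C * B.form s s' := by
  induction n with
  | zero => exact ⟨1, one_ne_zero, by simp⟩
  | succ n ih =>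
    obtain ⟨C, hC, e⟩ := ih
    refine ⟨((n : ℂ) + 1) * (μ + n) * C, mul_ne_zero (mul_ne_zero (Nat.cast_add_one_ne_zero n) ?_)
      hC, fun s s' hs' hE' => ?_⟩
    · have : (0 : ℝ) < μ + n := by positivity
      exact_mod_cast this.ne'
    · have hp : Eplus m c ^ (n + 1) • s = Eplus m c • Eplus m c ^ n • s := by
        rw [pow_succ', mul_smul]
      rw [hp, B.adj_Eplus, neg_smul, Eminus_smul_pow hs' hE', map_neg, map_smul, e s s' hs' hE',
        smul_eq_mul]
      ring

variable {ε : ℝ}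

variable {N : ℝ} (hN : ∀ v, sigma m c • incl c τ v = (N : ℂ) • incl c τ v)

/-- The space of harmonics as a module over the centraliser. -/
def harmSub (ε : ℝ) (k : ℕ) (lam : ℝ) : Submodule (Cent m c ε) (StdMod c τ) where
  carrier := harmonics c τ ε k lam
  add_mem' := add_mem
  zero_mem' := zero_mem _
  smul_mem' := by
    intro a x hx
    rw [SetLike.mem_coe, mem_harmonics, mem_harm] at hx ⊢
    obtain ⟨⟨h1, h2⟩, h3⟩ := hx
    rw [Subalgebra.smul_def]
    -- The centraliser is not visibly homogeneous, but it commutes with H, and the H-eigenvalue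
    -- determines the degree.
    refine ⟨⟨B.mem_degreePart_of_Hel hN ?_, ?_⟩, ?_⟩
    · rw [← mul_smul, (cent_Hel a).eq, mul_smul, Hel_smul hN h1, smul_comm]
    · rw [← mul_smul, (cent_Eminus a).eq, mul_smul, h2, smul_zero]
    · rw [← mul_smul, (cent_Ztilde a).eq, mul_smul, h3, smul_comm]

theorem mem_harmSub {ε : ℝ} {k : ℕ} {lam : ℝ} {x : StdMod c τ} :
    x ∈ B.harmSub hN ε k lam ↔ x ∈ harm c τ k ∧ Ztilde m c ε • x = (lam : ℂ) • x :=
  mem_harmonics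

/-! ### Raising harmonics by powers of E₊ -/

section decomposition

/-- The map `s ⊗ v_n ↦ E₊ ^ n s`. -/
def raise {ε : ℝ} (S : Submodule (Cent m c ε) (StdMod c τ)) : S ⊗[ℂ] (ℕ →₀ ℂ) →ₗ[ℂ] StdMod c τ :=
  TensorProduct.lift (Finsupp.linearCombination ℂ
    fun n : ℕ => op (Eplus m c ^ n) ∘ₗ S.subtype.restrictScalars ℂ).flip

theorem raise_single {ε : ℝ} (S : Submodule (Cent m c ε) (StdMod c τ)) (s : S) (n : ℕ) (a : ℂ) :
    raise S (s ⊗ₜ Finsupp.single n a) = a • Eplus m c ^ n • (s : StdMod c τ) := by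
  simp only [raise, TensorProduct.lift.tmul, LinearMap.flip_apply,
    Finsupp.linearCombination_single, LinearMap.smul_apply, LinearMap.comp_apply, op_apply]
  rfl

theorem raise_rep {ε : ℝ} (S : Submodule (Cent m c ε) (StdMod c τ)) {μ ν : ℝ}
    (hH : ∀ s ∈ S, Hel m c • s = (μ : ℂ) • s) (hE : ∀ s ∈ S, Eminus m c • s = 0)
    (hZ : ∀ s ∈ S, Ztilde m c ε • s = (ν : ℂ) • s) (A : Gl2) (s : S) (l : ℕ →₀ ℂ) :
    raise S (s ⊗ₜ lowestWeightRep μ ν A l) = u11 m c ε A • raise S (s ⊗ₜ l) := by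
  induction l using Finsupp.induction_linear with
  | zero => rw [map_zero, TensorProduct.tmul_zero, map_zero, smul_zero]
  | add f g hf hg =>
    rw [map_add, TensorProduct.tmul_add, map_add, hf, hg, TensorProduct.tmul_add, map_add, smul_add]
  | single n a =>
    have hcomm : Commute (Ztilde m c ε) (Eplus m c ^ n) :=
      Commute.pow_right (sub_eq_zero.mp (Ztilde_Eplus ε)) n
    rw [lowestWeightRep_apply, u11_apply]
    simp only [LinearMap.add_apply, LinearMap.smul_apply, lwH_single, lwP_single, lwM_single,
      Module.End.one_apply, TensorProduct.tmul_add, TensorProduct.tmul_smul, map_add, map_smul,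
      raise_single, add_smul, smul_assoc]
    rw [smul_comm (Hel m c) a, smul_comm (Eplus m c) a, smul_comm (Eminus m c) a,
      smul_comm (Ztilde m c ε) a, Hel_smul_pow (hH s s.2), ← mul_smul (Eplus m c), ← pow_succ',
      ← mul_smul (Ztilde m c ε), hcomm.eq, mul_smul (Eplus m c ^ n), hZ s s.2,
      smul_comm (Eplus m c ^ n) (ν : ℂ)]
    rcases n with _ | n
    · rw [pow_zero, one_smul, hE s s.2]
      generalize Eplus m c ^ (0 + 1) • (s : StdMod c τ) = y
      generalize (s : StdMod c τ) = y'
      push_cast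
      module
    · rw [Eminus_smul_pow (hH s s.2) (hE s s.2), Nat.add_sub_cancel]
      generalize Eplus m c ^ (n + 1) • (s : StdMod c τ) = y
      generalize Eplus m c ^ n • (s : StdMod c τ) = y'
      generalize Eplus m c ^ (n + 1 + 1) • (s : StdMod c τ) = y''
      push_cast
      module

theorem raise_cent {ε : ℝ} (S : Submodule (Cent m c ε) (StdMod c τ)) (a : Cent m c ε) (s : S)
    (l : ℕ →₀ ℂ) : raise S ((a • s) ⊗ₜ l) = a • raise S (s ⊗ₜ l) := by
  induction l using Finsupp.induction_linear with
  | zero => rw [TensorProduct.tmul_zero, map_zero, TensorProduct.tmul_zero, map_zero, smul_zero]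
  | add f g hf hg =>
    rw [TensorProduct.tmul_add, map_add, hf, hg, TensorProduct.tmul_add, map_add, smul_add]
  | single n b =>
    rw [raise_single, raise_single, Submodule.coe_smul, Subalgebra.smul_def, Subalgebra.smul_def,
      smul_comm (a : RCA m c) b, ← mul_smul, ((cent_Eplus a).pow_left n).eq, mul_smul]

/-- Pairing with E₊ⁿs sees only the component along v_n, which `finsuppScalarRight` extracts. -/
theorem form_raise_same (S : Submodule (Cent m c ε) (StdMod c τ)) {μ : ℝ} (hμ : 0 < μ)
    (hH : ∀ s ∈ S, Hel m c • s = (μ : ℂ) • s) (hE : ∀ s ∈ S, Eminus m c • s = 0) (n : ℕ) :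
    ∃ C : ℂ, C ≠ 0 ∧ ∀ (s : S) (t : S ⊗[ℂ] (ℕ →₀ ℂ)),
      B.form (Eplus m c ^ n • (s : StdMod c τ)) (raise S t) =
        C * B.form s (TensorProduct.finsuppScalarRight ℂ ℂ S ℕ t n : S) := by
  obtain ⟨C, hC, e⟩ := B.form_pow_eq hμ n
  refine ⟨C, hC, fun s t => ?_⟩
  induction t with
  | zero => rw [map_zero, map_zero, map_zero, Finsupp.zero_apply, Submodule.coe_zero, map_zero,
      mul_zero]
  | add x y hx hy =>
    rw [map_add, map_add, hx, hy, map_add, Finsupp.add_apply, Submodule.coe_add, map_add, mul_add]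
  | tmul s' l =>
    rw [TensorProduct.finsuppScalarRight_apply_tmul_apply]
    induction l using Finsupp.induction_linear with
    | zero => rw [TensorProduct.tmul_zero, map_zero, map_zero, Finsupp.zero_apply, zero_smul,
        Submodule.coe_zero, map_zero, mul_zero]
    | add f g hf hg =>
      rw [TensorProduct.tmul_add, map_add, map_add, hf, hg, Finsupp.add_apply, add_smul,
        Submodule.coe_add, map_add, mul_add]
    | single n' a =>
      rw [raise_single, map_smul, Finsupp.single_apply]
      split_ifs with h
      · subst h
        rw [e _ _ (hH _ s'.2) (hE _ s'.2)]
        change _ = C * B.form s (a • (s' : StdMod c τ))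
        rw [map_smul, smul_eq_mul, smul_eq_mul]; ring
      · rw [B.form_pow_ne (hH _ s'.2) (hE _ s.2) (hE _ s'.2) (Ne.symm h), smul_zero, zero_smul,
          Submodule.coe_zero, map_zero, mul_zero]

theorem form_raise_of_orthogonal (S : Submodule (Cent m c ε) (StdMod c τ)) {μ : ℝ} (hμ : 0 < μ)
    (hH : ∀ s ∈ S, Hel m c • s = (μ : ℂ) • s) (hE : ∀ s ∈ S, Eminus m c • s = 0) (n : ℕ)
    {s : StdMod c τ} (hs : Eminus m c • s = 0) (h : ∀ s' ∈ S, B.form s s' = 0)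
    (t : S ⊗[ℂ] (ℕ →₀ ℂ)) : B.form (Eplus m c ^ n • s) (raise S t) = 0 := by
  induction t with
  | zero => rw [map_zero, map_zero]
  | add x y hx hy => rw [map_add, map_add, hx, hy, add_zero]
  | tmul s' l =>
    induction l using Finsupp.induction_linear with
    | zero => rw [TensorProduct.tmul_zero, map_zero, map_zero]
    | add f g hf hg => rw [TensorProduct.tmul_add, map_add, map_add, hf, hg, add_zero]
    | single n' a =>
      rw [raise_single, map_smul]
      by_cases hn : n = n'
      · subst hn
        obtain ⟨C', -, e'⟩ := B.form_pow_eq hμ n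
        rw [e' _ _ (hH _ s'.2) (hE _ s'.2), h _ s'.2, mul_zero, smul_zero]
      · rw [B.form_pow_ne (hH _ s'.2) hs (hE _ s'.2) hn, smul_zero]

/-- Pairing with E₊ⁿs for s in one summand isolates the v_n-component in that summand, so the form
recovers every coordinate of an element from its image. -/
theorem raise_injective {I : Type} [DecidableEq I] (S : I → Submodule (Cent m c ε) (StdMod c τ))
    {μ : I → ℝ} (hμ : ∀ i, 0 < μ i) (hH : ∀ i, ∀ s ∈ S i, Hel m c • s = (μ i : ℂ) • s)
    (hE : ∀ i, ∀ s ∈ S i, Eminus m c • s = 0)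
    (horth : ∀ i j, i ≠ j → ∀ s ∈ S i, ∀ s' ∈ S j, B.form s s' = 0) :
    Function.Injective (DirectSum.toModule ℂ I (StdMod c τ) fun i => raise (S i)) := by
  have key (x : ⨁ i, S i ⊗[ℂ] (ℕ →₀ ℂ)) (i : I) (n : ℕ) (s : S i) :
      B.form (Eplus m c ^ n • (s : StdMod c τ))
        (DirectSum.toModule ℂ I (StdMod c τ) (fun i => raise (S i)) x) =
      B.form (Eplus m c ^ n • (s : StdMod c τ)) (raise (S i) (x i)) := by
    induction x using DirectSum.induction_on with
    | zero => rw [map_zero, DirectSum.zero_apply, map_zero, map_zero, map_zero]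
    | add x y hx hy => rw [map_add, map_add, hx, hy, DirectSum.add_apply, map_add, map_add]
    | of j t =>
      rw [← DirectSum.lof_eq_of ℂ, DirectSum.toModule_lof]
      by_cases hij : j = i
      · subst hij
        rw [DirectSum.lof_apply]
      · rw [DirectSum.lof_eq_of, DirectSum.of_eq_of_ne _ _ _ (Ne.symm hij), map_zero, map_zero]
        exact B.form_raise_of_orthogonal (S j) (hμ j) (hH j) (hE j) n (hE i _ s.2)
          (fun s' hs' => horth i j (Ne.symm hij) _ s.2 s' hs') t
  intro x y hxy
  refine DFinsupp.ext fun i => ?_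
  refine (TensorProduct.finsuppScalarRight ℂ ℂ (S i) ℕ).injective ?_
  ext1 n
  obtain ⟨C, hC, e⟩ := B.form_raise_same (S i) (hμ i) (hH i) (hE i) n
  -- The test vector is the difference of the two coordinates itself; it turns out to be orthogonal
  -- to itself.
  obtain ⟨d, hd⟩ : ∃ d : S i, d = TensorProduct.finsuppScalarRight ℂ ℂ (S i) ℕ (x i) n -
    TensorProduct.finsuppScalarRight ℂ ℂ (S i) ℕ (y i) n := ⟨_, rfl⟩
  have h1 := key x i n d
  rw [hxy, key y i n d, e, e] at h1
  have h2 : B.form d d = 0 := by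
    have h := congrArg (fun s : S i => B.form d (s : StdMod c τ)) hd
    simp only [Submodule.coe_sub, map_sub] at h
    rw [h, mul_left_cancel₀ hC h1, sub_self]
  have h3 : d = 0 := Subtype.ext (B.eq_zero_of_form h2)
  exact sub_eq_zero.mp (hd.symm.trans h3)

/-- A decomposition of the harmonics into eigenspaces yields a joint decomposition. -/
theorem isJointDecomposition [FiniteDimensional ℂ V] (hN1 : N < 1) {ε : ℝ} {I : Type}
    (deg : I → ℕ) (lam : I → ℝ) (hinj : ∀ i j, deg i = deg j → lam i = lam j → i = j)
    (hspan : ∀ k, harm c τ k ≤ ⨆ i, harmonics c τ ε (deg i) (lam i)) :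
    IsJointDecomposition c τ ε N deg lam fun i => B.harmSub hN ε (deg i) (lam i) := by
  classical
  set Φ := DirectSum.toModule ℂ I (StdMod c τ) fun i => raise (B.harmSub hN ε (deg i) (lam i))
    with hΦ
  have hΦof (i : I) (t : B.harmSub hN ε (deg i) (lam i) ⊗[ℂ] (ℕ →₀ ℂ)) :
      Φ (DirectSum.of _ i t) = raise _ t := by
    rw [hΦ, ← DirectSum.lof_eq_of ℂ, DirectSum.toModule_lof]
  have hμ (i : I) : 0 < (deg i + 1 - N : ℝ) := by
    have : (0 : ℝ) ≤ deg i := (deg i).cast_nonneg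
    linarith
  have hH (i : I) : ∀ s ∈ B.harmSub hN ε (deg i) (lam i),
      Hel m c • s = ((deg i + 1 - N : ℝ) : ℂ) • s := fun s hs => by
    rw [Hel_smul hN ((B.mem_harmSub hN).mp hs).1.1]; push_cast; rfl
  have hEm (i : I) : ∀ s ∈ B.harmSub hN ε (deg i) (lam i), Eminus m c • s = 0 :=
    fun s hs => ((B.mem_harmSub hN).mp hs).1.2
  have hZ (i : I) : ∀ s ∈ B.harmSub hN ε (deg i) (lam i),
      Ztilde m c ε • s = (lam i : ℂ) • s := fun s hs => ((B.mem_harmSub hN).mp hs).2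
  have hinjΦ : Function.Injective Φ := by
    -- Different summands are orthogonal because they differ either in the eigenvalue of Z̃ or, in
    -- different degrees, in that of H. Both elements are self-adjoint.
    refine B.raise_injective _ hμ hH hEm fun i j hij s hs s' hs' => ?_
    by_cases hd : deg i = deg j
    · exact orthogonal (B.adj_Ztilde ε) (hZ i s hs) (hZ j s' hs') fun h =>
        hij (hinj i j hd (by exact_mod_cast h))
    · refine orthogonal B.adj_Hel (hH i s hs) (hH j s' hs') fun h => hd ?_
      have : (deg i + 1 - N : ℝ) = deg j + 1 - N := by exact_mod_cast h
      have : (deg i : ℝ) = deg j := by linarith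
      exact_mod_cast this
  have hharm (k : ℕ) : harm c τ k ≤ LinearMap.range Φ := by
    refine (hspan k).trans (iSup_le fun i x hx => ?_)
    refine ⟨DirectSum.of _ i ((⟨x, hx⟩ : B.harmSub hN ε (deg i) (lam i)) ⊗ₜ Finsupp.single 0 1), ?_⟩
    rw [hΦof, raise_single, one_smul, pow_zero, one_smul]
  have hE (x : StdMod c τ) (hx : x ∈ LinearMap.range Φ) : Eplus m c • x ∈ LinearMap.range Φ := by
    obtain ⟨y, rfl⟩ := hx
    induction y using DirectSum.induction_on with
    | zero => rw [map_zero, smul_zero]; exact zero_mem _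
    | add x y hx hy => rw [map_add, smul_add]; exact add_mem hx hy
    | of i t =>
      induction t with
      | zero => rw [map_zero, map_zero, smul_zero]; exact zero_mem _
      | add x y hx hy => rw [map_add, map_add, smul_add]; exact add_mem hx hy
      | tmul s l =>
        induction l using Finsupp.induction_linear with
        | zero => rw [TensorProduct.tmul_zero, map_zero, map_zero, smul_zero]; exact zero_mem _
        | add f g hf hg =>
          rw [TensorProduct.tmul_add, map_add, map_add, smul_add]; exact add_mem hf hg
        | single n a =>
          refine ⟨DirectSum.of _ i (s ⊗ₜ Finsupp.single (n + 1) a), ?_⟩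
          rw [hΦof, hΦof, raise_single, raise_single, smul_comm (Eplus m c) a, ← mul_smul,
            ← pow_succ']
  -- Strong induction on the degree: a homogeneous element is a harmonic plus E₊ of something two
  -- degrees lower, and the range is stable under E₊.
  have hdeg (k : ℕ) : degreePart c τ k ≤ LinearMap.range Φ := by
    induction k using Nat.strong_induction_on with
    | _ k ih =>
      intro p hp
      obtain ⟨h, hh, q, hq, rfl⟩ := B.exists_harm hN hN1 hp
      refine add_mem (hharm k hh) (hE q ?_)
      rcases k with _ | _ | k
      · rw [(Submodule.mem_bot ℂ).mp hq]; exact zero_mem _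
      · rw [(Submodule.mem_bot ℂ).mp hq]; exact zero_mem _
      · exact ih k (by omega) hq
  have hsurj : Function.Surjective Φ := by
    rw [← LinearMap.range_eq_top, eq_top_iff, ← iSup_degreePart]
    exact iSup_le hdeg
  have hbij : Function.Bijective Φ := ⟨hinjΦ, hsurj⟩
  refine ⟨fun i => rfl, fun i => isIrreducibleLowestWeight (hμ i),
    LinearEquiv.ofBijective Φ hbij, fun i s => ?_, fun i a s l => ?_, fun i A s l => ?_⟩
  · refine (hΦof i _).trans ?_
    rw [raise_single, one_smul, pow_zero, one_smul]
  · refine (hΦof i _).trans ((raise_cent _ a s l).trans ?_)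
    exact congrArg (a • ·) (hΦof i _).symm
  · refine (hΦof i _).trans ((raise_rep _ (hH i) (hEm i) (hZ i) A s l).trans ?_)
    exact congrArg (u11 m c ε A • ·) (hΦof i _).symm

end decomposition

end UForm

end joint

/-! ### Blocks of harmonics -/

/-- On the span T has the matrix ((μ, b), (b, −μ)), whose square is the scalar l². Its trace is
zero, so for l ≠ 0 the eigenvalues l and −l are distinct and each is simple. -/
theorem exists_eigenvector_pair {M : Type*} [AddCommGroup M] [Module ℂ M] (T : Module.End ℂ M)
    {w w' : M} (hind : LinearIndependent ℂ ![w, w']) {μ b l : ℂ} (h1 : T w = μ • w + b • w')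
    (h2 : T w' = b • w - μ • w') (hl : l ≠ 0) (hl2 : l ^ 2 = μ ^ 2 + b ^ 2) :
    ∃ v ≠ 0, v ∈ Submodule.span ℂ {w, w'} ∧ T v = l • v ∧
      ∀ x ∈ Submodule.span ℂ {w, w'}, T x = l • x → x ∈ Submodule.span ℂ {v} := by
  rw [LinearIndependent.pair_iff] at hind
  have hcoord (α β : ℂ) (h : T (α • w + β • w') = l • (α • w + β • w')) :
      (μ - l) * α + b * β = 0 ∧ b * α - (μ + l) * β = 0 := by
    refine hind _ _ ?_
    rw [map_add, map_smul, map_smul, h1, h2] at h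
    linear_combination (norm := module) h
  -- The general eigenvector is (l + μ)w + b w′. It degenerates when l = −μ; then b² = l² − μ² = 0
  -- and w′ itself is the eigenvector.
  by_cases hlμ : l + μ = 0
  · have hb : b = 0 := by
      have : b ^ 2 = 0 := by linear_combination (l - μ) * hlμ - hl2
      exact pow_eq_zero_iff two_ne_zero |>.mp this
    have hμ : μ = -l := by linear_combination hlμ
    subst hb hμ
    refine ⟨w', fun h => ?_, Submodule.subset_span (by simp), by rw [h2]; module, fun x hx hT => ?_⟩
    · exact one_ne_zero (hind 0 1 (by rw [h]; simp)).2
    · obtain ⟨α, β, rfl⟩ := Submodule.mem_span_pair.mp hx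
      have hα : α = 0 := by
        have := (hcoord α β hT).1
        have : l * α = 0 := by linear_combination (-1 / 2 : ℂ) * this
        exact (mul_eq_zero.mp this).resolve_left hl
      rw [hα, zero_smul, zero_add]
      exact Submodule.smul_mem _ _ (Submodule.mem_span_singleton_self _)
  · refine ⟨(l + μ) • w + b • w', fun h => hlμ (hind _ _ h).1,
      Submodule.mem_span_pair.mpr ⟨_, _, rfl⟩, ?_, fun x hx hT => ?_⟩
    · rw [map_add, map_smul, map_smul, h1, h2]
      linear_combination (norm := module) -hl2 • w
    · obtain ⟨α, β, rfl⟩ := Submodule.mem_span_pair.mp hx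
      refine Submodule.mem_span_singleton.mpr ⟨α / (l + μ), ?_⟩
      have hβ : β = α / (l + μ) * b := by
        field_simp
        linear_combination -(hcoord α β hT).2
      rw [smul_add, smul_smul, smul_smul, ← hβ, div_mul_cancel₀ _ hlμ]

section weights

variable {m : ℕ} [NeZero m] {c : ZMod m → ℝ}
variable {V : Type*} [AddCommGroup V] [Module ℂ V] {τ : Representation ℂ (DihedralGroup m) V}

variable (c τ) in
/-- The vectors on which the rotations act by the scalars `ζ j`. -/
def weightSpace (ζ : ZMod m → ℂ) : Submodule ℂ (StdMod c τ) where
  carrier := {x | ∀ j, grp m c (.r j) • x = ζ j • x}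
  add_mem' ha hb j := by rw [smul_add, ha j, hb j, smul_add]
  zero_mem' j := by rw [smul_zero, smul_zero]
  smul_mem' a x hx j := by rw [smul_comm, hx j, smul_comm]

theorem grp_sr_eq (j : ZMod m) : grp m c (.sr j) = grp m c (.sr 0) * grp m c (.r j) := by
  rw [grp_mul_grp, DihedralGroup.sr_mul_r, zero_add]

theorem sr_sr_smul (x : StdMod c τ) : grp m c (.sr 0) • grp m c (.sr 0) • x = x := by
  rw [← mul_smul, grp_mul_grp, DihedralGroup.sr_mul_self, grp_one, one_smul]

theorem sr_smul_ne_zero {x : StdMod c τ} (hx : x ≠ 0) : grp m c (.sr 0) • x ≠ 0 := fun h =>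
  hx (by rw [← sr_sr_smul x, h, smul_zero])

theorem sr_smul_weightSpace {ζ : ZMod m → ℂ} {x : StdMod c τ} (hx : x ∈ weightSpace c τ ζ) :
    grp m c (.sr 0) • x ∈ weightSpace c τ fun j => ζ (-j) := fun j => by
  rw [← mul_smul, grp_mul_grp, DihedralGroup.r_mul_sr, zero_sub, grp_sr_eq, mul_smul, hx (-j),
    smul_comm]

theorem Z0_smul_weightSpace {ζ : ZMod m → ℂ} {x : StdMod c τ} (hx : x ∈ weightSpace c τ ζ) :
    Z0 m c • x ∈ weightSpace c τ ζ := fun j => by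
  rw [← mul_smul, r_Z0, mul_smul, hx j, smul_comm]

/-- Every reflection is s₀ composed with a rotation, and rotations act on x by scalars, so σ reduces
to a multiple of s₀. -/
theorem sigma_smul_weight {ζ : ZMod m → ℂ} {t : ℂ} (ht : ∑ j, (c j : ℂ) * ζ j = t)
    {x : StdMod c τ} (hx : x ∈ weightSpace c τ ζ) :
    sigma m c • x = t • grp m c (.sr 0) • x := by
  rw [sigma, Finset.sum_smul, ← ht, Finset.sum_smul]
  refine Finset.sum_congr rfl fun j _ => ?_
  rw [smul_assoc, grp_sr_eq, mul_smul, hx j, smul_comm (grp m c (.sr 0)), smul_smul]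

variable (hc : ∀ i j : ZMod m, IsConj (DihedralGroup.sr i) (DihedralGroup.sr j) → c i = c j)

include hc in
theorem sigma_smul_sr_weight {ζ : ZMod m → ℂ} {t : ℂ} (ht : ∑ j, (c j : ℂ) * ζ j = t)
    {x : StdMod c τ} (hx : x ∈ weightSpace c τ ζ) :
    sigma m c • grp m c (.sr 0) • x = t • x := by
  rw [← mul_smul, ← (commute_grp_sigma hc _).eq, mul_smul, sigma_smul_weight ht hx,
    smul_comm (grp m c (.sr 0)), sr_sr_smul]

theorem Z0_smul_sr {μ : ℂ} {x : StdMod c τ} (hx : Z0 m c • x = μ • x) :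
    Z0 m c • grp m c (.sr 0) • x = -μ • grp m c (.sr 0) • x := by
  have e : Z0 m c * grp m c (.sr 0) = -(grp m c (.sr 0) * Z0 m c) := by rw [sr_Z0, neg_neg]
  rw [← mul_smul, e, neg_smul, mul_smul, hx, smul_comm, neg_smul]

/-- Rotations act on w and s₀w by scalars, s₀ swaps them, and Z₀ has eigenvalues μ and −μ on them.
So the block is stable under G and Z₀, which generate all of `angular`. -/
theorem angular_smul_mem_span {ζ : ZMod m → ℂ} {μ : ℂ} {w : StdMod c τ}
    (hw : w ∈ weightSpace c τ ζ) (hμ : Z0 m c • w = μ • w) {a : RCA m c} (ha : a ∈ angular c)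
    {x : StdMod c τ} (hx : x ∈ Submodule.span ℂ {w, grp m c (.sr 0) • w}) :
    a • x ∈ Submodule.span ℂ {w, grp m c (.sr 0) • w} := by
  set W := Submodule.span ℂ {w, grp m c (.sr 0) • w} with hW
  have h1 : w ∈ W := Submodule.subset_span (by simp)
  have h2 : grp m c (.sr 0) • w ∈ W := Submodule.subset_span (by simp)
  have stable (b : RCA m c) (hb1 : b • w ∈ W) (hb2 : b • grp m c (.sr 0) • w ∈ W)
      (y : StdMod c τ) (hy : y ∈ W) : b • y ∈ W := by
    obtain ⟨α, β, rfl⟩ := Submodule.mem_span_pair.mp hy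
    rw [smul_add, smul_comm b α, smul_comm b β]
    exact add_mem (Submodule.smul_mem _ _ hb1) (Submodule.smul_mem _ _ hb2)
  have hZ : ∀ y ∈ W, Z0 m c • y ∈ W := stable _ (by rw [hμ]; exact Submodule.smul_mem _ _ h1)
    (by rw [Z0_smul_sr hμ]; exact Submodule.smul_mem _ _ h2)
  have hs : ∀ y ∈ W, grp m c (.sr 0) • y ∈ W := stable _ h2 (by rw [sr_sr_smul]; exact h1)
  have hr (j : ZMod m) : ∀ y ∈ W, grp m c (.r j) • y ∈ W :=
    stable _ (by rw [hw j]; exact Submodule.smul_mem _ _ h1)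
      (by rw [sr_smul_weightSpace hw j]; exact Submodule.smul_mem _ _ h2)
  have hg (g : DihedralGroup m) : ∀ y ∈ W, grp m c g • y ∈ W := fun y hy => by
    rcases g with j | j
    · exact hr j y hy
    · rw [grp_sr_eq, mul_smul]; exact hs _ (hr j y hy)
  induction ha using Submodule.span_induction with
  | mem a ha =>
    obtain ⟨l, g, rfl⟩ := ha
    rw [mul_smul]
    induction l with
    | zero => rw [pow_zero, one_smul]; exact hg g x hx
    | succ l ih => rw [pow_succ', mul_smul]; exact hZ _ ih
  | zero => rw [zero_smul]; exact zero_mem _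
  | add a b _ _ ha hb => rw [add_smul]; exact add_mem ha hb
  | smul s a _ ha => rw [smul_assoc]; exact Submodule.smul_mem _ s ha

include hc in
theorem cent_mem_angular {ε : ℝ} (a : Cent m c ε) : (a : RCA m c) ∈ angular c :=
  mem_angular_of_commute hc (cent_Hel a).eq (cent_Eplus a).eq

namespace UForm

variable (B : UForm c τ)

/-- Weight vectors of different weights are orthogonal. -/
theorem orthogonal_weight {n n' : ZMod m} (hn : n ≠ n') {x y : StdMod c τ}
    (hx : x ∈ weightSpace c τ fun j => om (j * n)) (hy : y ∈ weightSpace c τ fun j => om (j * n')) :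
    B.form x y = 0 := by
  by_contra h0
  have h1 := B.grp_adj (.r 1) x (grp m c (.r 1) • y)
  rw [← mul_smul, grp_mul_grp, inv_mul_cancel, grp_one, one_smul, hx 1, hy 1, map_smul,
    map_smulₛₗ, LinearMap.smul_apply, smul_eq_mul, smul_eq_mul, ← mul_assoc] at h1
  simp only [one_mul] at h1
  rw [mul_comm (om n')] at h1
  have h2 : starRingEnd ℂ (om n) * om n' = 1 := mul_right_cancel₀ h0 (h1.trans (one_mul _).symm)
  rw [om, om, ← AddChar.map_neg_eq_conj, ← AddChar.map_add_eq_mul, ← AddChar.map_zero_eq_one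
    (ZMod.stdAddChar (N := m))] at h2
  have := ZMod.injective_stdAddChar h2
  exact hn (by linear_combination -this)

variable {N : ℝ} (hN : ∀ v, sigma m c • incl c τ v = (N : ℂ) • incl c τ v)

include hN hc in
/-- In the block spanned by `w` and `s₀ w`, the eigenvalue `l` of `Z₀ + ε σ` is simple. -/
theorem exists_eigenline {ε : ℝ} {k : ℕ} {ζ : ZMod m → ℂ} {t : ℝ} {μ : ℂ} {w : StdMod c τ}
    (hw : w ∈ harm c τ k) (hw0 : w ≠ 0) (hζ : w ∈ weightSpace c τ ζ) (hμ : Z0 m c • w = μ • w)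
    (ht : ∑ j, (c j : ℂ) * ζ j = t) (htk : t ^ 2 < (k - N) ^ 2) {l : ℝ} (hl : l ≠ 0)
    (hl2 : l ^ 2 = (k - N) ^ 2 - (1 - ε ^ 2) * t ^ 2) :
    ∃ v ≠ 0, v ∈ harm c τ k ∧ v ∈ Submodule.span ℂ {w, grp m c (.sr 0) • w} ∧
      Ztilde m c ε • v = (l : ℂ) • v ∧ ∀ a : Cent m c ε, a • v ∈ Submodule.span ℂ {v} := by
  have hσ := sigma_smul_weight ht hζ
  have hσ' := sigma_smul_sr_weight hc ht hζ
  have hμ' := Z0_smul_sr hμ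
  have hμ2 : μ ^ 2 = ((k : ℂ) - N) ^ 2 - (t : ℂ) ^ 2 := by
    have h := Z0_sq_harm hN hw
    rw [hσ, smul_comm (sigma m c), hσ', hμ, smul_comm (Z0 m c), hμ] at h
    have : (μ ^ 2 - (((k : ℂ) - N) ^ 2 - (t : ℂ) ^ 2)) • w = 0 := by
      linear_combination (norm := module) h
    exact sub_eq_zero.mp ((smul_eq_zero.mp this).resolve_right hw0)
  -- The strict bound on t rules out μ = 0. Hence w and s₀w belong to the different eigenvalues μ
  -- and −μ of Z₀ and are independent.
  have hμ0 : μ ≠ 0 := by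
    rintro rfl
    have : ((((k : ℝ) - N) ^ 2 - t ^ 2 : ℝ) : ℂ) = 0 := by
      push_cast; linear_combination -hμ2
    have := Complex.ofReal_eq_zero.mp this
    linarith
  have hind : LinearIndependent ℂ ![w, grp m c (.sr 0) • w] := by
    rw [LinearIndependent.pair_iff]
    intro α β h
    have h' := congrArg (Z0 m c • ·) h
    simp only [smul_add, smul_zero] at h'
    rw [smul_comm (Z0 m c) α, smul_comm (Z0 m c) β, hμ, hμ'] at h'
    have hsw := sr_smul_ne_zero hw0
    generalize grp m c (.sr 0) • w = w' at h h' hsw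
    have e1 : (2 * μ * α) • w = 0 := by linear_combination (norm := module) μ • h + h'
    have e2 : (2 * μ * β) • w' = 0 := by
      linear_combination (norm := module) μ • h - h'
    have e1 := (smul_eq_zero.mp e1).resolve_right hw0
    have e2 := (smul_eq_zero.mp e2).resolve_right hsw
    simp only [mul_eq_zero, OfNat.ofNat_ne_zero, hμ0, false_or] at e1 e2
    exact ⟨e1, e2⟩
  -- On the block Z₀ is diag(μ, −μ) and σ is t times the swap, so the off-diagonal entry of Z̃ is
  -- εt.
  obtain ⟨v, hv0, hvW, hTv, huniq⟩ := exists_eigenvector_pair (op (Ztilde m c ε)) hind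
    (μ := μ) (b := ε * t) (l := l)
    (by rw [op_apply, Ztilde, add_smul, hμ, smul_assoc, hσ, smul_smul])
    (by rw [op_apply, Ztilde, add_smul, hμ', smul_assoc, hσ', smul_smul, neg_smul]; abel)
    (by exact_mod_cast hl)
    (by
      have : ((l ^ 2 : ℝ) : ℂ) = (((k - N) ^ 2 - (1 - ε ^ 2) * t ^ 2 : ℝ) : ℂ) := by rw [hl2]
      push_cast at this
      rw [this, hμ2]; ring)
  rw [op_apply] at hTv
  refine ⟨v, hv0, ?_, hvW, hTv, fun a => ?_⟩
  · obtain ⟨α, β, rfl⟩ := Submodule.mem_span_pair.mp hvW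
    exact add_mem (Submodule.smul_mem _ _ hw) (Submodule.smul_mem _ _ (grp_smul_harm _ hw))
  · rw [Subalgebra.smul_def]
    -- An element of the centraliser preserves the block and commutes with Z̃, so it preserves the
    -- simple eigenline.
    refine huniq _ (angular_smul_mem_span hζ hμ (cent_mem_angular hc a) hvW) ?_
    rw [op_apply, ← mul_smul, (cent_Ztilde a).eq, mul_smul, hTv, smul_comm]

/-- An orthogonal eigenbasis of the harmonics determines the eigenspaces. -/
theorem harmonics_eq_span [FiniteDimensional ℂ V] {ε : ℝ} {k : ℕ} {ι : Type*} [Fintype ι]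
    {v : ι → StdMod c τ} {e : ι → ℝ} (hv : ∀ i, v i ∈ harm c τ k) (hv0 : ∀ i, v i ≠ 0)
    (he : ∀ i, Ztilde m c ε • v i = (e i : ℂ) • v i)
    (horth : Pairwise fun i j => B.form (v i) (v j) = 0)
    (hcard : Module.finrank ℂ (harm c τ k) ≤ Fintype.card ι) :
    LinearIndependent ℂ v ∧ harm c τ k = Submodule.span ℂ (Set.range v) ∧
      ∀ l : ℝ, harmonics c τ ε k l = Submodule.span ℂ (v '' {i | e i = l}) := by
  classical
  have hcoef (g : ι → ℂ) (i : ι) : B.form (v i) (∑ j, g j • v j) = g i * B.form (v i) (v i) := by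
    rw [map_sum, Finset.sum_eq_single i]
    · rw [map_smul, smul_eq_mul]
    · intro j _ hj
      rw [map_smul, horth hj.symm, smul_zero]
    · simp
  have hne (i : ι) : B.form (v i) (v i) ≠ 0 := fun h => hv0 i (B.eq_zero_of_form h)
  have hind : LinearIndependent ℂ v := by
    rw [Fintype.linearIndependent_iff]
    intro g hg i
    have h := hcoef g i
    rw [hg, map_zero] at h
    exact (mul_eq_zero.mp h.symm).resolve_right (hne i)
  have hfin : FiniteDimensional ℂ (harm c τ k) :=
    Submodule.finiteDimensional_of_le (inf_le_left : harm c τ k ≤ degreePart c τ k)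
  have hspan : harm c τ k = Submodule.span ℂ (Set.range v) := by
    refine (Submodule.eq_of_le_of_finrank_le (Submodule.span_le.mpr ?_) ?_).symm
    · rintro _ ⟨i, rfl⟩; exact hv i
    · rw [finrank_span_eq_card hind]; exact hcard
  refine ⟨hind, hspan, fun l => le_antisymm (fun x hx => ?_) (Submodule.span_le.mpr ?_)⟩
  · obtain ⟨hx1, hx2⟩ := mem_harmonics.mp hx
    rw [hspan, Submodule.mem_span_range_iff_exists_fun] at hx1
    obtain ⟨g, rfl⟩ := hx1
    refine Submodule.sum_mem _ fun i _ => ?_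
    by_cases hi : e i = l
    · exact Submodule.smul_mem _ _ (Submodule.subset_span ⟨i, hi, rfl⟩)
    · have h := hcoef g i
      rw [orthogonal (B.adj_Ztilde ε) (he i) hx2 fun h => hi (by exact_mod_cast h)] at h
      rw [(mul_eq_zero.mp h.symm).resolve_right (hne i), zero_smul]
      exact zero_mem _
  · rintro _ ⟨i, rfl, rfl⟩
    exact mem_harmonics.mpr ⟨hv i, he i⟩

-- The splitting into a harmonic and a multiple of E₊ has a unique harmonic part, and G commutes
-- with E₊ and E₋. So the harmonic part inherits the weight of p.
include B hN in
theorem exists_harm_weight [FiniteDimensional ℂ V] (hN1 : N < 1) {k : ℕ} {ζ : ZMod m → ℂ}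
    {p : StdMod c τ} (hp : p ∈ degreePart c τ k) (hζ : p ∈ weightSpace c τ ζ) :
    ∃ h ∈ harm c τ k ⊓ weightSpace c τ ζ, ∃ q, p = h + Eplus m c • q := by
  obtain ⟨h, hh, q, hq, rfl⟩ := B.exists_harm hN hN1 hp
  refine ⟨h, ⟨hh, fun j => ?_⟩, q, rfl⟩
  refine B.harm_unique hN hN1 (grp_smul_harm _ hh) (Submodule.smul_mem _ _ hh)
    (grp_smul_lowerPart (.r j) hq) (Submodule.smul_mem _ (ζ j) hq) ?_
  have := hζ j
  rw [smul_add, smul_add, ← mul_smul, ← (commute_Eplus_grp _).eq, mul_smul] at this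
  rw [this, smul_comm (Eplus m c)]

theorem exists_Z0_eigenvector [FiniteDimensional ℂ V] {k : ℕ} {W : Submodule ℂ (StdMod c τ)}
    (hW : W ≤ harm c τ k) (hZ : ∀ x ∈ W, Z0 m c • x ∈ W) (h0 : W ≠ ⊥) :
    ∃ w ∈ W, w ≠ 0 ∧ ∃ μ : ℂ, Z0 m c • w = μ • w := by
  have : FiniteDimensional ℂ W := Submodule.finiteDimensional_of_le
    (hW.trans (inf_le_left : harm c τ k ≤ degreePart c τ k))
  have : Nontrivial W := Submodule.nontrivial_iff_ne_bot.mpr h0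
  obtain ⟨μ, hμ⟩ := Module.End.exists_eigenvalue ((op (τ := τ) (Z0 m c)).restrict hZ)
  obtain ⟨w, hw⟩ := hμ.exists_hasEigenvector
  exact ⟨w, w.2, fun h => hw.2 (Subtype.ext h), μ, congrArg Subtype.val hw.apply_eq_smul⟩

include B hN hc in
/-- Bounds on the scalars by which `σ s₀` acts. -/
theorem sigma_weight_bound {k : ℕ} (hk : 0 < k) {ζ : ZMod m → ℂ} {t : ℝ} {p : StdMod c τ}
    (hp : p ∈ degreePart c τ k) (hζ : p ∈ weightSpace c τ ζ) (ht : ∑ j, (c j : ℂ) * ζ j = t)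
    (h1 : p + grp m c (.sr 0) • p ≠ 0) (h2 : p - grp m c (.sr 0) • p ≠ 0) :
    0 < k - N + t ∧ 0 < k - N - t := by
  have hσ := sigma_smul_weight ht hζ
  have hσ' := sigma_smul_sr_weight hc ht hζ
  have hp' := grp_smul_mem (.sr 0) hp
  -- The vectors p + s₀p and p − s₀p are eigenvectors of σ with eigenvalues t and −t, which gives
  -- the two inequalities.
  refine ⟨B.sigma_eigenvalue_pos hN hk (add_mem hp hp') h1 ?_, ?_⟩
  · rw [smul_add, hσ, hσ', smul_add, add_comm]
  · rw [sub_eq_add_neg (_ - _)]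
    refine B.sigma_eigenvalue_pos hN hk (sub_mem hp hp') h2 ?_
    rw [smul_sub, hσ, hσ']
    generalize grp m c (.sr 0) • p = y
    push_cast
    module

end UForm

/-! ### Simple modules from lines stable under the centraliser -/

section irreducible

variable {ε : ℝ} (S : Submodule (Cent m c ε) (StdMod c τ))

/-- The submodule of `S` given by a line stable under the centraliser. -/
def lineSub {v : StdMod c τ} (hv : ∀ a : Cent m c ε, a • v ∈ Submodule.span ℂ {v}) :
    Submodule (Cent m c ε) S where
  carrier := {x | (x : StdMod c τ) ∈ Submodule.span ℂ {v}}
  add_mem' ha hb := (Submodule.span ℂ {v}).add_mem ha hb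
  zero_mem' := (Submodule.span ℂ {v}).zero_mem
  smul_mem' a x hx := by
    obtain ⟨b, hb⟩ := Submodule.mem_span_singleton.mp
      (show (x : StdMod c τ) ∈ Submodule.span ℂ {v} from hx)
    show a • (x : StdMod c τ) ∈ Submodule.span ℂ {v}
    rw [← hb, Subalgebra.smul_def, smul_comm, ← Subalgebra.smul_def]
    exact Submodule.smul_mem _ _ (hv a)

theorem mem_lineSub {v : StdMod c τ} (hv : ∀ a : Cent m c ε, a • v ∈ Submodule.span ℂ {v}) {x : S} :
    x ∈ lineSub S hv ↔ (x : StdMod c τ) ∈ Submodule.span ℂ {v} := Iff.rfl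

theorem isSimpleModule_of_finrank_one {M : Type*} [AddCommGroup M] [Module ℂ M]
    [Module (Cent m c ε) M] [IsScalarTower ℂ (Cent m c ε) M] (h : Module.finrank ℂ M = 1) :
    IsSimpleModule (Cent m c ε) M :=
  (isSimpleModule_iff ..).mpr (is_simple_module_of_finrank_eq_one h)

theorem isSimpleModule_lineSub {v : StdMod c τ}
    (hv : ∀ a : Cent m c ε, a • v ∈ Submodule.span ℂ {v}) (h0 : v ≠ 0) (hvS : v ∈ S) :
    IsSimpleModule (Cent m c ε) (lineSub S hv) := by
  refine isSimpleModule_of_finrank_one (finrank_eq_one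
    (⟨⟨v, hvS⟩, (mem_lineSub S hv).mpr (Submodule.mem_span_singleton_self v)⟩ : lineSub S hv) ?_ ?_)
  · intro h
    exact h0 (congrArg (fun x : lineSub S hv => ((x : S) : StdMod c τ)) h)
  · rintro ⟨⟨x, hxS⟩, hx⟩
    obtain ⟨b, hb⟩ := Submodule.mem_span_singleton.mp ((mem_lineSub S hv).mp hx)
    exact ⟨b, Subtype.ext (Subtype.ext hb)⟩

theorem exists_isCompl_lines {v v' : StdMod c τ} (hind : LinearIndependent ℂ ![v, v'])
    (hv : ∀ a : Cent m c ε, a • v ∈ Submodule.span ℂ {v})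
    (hv' : ∀ a : Cent m c ε, a • v' ∈ Submodule.span ℂ {v'})
    (hS : (S : Set (StdMod c τ)) = Submodule.span ℂ {v, v'}) :
    Module.finrank ℂ S = 2 ∧ ∃ A B : Submodule (Cent m c ε) S,
      IsSimpleModule (Cent m c ε) A ∧ IsSimpleModule (Cent m c ε) B ∧ IsCompl A B := by
  have hmem (x : StdMod c τ) : x ∈ S ↔ x ∈ Submodule.span ℂ {v, v'} := Set.ext_iff.mp hS x
  have h1 : v ∈ S := (hmem v).mpr (Submodule.subset_span (by simp))
  have h2 : v' ∈ S := (hmem v').mpr (Submodule.subset_span (by simp))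
  refine ⟨?_, lineSub S hv, lineSub S hv', isSimpleModule_lineSub S hv (hind.ne_zero 0) h1,
    isSimpleModule_lineSub S hv' (hind.ne_zero 1) h2, ?_, ?_⟩
  · have e : S.restrictScalars ℂ = Submodule.span ℂ (Set.range ![v, v']) := by
      rw [Matrix.range_cons_cons_empty]
      exact SetLike.ext hmem
    have h := finrank_span_eq_card hind
    rw [← e] at h
    exact h
  · rw [Submodule.disjoint_def]
    rintro ⟨x, hxS⟩ hx hx'
    obtain ⟨a, ha⟩ := Submodule.mem_span_singleton.mp ((mem_lineSub S hv).mp hx)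
    obtain ⟨b, hb⟩ := Submodule.mem_span_singleton.mp ((mem_lineSub S hv').mp hx')
    have h := LinearIndependent.pair_iff.mp hind a (-b) (by
      rw [neg_smul, ha, hb]; exact add_neg_cancel x)
    refine Subtype.ext ?_
    rw [← ha, h.1, zero_smul]; rfl
  · rw [codisjoint_iff, eq_top_iff]
    rintro ⟨x, hxS⟩ -
    obtain ⟨a, b, hab⟩ := Submodule.mem_span_pair.mp ((hmem x).mp hxS)
    refine Submodule.mem_sup.mpr ⟨a • ⟨v, h1⟩, ?_, b • ⟨v', h2⟩, ?_, Subtype.ext hab⟩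
    · exact (mem_lineSub S hv).mpr <| Submodule.smul_mem (Submodule.span ℂ {v}) a
        (Submodule.mem_span_singleton_self v)
    · exact (mem_lineSub S hv').mpr <| Submodule.smul_mem (Submodule.span ℂ {v'}) b
        (Submodule.mem_span_singleton_self v')

end irreducible

end weights

/-! ### The decompositions -/

section decompositions

variable {m : ℕ} [NeZero m] {c : ZMod m → ℝ}
variable {V : Type*} [AddCommGroup V] [Module ℂ V] {τ : Representation ℂ (DihedralGroup m) V}
variable (hc : ∀ i j : ZMod m, IsConj (DihedralGroup.sr i) (DihedralGroup.sr j) → c i = c j)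

theorem om_pow (j : ZMod m) (k : ℕ) : om j ^ k = om (j * (k : ZMod m)) := by
  rw [mul_comm, ← nsmul_eq_mul]
  exact (AddChar.map_nsmul_eq_pow _ k j).symm

theorem zC_pow_weight {η : ZMod m → ℂ} {v : V} (hv : ∀ j, τ (.r j) v = η j • v) (k : ℕ) :
    zC m c ^ k • incl c τ v ∈ weightSpace c τ fun j => om (j * (k : ZMod m)) * η j := fun j => by
  rw [← mul_smul, mul_pow_of_mul_eq_smul (r_zC j), smul_assoc, mul_smul, grp_smul_incl, hv,
    map_smul, smul_comm (zC m c ^ k), smul_smul, om_pow]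

theorem zbC_pow_weight {η : ZMod m → ℂ} {v : V} (hv : ∀ j, τ (.r j) v = η j • v) (k : ℕ) :
    zbC m c ^ k • incl c τ v ∈ weightSpace c τ fun j => om (-j * (k : ZMod m)) * η j := fun j => by
  rw [← mul_smul, mul_pow_of_mul_eq_smul (r_zbC j), smul_assoc, mul_smul, grp_smul_incl, hv,
    map_smul, smul_comm (zbC m c ^ k), smul_smul, om_pow]

theorem sr_zC_pow (k : ℕ) (v : V) : grp m c (.sr 0) • zC m c ^ k • incl c τ v =
    zbC m c ^ k • incl c τ (τ (.sr 0) v) := by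
  rw [← mul_smul, mul_pow_of_mul_eq_smul (sr_zC 0), om_zero, one_pow, one_smul, mul_smul,
    grp_smul_incl]

theorem incl_mem_weightSpace {η : ZMod m → ℂ} {v : V} (hv : ∀ j, τ (.r j) v = η j • v) :
    incl c τ v ∈ weightSpace c τ η := fun j => by rw [grp_smul_incl, hv, map_smul]

theorem Z0_smul_incl (v : V) : Z0 m c • incl c τ v = 0 := by
  rw [Z0, smul_assoc, sub_smul, mul_smul, mul_smul, eta, xi, vec_smul_incl, vec_smul_incl,
    smul_zero, smul_zero, sub_zero, smul_zero]

/-! ### Harmonics of degree zero -/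

section degreeZero

variable {N : ℝ}

theorem Ztilde_smul_incl (hN : ∀ v, sigma m c • incl c τ v = (N : ℂ) • incl c τ v) (ε : ℝ) (v : V) :
    Ztilde m c ε • incl c τ v = ((ε * N : ℝ) : ℂ) • incl c τ v := by
  rw [Ztilde, add_smul, Z0_smul_incl, smul_assoc, hN, zero_add, smul_smul]
  push_cast; rfl

theorem harmonics_zero (hN : ∀ v, sigma m c • incl c τ v = (N : ℂ) • incl c τ v) (ε : ℝ) :
    harmonics c τ ε 0 (ε * N) = LinearMap.range (incl c τ) := by
  refine le_antisymm (fun x hx => ?_) ?_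
  · rw [← degreePart_zero]; exact hx.1
  · rintro _ ⟨v, rfl⟩
    exact ⟨incl_mem_degreePart v, Eminus_smul_zero (incl_mem_degreePart v),
      Ztilde_smul_incl hN ε v⟩

theorem harm_zero : harm c τ 0 ≤ LinearMap.range (incl c τ) := by
  rw [← degreePart_zero]; exact inf_le_left

end degreeZero

/-- The number under the root is ((k − N)² − s²) + (εs)², so the strict bound on s makes it positive
for every real ε. -/
theorem lamPlus_sq {ε N : ℝ} {k : ℕ} {s : ℝ} (h : s ^ 2 < (k - N) ^ 2) :
    0 ≤ (k - N) ^ 2 - (1 - ε ^ 2) * s ^ 2 ∧ 0 < lamPlus ε N k s ∧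
      lamPlus ε N k s ^ 2 = (k - N) ^ 2 - (1 - ε ^ 2) * s ^ 2 := by
  have h1 : 0 < (k - N) ^ 2 - (1 - ε ^ 2) * s ^ 2 := by
    have : 0 ≤ (ε * s) ^ 2 := sq_nonneg _
    linarith
  exact ⟨h1.le, Real.sqrt_pos.mpr h1, Real.sq_sqrt h1.le⟩

theorem finrank_eq_of_coe {ε : ℝ} {S : Submodule (Cent m c ε) (StdMod c τ)}
    {W : Submodule ℂ (StdMod c τ)} (h : (S : Set (StdMod c τ)) = W) :
    Module.finrank ℂ S = Module.finrank ℂ W := by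
  have e : S.restrictScalars ℂ = W := SetLike.coe_injective h
  rw [← e]; rfl

theorem sq_lt_of_bounds {a t : ℝ} (h : 0 < a + t ∧ 0 < a - t) : t ^ 2 < a ^ 2 :=
  sq_lt_sq' (by linarith [h.1]) (by linarith [h.2])

/-! ### One-dimensional representations -/

section character

variable (χ : DihedralGroup m →* ℂ)

omit [NeZero m] in
theorem charRep_apply (g : DihedralGroup m) (v : ℂ) : charRep χ g v = χ g • v := rfl

omit [NeZero m] in
theorem chi_sr (j : ZMod m) : χ (.r j) = χ (.sr 0) * χ (.sr j) := by
  rw [← map_mul, DihedralGroup.sr_mul_sr, sub_zero]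

omit [NeZero m] in
theorem chi_sr_zero : χ (.sr 0) = 1 ∨ χ (.sr 0) = -1 :=
  mul_self_eq_one_iff.mp (by rw [← map_mul, DihedralGroup.sr_mul_self, map_one])

include hc in
theorem sigma_smul_incl_char (v : ℂ) :
    sigma m c • incl c (charRep χ) v = (Nc c χ : ℂ) • incl c (charRep χ) v := by
  rw [Nc, ofReal_sigmaChar c hc, sigmaCharC, sigma, Finset.sum_smul, Finset.sum_smul]
  refine Finset.sum_congr rfl fun j _ => ?_
  rw [smul_assoc, grp_smul_incl, charRep_apply, map_smul, smul_smul]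
  simp

-- Since χ(r_j) = χ(s₀)χ(s_j) and χ(s₀) = ±1, the weight sum of z^k equals ±σ_{χ,k}. Only its square
-- enters the eigenvalues, so the sign is discarded.
include hc in
theorem exists_char_weight_sum (k : ℕ) : ∃ t : ℝ, t ^ 2 = sigmaChar c χ k ^ 2 ∧
    ∑ j, (c j : ℂ) * (om (j * (k : ZMod m)) * χ (.r j)) = t := by
  have h : ∑ j, (c j : ℂ) * (om (j * (k : ZMod m)) * χ (.r j)) =
      χ (.sr 0) * (sigmaChar c χ k : ℂ) := by
    rw [ofReal_sigmaChar c hc, sigmaCharC, Finset.mul_sum]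
    refine Finset.sum_congr rfl fun j _ => ?_
    rw [chi_sr, om]; push_cast; ring
  rcases chi_sr_zero χ with h1 | h1
  · exact ⟨sigmaChar c χ k, rfl, by rw [h, h1, one_mul]⟩
  · exact ⟨-sigmaChar c χ k, neg_sq _, by rw [h, h1]; push_cast; ring⟩

namespace UForm

variable {χ} (B : UForm c (charRep χ))

-- The test vector is z^k, whose image under s₀ is a multiple of z̄^k. For k > 0 these are
-- independent, so neither z^k + s₀z^k nor z^k − s₀z^k vanishes.
include B hc in
theorem char_bound {k : ℕ} (hk : 0 < k) {t : ℝ}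
    (ht : ∑ j, (c j : ℂ) * (om (j * (k : ZMod m)) * χ (.r j)) = t) :
    0 < k - Nc c χ + t ∧ 0 < k - Nc c χ - t := by
  have hζ : zC m c ^ k • incl c (charRep χ) 1 ∈ _ :=
    zC_pow_weight (fun j => charRep_apply χ (.r j) 1) k
  have hp : zC m c ^ k • incl c (charRep χ) 1 ∈ degreePart c (charRep χ) k := by
    have := extremal_mem (c := c) (τ := charRep χ) k (1, 0)
    rwa [extremal_apply, map_zero, smul_zero, add_zero] at this
  have hne (a : ℂ) : zC m c ^ k • incl c (charRep χ) 1 +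
      a • grp m c (.sr 0) • zC m c ^ k • incl c (charRep χ) 1 ≠ 0 := fun h => by
    rw [sr_zC_pow, smul_comm a, ← map_smul (incl c (charRep χ)) a, ← extremal_apply] at h
    exact one_ne_zero (extremal_eq_zero_of_Eplus hc hk (h.trans (smul_zero _).symm)).1
  refine B.sigma_weight_bound hc (sigma_smul_incl_char hc χ) hk hp hζ ht ?_ ?_
  · simpa using hne 1
  · simpa [sub_eq_add_neg] using hne (-1)

-- In degree 1 both 1 − N + t and 1 − N − t are positive; adding them eliminates t.
include B hc in
theorem Nc_lt_one : Nc c χ < 1 := by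
  obtain ⟨t, -, ht⟩ := exists_char_weight_sum hc χ 1
  obtain ⟨h1, h2⟩ := B.char_bound hc one_pos ht
  push_cast at h1 h2
  linarith

include B hc in
theorem char_sq_lt {k : ℕ} (hk : 0 < k) : sigmaChar c χ k ^ 2 < (k - Nc c χ) ^ 2 := by
  obtain ⟨t, ht2, ht⟩ := exists_char_weight_sum hc χ k
  rw [← ht2]
  exact sq_lt_of_bounds (B.char_bound hc hk ht)

-- The harmonic part of z^k is nonzero, because z^k is not in the image of E₊. Its weight space
-- contains a Z₀-eigenvector, whose block supplies eigenvectors for l and −l; since the harmonics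
-- have dimension at most two, these form a basis.
include B hc in
theorem char_harm (ε : ℝ) {k : ℕ} (hk : 0 < k) {l : ℝ}
    (hl : l = lamPlus ε (Nc c χ) k (sigmaChar c χ k)) :
    harm c (charRep χ) k ≤ harmonics c (charRep χ) ε k l ⊔ harmonics c (charRep χ) ε k (-l) ∧
      Module.finrank ℂ (harmonics c (charRep χ) ε k l) = 1 ∧
      Module.finrank ℂ (harmonics c (charRep χ) ε k (-l)) = 1 := by
  have hN := sigma_smul_incl_char hc χ
  have hN1 := B.Nc_lt_one hc
  obtain ⟨t, ht2, ht⟩ := exists_char_weight_sum hc χ k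
  obtain ⟨-, hl0, hl2⟩ := lamPlus_sq (ε := ε) (B.char_sq_lt hc hk)
  rw [← hl] at hl0 hl2
  have hp : zC m c ^ k • incl c (charRep χ) 1 ∈ degreePart c (charRep χ) k := by
    have := extremal_mem (c := c) (τ := charRep χ) k (1, 0)
    rwa [extremal_apply, map_zero, smul_zero, add_zero] at this
  obtain ⟨h, hh, q, hq⟩ := B.exists_harm_weight hN hN1 hp
    (zC_pow_weight (fun j => charRep_apply χ (.r j) 1) k)
  have hne : h ≠ 0 := by
    rintro rfl
    have : extremal c (charRep χ) k (1, 0) = Eplus m c • q := by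
      rw [extremal_apply, map_zero, smul_zero, add_zero, hq, zero_add]
    exact one_ne_zero (extremal_eq_zero_of_Eplus hc hk this).1
  obtain ⟨w, hw, hw0, μ, hμ⟩ := exists_Z0_eigenvector
    (W := harm c (charRep χ) k ⊓ weightSpace c (charRep χ) _) inf_le_left
    (fun x hx => ⟨Z0_smul_harm hx.1, Z0_smul_weightSpace hx.2⟩)
    ((Submodule.ne_bot_iff _).mpr ⟨h, hh, hne⟩)
  have htk : t ^ 2 < (k - Nc c χ) ^ 2 := by rw [ht2]; exact B.char_sq_lt hc hk
  obtain ⟨v, hv0, hv, -, hvZ, -⟩ := exists_eigenline hc hN (ε := ε) hw.1 hw0 hw.2 hμ ht htk hl0.ne'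
    (by rw [hl2, ht2])
  obtain ⟨v', hv0', hv', -, hvZ', -⟩ := exists_eigenline hc hN (ε := ε) hw.1 hw0 hw.2 hμ ht htk
    (neg_ne_zero.mpr hl0.ne') (by rw [neg_sq, hl2, ht2])
  have horth : B.form v v' = 0 := orthogonal (B.adj_Ztilde ε) hvZ hvZ' fun h => by
    have : l = -l := by exact_mod_cast h
    linarith
  obtain ⟨-, h1, h2⟩ := B.harmonics_eq_span (ε := ε) (k := k) (v := ![v, v']) (e := ![l, -l])
    (by simp [Fin.forall_fin_two, hv, hv']) (by simp [Fin.forall_fin_two, hv0, hv0'])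
    (by
      rw [Fin.forall_fin_two]
      exact ⟨hvZ, hvZ'⟩)
    (by
      intro i j hij
      fin_cases i <;> fin_cases j
      · exact absurd rfl hij
      · exact horth
      · exact B.form_symm_zero horth
      · exact absurd rfl hij)
    (by simpa using B.finrank_harm_le hN hN1 k)
  have e1 : {i : Fin 2 | ![l, -l] i = l} = {0} := by
    ext i; fin_cases i
    · simp
    · simp; linarith
  have e2 : {i : Fin 2 | ![l, -l] i = -l} = {1} := by
    ext i; fin_cases i
    · simp; linarith
    · simp
  have f1 := h2 l
  have f2 := h2 (-l)
  rw [e1, Set.image_singleton] at f1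
  rw [e2, Set.image_singleton] at f2
  refine ⟨?_, by rw [f1]; exact finrank_span_singleton hv0, by
    rw [f2]; exact finrank_span_singleton hv0'⟩
  rw [h1, Submodule.span_le]
  rintro _ ⟨i, rfl⟩
  fin_cases i
  · exact Submodule.mem_sup_left (mem_harmonics.mpr ⟨hv, hvZ⟩)
  · exact Submodule.mem_sup_right (mem_harmonics.mpr ⟨hv', hvZ'⟩)

end UForm

include hc in
theorem decomposition_char (ε : ℝ) (hU : IsUnitarisable c (charRep χ)) :
    (∀ k : ℕ, 0 < k → 0 ≤ ((k : ℝ) - Nc c χ) ^ 2 - (1 - ε ^ 2) * sigmaChar c χ k ^ 2) ∧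
    ∃ S : ℤ → Submodule (Cent m c ε) (StdMod c (charRep χ)),
      IsJointDecomposition c (charRep χ) ε (Nc c χ) Int.natAbs (lamChar c ε χ) S ∧
      (S 0 : Set (StdMod c (charRep χ))) = Set.range (incl c (charRep χ)) ∧
      ∀ k : ℤ, Module.finrank ℂ (S k) = 1 ∧ IsSimpleModule (Cent m c ε) (S k) := by
  obtain ⟨β, h1, h2, h3, h4, h5⟩ := hU
  let B : UForm c (charRep χ) := ⟨β, h1, h2, h3, h4, h5⟩
  have hN := sigma_smul_incl_char hc χ
  have hN1 := B.Nc_lt_one hc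
  refine ⟨fun k hk => (lamPlus_sq (B.char_sq_lt hc hk)).1,
    fun k => B.harmSub hN ε k.natAbs (lamChar c ε χ k),
    B.isJointDecomposition hN hN1 _ _ ?_ ?_, ?_, ?_⟩
  · intro i j hij hl
    rcases Int.natAbs_eq_natAbs_iff.mp hij with h | rfl
    · exact h
    by_cases hj : j = 0
    · simp [hj]
    -- The indices j and −j share a degree, and their eigenvalues are opposite. Positivity of the
    -- root keeps them apart.
    · exfalso
      have hpos := (lamPlus_sq (ε := ε) (B.char_sq_lt hc (Int.natAbs_pos.mpr hj))).2.1
      rw [lamChar, lamChar, if_neg (neg_ne_zero.mpr hj), if_neg hj, Int.natAbs_neg, Int.sign_neg]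
        at hl
      have hs : (j.sign : ℝ) ≠ 0 := by exact_mod_cast fun h => hj (Int.sign_eq_zero_iff_zero.mp h)
      have : (j.sign : ℝ) * lamPlus ε (Nc c χ) j.natAbs (sigmaChar c χ j.natAbs) = 0 := by
        rw [Int.cast_neg] at hl; linarith
      exact (mul_ne_zero hs hpos.ne') this
  · intro k
    rcases Nat.eq_zero_or_pos k with rfl | hk
    · refine harm_zero.trans ?_
      rw [← harmonics_zero hN ε]
      refine le_iSup_of_le (0 : ℤ) (le_of_eq ?_)
      rw [Int.natAbs_zero, lamChar, if_pos rfl, Nc]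
    · obtain ⟨h, -⟩ := B.char_harm hc ε hk rfl
      have hk' : (k : ℤ) ≠ 0 := by exact_mod_cast hk.ne'
      have hs : ((k : ℤ).sign : ℝ) = 1 := by
        rw [Int.sign_eq_one_of_pos (by exact_mod_cast hk), Int.cast_one]
      refine h.trans (sup_le (le_iSup_of_le (k : ℤ) (le_of_eq ?_))
        (le_iSup_of_le (-k : ℤ) (le_of_eq ?_)))
      · rw [Int.natAbs_natCast, lamChar, if_neg hk', Int.natAbs_natCast, hs, one_mul]
      · rw [Int.natAbs_neg, Int.natAbs_natCast, lamChar, if_neg (neg_ne_zero.mpr hk'),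
          Int.natAbs_neg, Int.natAbs_natCast, Int.sign_neg, Int.cast_neg, hs, neg_one_mul]
  · show (harmonics c (charRep χ) ε 0 (lamChar c ε χ 0) : Set (StdMod c (charRep χ))) = _
    rw [lamChar, if_pos rfl, ← Nc, harmonics_zero hN, LinearMap.coe_range]
  · intro k
    have hfin : Module.finrank ℂ (B.harmSub hN ε k.natAbs (lamChar c ε χ k)) = 1 := by
      rw [finrank_eq_of_coe (W := harmonics c (charRep χ) ε k.natAbs (lamChar c ε χ k)) rfl]
      by_cases hk : k = 0
      · rw [hk, lamChar, if_pos rfl, ← Nc, Int.natAbs_zero, harmonics_zero hN,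
          LinearMap.finrank_range_of_inj (incl_injective _ hc), Module.finrank_self]
      · obtain ⟨-, h1, h2⟩ := B.char_harm hc ε (Int.natAbs_pos.mpr hk) rfl
        rw [lamChar, if_neg hk]
        rcases lt_or_gt_of_ne hk with h | h
        · rw [Int.sign_eq_neg_one_of_neg h, Int.cast_neg, Int.cast_one, neg_one_mul]; exact h2
        · rw [Int.sign_eq_one_of_pos h, Int.cast_one, one_mul]; exact h1
    exact ⟨hfin, isSimpleModule_of_finrank_one hfin⟩

end character

end decompositions

/-! ### Two-dimensional representations -/

section twoDimensional

variable {m : ℕ} [NeZero m] {c : ZMod m → ℝ}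
variable (hc : ∀ i j : ZMod m, IsConj (DihedralGroup.sr i) (DihedralGroup.sr j) → c i = c j)

theorem rho_apply (u : ℕ) (g : DihedralGroup m) (v : Fin 2 → ℂ) :
    rho u g v = (rhoMat u g).mulVec v := Matrix.toLin'_apply ..

theorem rho_r_e0 (u : ℕ) (j : ZMod m) : rho u (.r j) ![1, 0] = om (j * (u : ZMod m)) • ![1, 0] := by
  rw [rho_apply]
  ext i; fin_cases i <;> simp [rhoMat, Matrix.mulVec, dotProduct]

theorem rho_r_e1 (u : ℕ) (j : ZMod m) :
    rho u (.r j) ![0, 1] = om (j * -(u : ZMod m)) • ![0, 1] := by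
  rw [rho_apply]
  ext i; fin_cases i <;> simp [rhoMat, Matrix.mulVec, dotProduct]

include hc in
theorem sum_om_mul (n : ℤ) : ∑ j, (c j : ℂ) * om (j * (n : ZMod m)) = sigmaNum c n := by
  rw [sigmaNum, ofReal_sigmaChar c hc, sigmaCharC]
  refine Finset.sum_congr rfl fun j _ => ?_
  rw [MonoidHom.one_apply, mul_one, om]

include hc in
/-- `σ_n = 0` unless `m` divides `2 n`. -/
theorem sum_om_mul_eq_zero {n : ZMod m} (hn : 2 * n ≠ 0) : ∑ j, (c j : ℂ) * om (j * n) = 0 := by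
  -- Conjugation by a generating rotation shifts the index of a reflection by 2. Reindexing the sum
  -- by this shift multiplies it by ω^{2n}, which differs from 1.
  have hcj (j : ZMod m) : c (j + 2) = c j := by
    refine hc _ _ (isConj_iff.mpr ⟨.r 1, ?_⟩)
    simp only [DihedralGroup.r_mul_sr, DihedralGroup.inv_r, DihedralGroup.sr_mul_r]
    congr 1; ring
  have h : ∑ j, (c j : ℂ) * om (j * n) = (∑ j, (c j : ℂ) * om (j * n)) * om (2 * n) := by
    conv_lhs => rw [← Equiv.sum_comp (Equiv.addRight (2 : ZMod m))]
    rw [Finset.sum_mul]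
    refine Finset.sum_congr rfl fun j _ => ?_
    rw [Equiv.coe_addRight, hcj, add_mul, om_add, mul_assoc]
  by_contra h0
  have h1 : om (2 * n) = 1 := mul_left_cancel₀ h0 (h.symm.trans (mul_one _).symm)
  rw [← om_zero (m := m)] at h1
  exact hn (ZMod.injective_stdAddChar h1)

section fixed

variable {u : ℕ} (hu : 0 < u) (hum : 2 * u < m)

include hu hum in
omit [NeZero m] in
theorem two_mul_cast_ne_zero : 2 * (u : ZMod m) ≠ 0 := by
  have : ((2 * u : ℕ) : ZMod m) ≠ 0 := by
    rw [Ne, ZMod.natCast_eq_zero_iff]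
    exact Nat.not_dvd_of_pos_of_lt (by omega) hum
  simpa using this

-- The two basis vectors have rotation weights u and −u. As 0 < 2u < m, the weight sums vanish and σ
-- kills both, so N = 0 for these representations.
include hc hu hum in
theorem sigma_smul_incl_rho (v : Fin 2 → ℂ) : sigma m c • incl c (rho u) v =
    ((0 : ℝ) : ℂ) • incl c (rho (m := m) u) v := by
  have hu2 := two_mul_cast_ne_zero hu hum
  have h0 := sigma_smul_weight (sum_om_mul_eq_zero hc hu2)
    (incl_mem_weightSpace (c := c) (rho_r_e0 u))
  have h1 := sigma_smul_weight (sum_om_mul_eq_zero (n := -(u : ZMod m)) hc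
    (by rw [mul_neg]; exact neg_ne_zero.mpr hu2)) (incl_mem_weightSpace (c := c) (rho_r_e1 u))
  have hv : v = v 0 • ![1, 0] + v 1 • ![0, 1] := by ext i; fin_cases i <;> simp
  rw [Complex.ofReal_zero, zero_smul, hv, map_add, map_smul, map_smul, smul_add,
    smul_comm (sigma m c), smul_comm (sigma m c), h0, h1, zero_smul, zero_smul, smul_zero,
    smul_zero, add_zero]

theorem zC_pow_e0_weight (k : ℕ) : zC m c ^ k • incl c (rho u) ![1, 0] ∈
    weightSpace c (rho (m := m) u) fun j => om (j * (((k : ℤ) + u : ℤ) : ZMod m)) := by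
  have := zC_pow_weight (c := c) (rho_r_e0 (m := m) u) k
  simp only [← om_add, ← mul_add] at this
  push_cast; exact this

theorem zC_pow_e1_weight (k : ℕ) : zC m c ^ k • incl c (rho u) ![0, 1] ∈
    weightSpace c (rho (m := m) u) fun j => om (j * (((k : ℤ) - u : ℤ) : ZMod m)) := by
  have := zC_pow_weight (c := c) (rho_r_e1 (m := m) u) k
  simp only [← om_add, ← mul_add] at this
  push_cast; rw [sub_eq_add_neg]; exact this

theorem zbC_pow_e1_weight (k : ℕ) : zbC m c ^ k • incl c (rho u) ![0, 1] ∈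
    weightSpace c (rho (m := m) u) fun j => om (j * -(((k : ℤ) + u : ℤ) : ZMod m)) := by
  have := zbC_pow_weight (c := c) (rho_r_e1 (m := m) u) k
  simp only [← om_add, neg_mul, ← mul_neg, ← mul_add] at this
  push_cast; rw [neg_add]; exact this

theorem zC_pow_mem (k : ℕ) (v : Fin 2 → ℂ) :
    zC m c ^ k • incl c (rho u) v ∈ degreePart c (rho (m := m) u) k := by
  have := extremal_mem (c := c) (τ := rho (m := m) u) k (v, 0)
  rwa [extremal_apply, map_zero, smul_zero, add_zero] at this

theorem zbC_pow_mem (k : ℕ) (v : Fin 2 → ℂ) :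
    zbC m c ^ k • incl c (rho u) v ∈ degreePart c (rho (m := m) u) k := by
  have := extremal_mem (c := c) (τ := rho (m := m) u) k (0, v)
  rwa [extremal_apply, map_zero, smul_zero, zero_add] at this

theorem e0_ne_zero : (![1, 0] : Fin 2 → ℂ) ≠ 0 := fun h => one_ne_zero (congrFun h 0)

theorem e1_ne_zero : (![0, 1] : Fin 2 → ℂ) ≠ 0 := fun h => one_ne_zero (congrFun h 1)

/-! ### Harmonics for the two-dimensional representations -/

namespace UForm

variable (B : UForm c (rho (m := m) u))

-- The test vectors are z^k times each of the two basis vectors of the representation; their weights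
-- k + u and k − u produce the two sums.
include B hc hu hum in
theorem rho_sq_lt {k : ℕ} (hk : 0 < k) : sigmaNum c (k + u) ^ 2 < ((k : ℝ) - (0 : ℝ)) ^ 2 ∧
    sigmaNum c (k - u) ^ 2 < ((k : ℝ) - (0 : ℝ)) ^ 2 := by
  have hN := sigma_smul_incl_rho hc hu hum
  have hne (v : Fin 2 → ℂ) (hv : v ≠ 0) (a : ℂ) : zC m c ^ k • incl c (rho u) v +
      a • grp m c (.sr 0) • zC m c ^ k • incl c (rho u) v ≠ 0 := fun h => by
    rw [sr_zC_pow, smul_comm a, ← map_smul (incl c (rho u)) a, ← extremal_apply] at h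
    exact hv (extremal_eq_zero_of_Eplus hc hk (h.trans (smul_zero _).symm)).1
  constructor
  · refine sq_lt_of_bounds (B.sigma_weight_bound hc hN hk (zC_pow_mem k _) (zC_pow_e0_weight k)
      (sum_om_mul hc _) ?_ ?_)
    · simpa using hne _ e0_ne_zero 1
    · simpa [sub_eq_add_neg] using hne _ e0_ne_zero (-1)
  · refine sq_lt_of_bounds (B.sigma_weight_bound hc hN hk (zC_pow_mem k _) (zC_pow_e1_weight k)
      (sum_om_mul hc _) ?_ ?_)
    · simpa using hne _ e1_ne_zero 1
    · simpa [sub_eq_add_neg] using hne _ e1_ne_zero (-1)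

include hc hu hum in
/-- A harmonic of weight `k - u` orthogonal to the block of a harmonic of weight `k + u`. -/
theorem exists_second_weight {k : ℕ} (hk : 0 < k) {w : StdMod c (rho (m := m) u)}
    (hw : w ∈ weightSpace c (rho (m := m) u) fun j => om (j * (((k : ℤ) + u : ℤ) : ZMod m))) :
    ∃ h ≠ 0, h ∈ harm c (rho (m := m) u) k ∧
      (h ∈ weightSpace c (rho (m := m) u) fun j => om (j * (((k : ℤ) - u : ℤ) : ZMod m))) ∧
      B.form w h = 0 ∧ B.form (grp m c (.sr 0) • w) h = 0 := by
  have hN := sigma_smul_incl_rho hc hu hum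
  have hu2 := two_mul_cast_ne_zero hu hum
  have hn : (((k : ℤ) + u : ℤ) : ZMod m) ≠ (((k : ℤ) - u : ℤ) : ZMod m) := fun h => hu2 (by
    push_cast at h; linear_combination h)
  obtain ⟨h₁, hh₁, q₁, e₁⟩ := B.exists_harm_weight hN one_pos.gt (zC_pow_mem k _)
    (zC_pow_e1_weight (c := c) (u := u) k)
  -- The products of z^k and z̄^k with the second basis vector are independent modulo the image of
  -- E₊, hence so are their harmonic parts.
  have comb (a b : ℂ) (h₂ q₂ : StdMod c (rho (m := m) u))
      (e₂ : zbC m c ^ k • incl c (rho u) ![0, 1] = h₂ + Eplus m c • q₂)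
      (h0 : a • h₁ + b • h₂ = 0) : a = 0 ∧ b = 0 := by
    have : extremal c (rho (m := m) u) k (a • ![0, 1], b • ![0, 1]) =
        Eplus m c • (a • q₁ + b • q₂) := by
      rw [extremal_apply, map_smul, map_smul, smul_comm _ a, smul_comm _ b, e₁, e₂, smul_add,
        smul_add, smul_add, smul_comm _ a, smul_comm _ b]
      generalize Eplus m c • q₁ = y
      generalize Eplus m c • q₂ = y'
      linear_combination (norm := module) h0
    obtain ⟨ha, hb⟩ := extremal_eq_zero_of_Eplus hc hk this
    exact ⟨(smul_eq_zero.mp ha).resolve_right e1_ne_zero,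
      (smul_eq_zero.mp hb).resolve_right e1_ne_zero⟩
  obtain ⟨h₂, hh₂, q₂, e₂⟩ := B.exists_harm_weight hN one_pos.gt (zbC_pow_mem k _)
    (zbC_pow_e1_weight (c := c) (u := u) k)
  by_cases horth : B.form (grp m c (.sr 0) • w) h₁ = 0
  · refine ⟨h₁, fun h => ?_, hh₁.1, hh₁.2, B.orthogonal_weight hn hw hh₁.2, horth⟩
    exact one_ne_zero (comb 1 0 h₂ q₂ e₂ (by rw [h, smul_zero, zero_smul, zero_add])).1
  -- The vector s₀w has weight −(k + u). It can pair nontrivially with h₁ only if this weight equals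
  -- k − u modulo m; then h₂ has that weight too, and the combination b h₁ − a h₂ cancels the
  -- pairing. It is nonzero because a is.
  · have hsw := sr_smul_weightSpace hw
    have hwt : -(((k : ℤ) + u : ℤ) : ZMod m) = (((k : ℤ) - u : ℤ) : ZMod m) := by
      by_contra h
      refine horth (B.orthogonal_weight h ?_ hh₁.2)
      simpa only [neg_mul, mul_neg] using hsw
    rw [hwt] at hh₂
    set a := B.form (grp m c (.sr 0) • w) h₁
    set b := B.form (grp m c (.sr 0) • w) h₂
    have hmem : b • h₁ + (-a) • h₂ ∈ weightSpace c (rho (m := m) u)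
        fun j => om (j * (((k : ℤ) - u : ℤ) : ZMod m)) :=
      add_mem (Submodule.smul_mem _ _ hh₁.2) (Submodule.smul_mem _ _ hh₂.2)
    refine ⟨b • h₁ + (-a) • h₂, fun h => ?_, add_mem (Submodule.smul_mem _ _ hh₁.1)
      (Submodule.smul_mem _ _ hh₂.1), hmem, B.orthogonal_weight hn hw hmem, ?_⟩
    · exact horth (neg_eq_zero.mp (comb _ _ h₂ q₂ e₂ h).2)
    · have e := map_add (B.form (grp m c (.sr 0) • w)) (b • h₁) (-a • h₂)
      rw [LinearMap.map_smul, LinearMap.map_smul, smul_eq_mul, smul_eq_mul] at e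
      refine e.trans ?_
      show b * a + -a * b = 0
      ring

/-- The involution s₀ is self-adjoint, so the two given orthogonality relations imply the other two.
-/
theorem orthogonal_blocks {w w' x y : StdMod c (rho (m := m) u)} (h1 : B.form w w' = 0)
    (h2 : B.form (grp m c (.sr 0) • w) w' = 0)
    (hx : x ∈ Submodule.span ℂ {w, grp m c (.sr 0) • w})
    (hy : y ∈ Submodule.span ℂ {w', grp m c (.sr 0) • w'}) : B.form x y = 0 := by
  obtain ⟨α, β, rfl⟩ := Submodule.mem_span_pair.mp hx
  obtain ⟨γ, δ, rfl⟩ := Submodule.mem_span_pair.mp hy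
  have h3 : B.form w (grp m c (.sr 0) • w') = 0 := by rw [← B.adj_sr, h2]
  have h4 : B.form (grp m c (.sr 0) • w) (grp m c (.sr 0) • w') = 0 := by
    rw [B.adj_sr, sr_sr_smul, h1]
  simp only [map_add, map_smul, map_smulₛₗ, LinearMap.add_apply, LinearMap.smul_apply, h1, h2, h3,
    h4, smul_zero, add_zero]

-- Blocks of weights k + u and k − u, chosen orthogonal to each other, yield four pairwise
-- orthogonal eigenvectors. The harmonics have dimension at most 2 · 2, so these form a basis.
-- Orthogonality between the blocks cannot be read off from the eigenvalues, since a and b may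
-- coincide.
include B hc hu hum in
theorem rho_harm (ε : ℝ) {k : ℕ} (hk : 0 < k) {a b : ℝ}
    (ha : a = lamPlus ε 0 k (sigmaNum c (k + u))) (hb : b = lamPlus ε 0 k (sigmaNum c (k - u))) :
    ∃ v : Fin 4 → StdMod c (rho (m := m) u), LinearIndependent ℂ v ∧
      (∀ i, ∀ x : Cent m c ε, x • v i ∈ Submodule.span ℂ {v i}) ∧
      harm c (rho (m := m) u) k = Submodule.span ℂ (Set.range v) ∧
      ∀ l : ℝ, harmonics c (rho u) ε k l =
        Submodule.span ℂ (v '' {i | (![a, -a, b, -b] : Fin 4 → ℝ) i = l}) := by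
  have hN := sigma_smul_incl_rho hc hu hum
  obtain ⟨hs1, hs2⟩ := B.rho_sq_lt hc hu hum hk
  obtain ⟨-, ha0, ha2⟩ := lamPlus_sq (ε := ε) hs1
  obtain ⟨-, hb0, hb2⟩ := lamPlus_sq (ε := ε) hs2
  rw [← ha] at ha0 ha2
  rw [← hb] at hb0 hb2
  obtain ⟨h, hh, q, hq⟩ := B.exists_harm_weight hN one_pos.gt (zC_pow_mem k _)
    (zC_pow_e0_weight (c := c) (u := u) k)
  have hne : h ≠ 0 := by
    rintro rfl
    have : extremal c (rho u) k (![1, 0], 0) = Eplus m c • q := by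
      rw [extremal_apply, map_zero, smul_zero, add_zero, hq, zero_add]
    exact e0_ne_zero (extremal_eq_zero_of_Eplus hc hk this).1
  obtain ⟨w, hw, hw0, μ, hμ⟩ := exists_Z0_eigenvector
    (W := harm c (rho u) k ⊓ weightSpace c (rho u) _) inf_le_left
    (fun x hx => ⟨Z0_smul_harm hx.1, Z0_smul_weightSpace hx.2⟩)
    ((Submodule.ne_bot_iff _).mpr ⟨h, hh, hne⟩)
  obtain ⟨h', hne', hh', hh'w, hwh, hswh⟩ := B.exists_second_weight hc hu hum hk hw.2
  -- The orthogonal complement of the first block is stable under the self-adjoint Z₀, because w and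
  -- s₀w are Z₀-eigenvectors. So the second block can be started from a Z₀-eigenvector inside that
  -- complement.
  obtain ⟨w', hw', hw0', μ', hμ'⟩ := exists_Z0_eigenvector
    (W := harm c (rho u) k ⊓ weightSpace c (rho u)
      (fun j => om (j * (((k : ℤ) - u : ℤ) : ZMod m))) ⊓
      (LinearMap.ker (B.form w) ⊓ LinearMap.ker (B.form (grp m c (.sr 0) • w))))
    (inf_le_left.trans inf_le_left)
    (fun x hx => ⟨⟨Z0_smul_harm hx.1.1, Z0_smul_weightSpace hx.1.2⟩, by
      rw [SetLike.mem_coe, LinearMap.mem_ker, ← B.adj_Z0, hμ, map_smulₛₗ, LinearMap.smul_apply,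
        LinearMap.mem_ker.mp hx.2.1, smul_zero], by
      rw [SetLike.mem_coe, LinearMap.mem_ker, ← B.adj_Z0, Z0_smul_sr hμ, map_smulₛₗ,
        LinearMap.smul_apply, LinearMap.mem_ker.mp hx.2.2, smul_zero]⟩)
    ((Submodule.ne_bot_iff _).mpr ⟨h', ⟨⟨hh', hh'w⟩, hwh, hswh⟩, hne'⟩)
  obtain ⟨v1, v10, v1h, v1W, v1Z, v1c⟩ := exists_eigenline hc hN (ε := ε) hw.1 hw0 hw.2 hμ
    (sum_om_mul hc _) hs1 ha0.ne' ha2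
  obtain ⟨v2, v20, v2h, v2W, v2Z, v2c⟩ := exists_eigenline hc hN (ε := ε) hw.1 hw0 hw.2 hμ
    (sum_om_mul hc _) hs1 (neg_ne_zero.mpr ha0.ne') (by rw [neg_sq, ha2])
  obtain ⟨v3, v30, v3h, v3W, v3Z, v3c⟩ := exists_eigenline hc hN (ε := ε) hw'.1.1 hw0' hw'.1.2 hμ'
    (sum_om_mul hc _) hs2 hb0.ne' hb2
  obtain ⟨v4, v40, v4h, v4W, v4Z, v4c⟩ := exists_eigenline hc hN (ε := ε) hw'.1.1 hw0' hw'.1.2 hμ'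
    (sum_om_mul hc _) hs2 (neg_ne_zero.mpr hb0.ne') (by rw [neg_sq, hb2])
  have o12 : B.form v1 v2 = 0 := orthogonal (B.adj_Ztilde ε) v1Z v2Z fun h => by
    have : a = -a := by exact_mod_cast h
    linarith
  have o34 : B.form v3 v4 = 0 := orthogonal (B.adj_Ztilde ε) v3Z v4Z fun h => by
    have : b = -b := by exact_mod_cast h
    linarith
  have hblock {x y} := B.orthogonal_blocks (x := x) (y := y) hw'.2.1 hw'.2.2
  have o13 := hblock v1W v3W
  have o14 := hblock v1W v4W
  have o23 := hblock v2W v3W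
  have o24 := hblock v2W v4W
  obtain ⟨f1, f2, f3⟩ := B.harmonics_eq_span (ε := ε) (k := k) (v := ![v1, v2, v3, v4])
    (e := ![a, -a, b, -b])
    (by intro i; fin_cases i; exacts [v1h, v2h, v3h, v4h])
    (by intro i; fin_cases i; exacts [v10, v20, v30, v40])
    (by intro i; fin_cases i; exacts [v1Z, v2Z, v3Z, v4Z])
    (by
      intro i j hij
      fin_cases i <;> fin_cases j <;> first
        | exact absurd rfl hij
        | exact o12 | exact o13 | exact o14 | exact o23 | exact o24 | exact o34
        | exact B.form_symm_zero o12 | exact B.form_symm_zero o13 | exact B.form_symm_zero o14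
        | exact B.form_symm_zero o23 | exact B.form_symm_zero o24 | exact B.form_symm_zero o34)
    (by simpa using B.finrank_harm_le hN one_pos.gt k)
  exact ⟨_, f1, by intro i; fin_cases i; exacts [v1c, v2c, v3c, v4c], f2, f3⟩

end UForm

theorem Lam_zero (ε : ℝ) : Lam c ε u 0 = {0} := if_pos rfl

theorem Lam_eq_range (ε : ℝ) {k : ℕ} (hk : 0 < k) {a b : ℝ}
    (ha : a = lamPlus ε 0 k (sigmaNum c (k + u))) (hb : b = lamPlus ε 0 k (sigmaNum c (k - u))) :
    Lam c ε u k = Set.range ![a, -a, b, -b] := by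
  rw [Lam, if_neg hk.ne', ← ha, ← hb]
  simp only [Matrix.range_cons, Matrix.range_empty, Set.union_empty, Set.insert_eq]

include hc hu hum in
theorem decomposition_rho (ε : ℝ) (hU : IsUnitarisable c (rho (m := m) u)) :
    (∀ k : ℕ, 0 < k → 0 ≤ (k : ℝ) ^ 2 - (1 - ε ^ 2) * sigmaNum c (k + u) ^ 2 ∧
      0 ≤ (k : ℝ) ^ 2 - (1 - ε ^ 2) * sigmaNum c (k - u) ^ 2) ∧
    ∃ S : ((k : ℕ) × Lam c ε u k) → Submodule (Cent m c ε) (StdMod c (rho (m := m) u)),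
      IsJointDecomposition c (rho (m := m) u) ε 0 (fun i => i.1) (fun i => (i.2 : ℝ)) S ∧
      (∀ l : Lam c ε u 0, (S ⟨0, l⟩ : Set (StdMod c (rho (m := m) u))) =
        Set.range (incl c (rho (m := m) u))) ∧
      ∀ k : ℕ, 0 < k → ((Lam c ε u k).ncard = 4 ∨ (Lam c ε u k).ncard = 2) ∧
        ((Lam c ε u k).ncard = 4 → ∀ l : Lam c ε u k, Module.finrank ℂ (S ⟨k, l⟩) = 1 ∧
          IsSimpleModule (Cent m c ε) (S ⟨k, l⟩)) ∧
        ((Lam c ε u k).ncard = 2 → ∀ l : Lam c ε u k, Module.finrank ℂ (S ⟨k, l⟩) = 2 ∧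
          ∃ A B : Submodule (Cent m c ε) (S ⟨k, l⟩), IsSimpleModule (Cent m c ε) A ∧
            IsSimpleModule (Cent m c ε) B ∧ IsCompl A B) := by
  obtain ⟨β, h1, h2, h3, h4, h5⟩ := hU
  let B : UForm c (rho (m := m) u) := ⟨β, h1, h2, h3, h4, h5⟩
  have hN := sigma_smul_incl_rho hc hu hum
  have hzero : harmonics c (rho (m := m) u) ε 0 0 = LinearMap.range (incl c (rho u)) := by
    rw [← harmonics_zero hN ε, mul_zero]
  refine ⟨fun k hk => ?_, fun i => B.harmSub hN ε i.1 i.2,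
    B.isJointDecomposition hN one_pos.gt _ _ ?_ ?_, ?_, ?_⟩
  · obtain ⟨hs1, hs2⟩ := B.rho_sq_lt hc hu hum hk
    have e1 := (lamPlus_sq (ε := ε) hs1).1
    have e2 := (lamPlus_sq (ε := ε) hs2).1
    rw [sub_zero] at e1 e2
    exact ⟨e1, e2⟩
  · rintro ⟨k, l, hl⟩ ⟨k', l', hl'⟩ h h'
    obtain rfl : k = k' := h
    obtain rfl : l = l' := h'
    rfl
  · intro k
    rcases Nat.eq_zero_or_pos k with rfl | hk
    · refine harm_zero.trans ?_
      rw [← hzero]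
      exact le_iSup (fun i : (k : ℕ) × Lam c ε u k => harmonics c (rho u) ε i.1 i.2)
        ⟨0, 0, by rw [Lam_zero]; rfl⟩
    · obtain ⟨v, -, -, hspan, heig⟩ := B.rho_harm hc hu hum ε hk rfl rfl
      rw [hspan, Submodule.span_le]
      rintro _ ⟨i, rfl⟩
      refine (le_iSup (fun i : (k : ℕ) × Lam c ε u k => harmonics c (rho u) ε i.1 i.2)
        ⟨k, _, by rw [Lam_eq_range ε hk rfl rfl]; exact ⟨i, rfl⟩⟩) ?_
      rw [heig]
      exact Submodule.subset_span ⟨i, rfl, rfl⟩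
  · rintro ⟨l, hl⟩
    obtain rfl : l = 0 := by rwa [Lam_zero] at hl
    show (harmonics c (rho u) ε 0 0 : Set (StdMod c (rho (m := m) u))) = _
    rw [hzero, LinearMap.coe_range]
  · intro k hk
    obtain ⟨a, ha⟩ : ∃ a, a = lamPlus ε 0 k (sigmaNum c (k + u)) := ⟨_, rfl⟩
    obtain ⟨b, hb⟩ : ∃ b, b = lamPlus ε 0 k (sigmaNum c (k - u)) := ⟨_, rfl⟩
    obtain ⟨v, hind, hv, -, heig⟩ := B.rho_harm hc hu hum ε hk ha hb
    obtain ⟨hs1, hs2⟩ := B.rho_sq_lt hc hu hum hk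
    have ha0 := (lamPlus_sq (ε := ε) hs1).2.1
    have hb0 := (lamPlus_sq (ε := ε) hs2).2.1
    rw [← ha] at ha0
    rw [← hb] at hb0
    have hLam := Lam_eq_range ε hk ha hb
    -- As a and b are positive, the four numbers ±a, ±b can coincide only through a = b.
    by_cases hab : a = b
    · subst hab
      have hLam' : Lam c ε u k = {a, -a} := by
        rw [hLam]
        simp only [Matrix.range_cons, Matrix.range_empty, Set.union_empty]
        ext x
        simp only [Set.mem_union, Set.mem_singleton_iff, Set.mem_insert_iff]
        tauto
      have hcard : (Lam c ε u k).ncard = 2 := by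
        rw [hLam']; exact Set.ncard_pair (by linarith)
      refine ⟨Or.inr hcard, fun h => by omega, ?_⟩
      rintro - ⟨l, hl⟩
      -- Each eigenvalue then occurs exactly twice, once in each block, and the two stable lines are
      -- the two simple summands.
      obtain ⟨i, j, hij, hset⟩ : ∃ i j : Fin 4, i ≠ j ∧
          {i | (![a, -a, a, -a] : Fin 4 → ℝ) i = l} = {i, j} := by
        have hne : a ≠ -a := by linarith
        rw [hLam'] at hl
        rcases hl with rfl | rfl
        · refine ⟨0, 2, by decide, ?_⟩
          ext i; fin_cases i <;> simp [hne.symm]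
        · refine ⟨1, 3, by decide, ?_⟩
          ext i; fin_cases i <;> simp [hne]
      refine exists_isCompl_lines (v := v i) (v' := v j) _ ?_ (hv i) (hv j) ?_
      · have := hind.comp ![i, j] (by
          intro x y hxy
          fin_cases x <;> fin_cases y <;> simp_all)
        convert this using 1
        ext x; fin_cases x <;> rfl
      · show (harmonics c (rho u) ε k l : Set (StdMod c (rho (m := m) u))) = _
        rw [heig, hset, Set.image_pair]
    · have hinj : Function.Injective (![a, -a, b, -b] : Fin 4 → ℝ) := by
        intro i j hij
        fin_cases i <;> fin_cases j <;> simp at hij ⊢ <;> first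
          | exact hab hij | exact hab hij.symm | linarith
      have hcard : (Lam c ε u k).ncard = 4 := by
        rw [hLam, Set.ncard_range_of_injective hinj, Nat.card_fin]
      refine ⟨Or.inl hcard, ?_, fun h => by omega⟩
      rintro - ⟨l, hl⟩
      rw [hLam] at hl
      obtain ⟨i, rfl⟩ := hl
      have hfin : Module.finrank ℂ
          (B.harmSub hN ε k ((![a, -a, b, -b] : Fin 4 → ℝ) i)) = 1 := by
        rw [finrank_eq_of_coe (W := harmonics c (rho u) ε k _) rfl, heig,
          show {i' | (![a, -a, b, -b] : Fin 4 → ℝ) i' = ![a, -a, b, -b] i} = {i} from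
            Set.ext fun i' => hinj.eq_iff, Set.image_singleton]
        exact finrank_span_singleton (hind.ne_zero i)
      exact ⟨hfin, isSimpleModule_of_finrank_one hfin⟩

end fixed

end twoDimensional

end

end DihedralCherednik

/-! ### The main theorem -/

theorem mainTheorem4 (m : ℕ) [NeZero m] (c : ZMod m → ℝ)
    (hc : ∀ i j : ZMod m, IsConj (DihedralGroup.sr i) (DihedralGroup.sr j) → c i = c j) (ε : ℝ) :
    -- one-dimensional representations
    (∀ χ : DihedralGroup m →* ℂ,
      IsSimpleModule (DihedralCherednik.RCA m c)
        (DihedralCherednik.StdMod c (DihedralCherednik.charRep χ)) →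
      DihedralCherednik.IsUnitarisable c (DihedralCherednik.charRep χ) →
      (∀ k : ℕ, 0 < k → 0 ≤ ((k : ℝ) - DihedralCherednik.Nc c χ) ^ 2 -
        (1 - ε ^ 2) * DihedralCherednik.sigmaChar c χ k ^ 2) ∧
      Function.Injective (DihedralCherednik.incl c (DihedralCherednik.charRep χ)) ∧
      ∃ S : ℤ → Submodule (DihedralCherednik.Cent m c ε)
          (DihedralCherednik.StdMod c (DihedralCherednik.charRep χ)),
        DihedralCherednik.IsJointDecomposition c (DihedralCherednik.charRep χ) ε
          (DihedralCherednik.Nc c χ) Int.natAbs (DihedralCherednik.lamChar c ε χ) S ∧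
        (S 0 : Set (DihedralCherednik.StdMod c (DihedralCherednik.charRep χ))) =
          Set.range (DihedralCherednik.incl c (DihedralCherednik.charRep χ)) ∧
        ∀ k : ℤ, Module.finrank ℂ (S k) = 1 ∧
          IsSimpleModule (DihedralCherednik.Cent m c ε) (S k)) ∧
    -- two-dimensional representations
    (∀ u : ℕ, 0 < u → 2 * u < m →
      IsSimpleModule (DihedralCherednik.RCA m c)
        (DihedralCherednik.StdMod c (DihedralCherednik.rho (m := m) u)) →
      DihedralCherednik.IsUnitarisable c (DihedralCherednik.rho (m := m) u) →
      (∀ k : ℕ, 0 < k →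
        0 ≤ (k : ℝ) ^ 2 - (1 - ε ^ 2) * DihedralCherednik.sigmaNum c (k + u) ^ 2 ∧
        0 ≤ (k : ℝ) ^ 2 - (1 - ε ^ 2) * DihedralCherednik.sigmaNum c (k - u) ^ 2) ∧
      Function.Injective (DihedralCherednik.incl c (DihedralCherednik.rho (m := m) u)) ∧
      ∃ S : ((k : ℕ) × DihedralCherednik.Lam c ε u k) → Submodule (DihedralCherednik.Cent m c ε)
          (DihedralCherednik.StdMod c (DihedralCherednik.rho (m := m) u)),
        DihedralCherednik.IsJointDecomposition c (DihedralCherednik.rho (m := m) u) ε 0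
          (fun i => i.1) (fun i => (i.2 : ℝ)) S ∧
        (∀ l : DihedralCherednik.Lam c ε u 0,
          (S ⟨0, l⟩ : Set (DihedralCherednik.StdMod c (DihedralCherednik.rho (m := m) u))) =
            Set.range (DihedralCherednik.incl c (DihedralCherednik.rho (m := m) u))) ∧
        ∀ k : ℕ, 0 < k →
          ((DihedralCherednik.Lam c ε u k).ncard = 4 ∨
            (DihedralCherednik.Lam c ε u k).ncard = 2) ∧
          ((DihedralCherednik.Lam c ε u k).ncard = 4 →
            ∀ l : DihedralCherednik.Lam c ε u k, Module.finrank ℂ (S ⟨k, l⟩) = 1 ∧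
              IsSimpleModule (DihedralCherednik.Cent m c ε) (S ⟨k, l⟩)) ∧
          ((DihedralCherednik.Lam c ε u k).ncard = 2 →
            ∀ l : DihedralCherednik.Lam c ε u k, Module.finrank ℂ (S ⟨k, l⟩) = 2 ∧
              ∃ A B : Submodule (DihedralCherednik.Cent m c ε) (S ⟨k, l⟩),
                IsSimpleModule (DihedralCherednik.Cent m c ε) A ∧
                IsSimpleModule (DihedralCherednik.Cent m c ε) B ∧ IsCompl A B)) := by
  refine ⟨fun χ _ hU => ?_, fun u hu hum _ hU => ?_⟩
  · obtain ⟨h1, h2⟩ := DihedralCherednik.decomposition_char hc χ ε hU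
    exact ⟨h1, DihedralCherednik.incl_injective _ hc, h2⟩
  · obtain ⟨h1, h2⟩ := DihedralCherednik.decomposition_rho hc hu hum ε hU
    exact ⟨h1, DihedralCherednik.incl_injective _ hc, h2⟩
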